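/- Let $1\le m\le n$ be integers. Let $(x_1,\dots,x_m)$ be a random vector in $[0,1]^m$ whose joint probability density is proportional to $$\prod_{1\le i<j\le m}(x_i^2-x_j^2)^2\prod_{i=1}^m(1-x_i^2)^{n-m}$$ (the eigenvalue density of the ensemble of fermionic Gaussian states with an arbitrary number of particles, for subsystem dimensions $m\le n$). Let $$S=-\sum_{i=1}^m v(x_i),\qquad v(x)=\frac{1-x}{2}\ln\frac{1-x}{2}+\frac{1+x}{2}\ln\frac{1+x}{2}\quad(0\ln 0=0),$$ be the von Neumann entropy. Then $S$ is square integrable and its variance is $$\mathbb V[S]=\Big(\tfrac12-m-n\Big)\psi_1(2m+2n)+\Big(n-\tfrac12\Big)\psi_1(2n)+\Big(\frac{m(2m+n-1)}{2m+2n-1}-\frac18\Big)\psi_1(m+n)+\frac{\psi_1(n)}{8}-\frac12\big(\psi_0(2m+2n)-\psi_0(2n)\big),$$ where $\psi_0(x)=\frac{d}{dx}\ln\Gamma(x)$ and $\psi_1(x)=\frac{d^2}{dx^2}\ln\Gamma(x)$ are the digamma and trigamma functions. -/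

import Mathlib

open MeasureTheory ProbabilityTheory

namespace FermionicGaussian

/-- The digamma function `ψ₀(x) = d ln Γ(x) / dx` (used at positive arguments, where `Γ > 0`). -/
noncomputable def digamma (x : ℝ) : ℝ :=
  deriv (fun t : ℝ => Real.log (Real.Gamma t)) x

/-- The trigamma function `ψ₁(x) = d² ln Γ(x) / dx²` (used at positive arguments). -/
noncomputable def trigamma (x : ℝ) : ℝ :=
  iteratedDeriv 2 (fun t : ℝ => Real.log (Real.Gamma t)) x

/-- `v(x) = (1-x)/2 · ln((1-x)/2) + (1+x)/2 · ln((1+x)/2)`, with `0 · ln 0 = 0`. -/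
noncomputable def v (x : ℝ) : ℝ :=
  (1 - x) / 2 * Real.log ((1 - x) / 2) + (1 + x) / 2 * Real.log ((1 + x) / 2)

/-- The von Neumann entropy `S = -∑ v(xᵢ)` as a function of the eigenvalues `x₁, …, x_m`. -/
noncomputable def entropy (m : ℕ) (x : Fin m → ℝ) : ℝ :=
  -∑ i, v (x i)

/-- The unnormalised joint eigenvalue density
`∏_{i<j} (xᵢ² - xⱼ²)² ∏ᵢ (1 - xᵢ²)^(n-m)`; it is used for `m ≤ n` only. -/
noncomputable def weight (m n : ℕ) (x : Fin m → ℝ) : ℝ :=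
  (∏ i : Fin m, ∏ j ∈ Finset.Ioi i, (x i ^ 2 - x j ^ 2) ^ 2) *
    ∏ i : Fin m, (1 - x i ^ 2) ^ (n - m)

/-- The measure on `ℝᵐ` with Lebesgue density `weight m n` on the cube `[0,1]ᵐ`. -/
noncomputable def unnormalizedLaw (m n : ℕ) : Measure (Fin m → ℝ) :=
  (volume.restrict (Set.univ.pi fun _ : Fin m => Set.Icc (0 : ℝ) 1)).withDensity
    fun x => ENNReal.ofReal (weight m n x)

/-- The joint law of the eigenvalues: the probability measure on `[0,1]ᵐ` whose density is
proportional to `weight m n`. -/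
noncomputable def eigenvalueLaw (m n : ℕ) : Measure (Fin m → ℝ) :=
  (unnormalizedLaw m n Set.univ)⁻¹ • unnormalizedLaw m n

end FermionicGaussian

namespace FermionicGaussian

open Filter Topology

/-! Put `a = n - m`. The density contains a squared Vandermonde determinant in the squares of the `x
i`. Up to a constant it is therefore `(1-x²)^a` in each variable times the squared determinant of
`p_j = orthoPoly a j`, `j < m`, the even ultraspherical polynomials orthonormal on `[0,1]` for that
weight. For such a determinantal ensemble the variance of `∑ v(x i)` is `∑_{j<m} (⟨v² p_j, p_j⟩ -
∑_{k<m} ⟨v p_j, p_k⟩²)` (`integral_entropy`, `integral_entropy_sq`), and Parseval's identity turns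
this into `∑_{j<m≤k} ⟨v p_j, p_k⟩²` (`sum_unitInt_sub_sum_sq`).

These matrix elements are explicit. Reflection replaces `v` on `[0,1]` by `(1-x) ln(1-x)` on
`[-1,1]`, up to a `ln 2` term that orthogonality removes. Lagrange's identity for the ultraspherical
equation, integrated by parts against `ln(1-x)`, gives the matrix elements of `ln(1-x)` as a
constant depending on the larger degree divided by a difference of eigenvalues; the three-term
recurrence supplies the factor `1-x`. In the shifted indices `s = a+i`, `t = a+l` the eigenvalue
difference is `(t-s)(t+s+1)`, and the normalised square is `entTerm a s t` (`logInt_sq_div`).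

The double sum is evaluated by induction on `m` with `a` fixed. Passing from `m` to `m+1` adds a row
and removes a column, both through `s = a+2m`, so only the difference `entSum` of a row and a column
sum is needed. Partial fractions split it into sums with double poles (`logTerm`) and with simple
poles (`rowTerm`, `colTerm`). Row minus column of the simple-pole sums has a closed form, because
the change under `s → s+2` telescopes. Row minus column of the double-pole sums changes under `a →
a+1` by a multiple of that closed form, so it reduces to `a = 0`, where the gamma ratios disappear
and the trigamma series remains. The resulting increments are those of `varianceFormula`. -/

/-! ### Digamma and trigamma: recurrences and series -/

lemma hasDerivAt_log_Gamma {x : ℝ} (hx : 0 < x) :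
    HasDerivAt (fun t : ℝ => Real.log (Real.Gamma t)) (digamma x) x := by
  have h1 : DifferentiableAt ℝ Real.Gamma x :=
    Real.differentiableAt_Gamma fun m => by
      have : (0 : ℝ) ≤ m := m.cast_nonneg
      linarith
  exact (h1.log (Real.Gamma_pos_of_pos hx).ne').hasDerivAt

lemma digamma_add_one {x : ℝ} (hx : 0 < x) : digamma (x + 1) = digamma x + 1 / x := by
  have h1 := (hasDerivAt_log_Gamma (show 0 < x + 1 by linarith)).comp_add_const x 1
  have h2 := (hasDerivAt_log_Gamma hx).add (Real.hasDerivAt_log hx.ne')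
  have h3 : (fun t : ℝ => Real.log (Real.Gamma (t + 1)))
      =ᶠ[𝓝 x] ((fun t : ℝ => Real.log (Real.Gamma t)) + Real.log) := by
    filter_upwards [lt_mem_nhds hx] with t ht
    rw [Real.Gamma_add_one ht.ne', Real.log_mul ht.ne' (Real.Gamma_pos_of_pos ht).ne']
    simp [add_comm]
  have h4 := h1.unique (h2.congr_of_eventuallyEq h3)
  rw [h4, one_div]

/-- By `Γ(x+1) = x Γ(x)` the chord of `ln Γ` over `[x, x+1]` has slope `ln x`; convexity places it
between the derivatives at the two ends. -/
lemma digamma_le_log {x : ℝ} (hx : 0 < x) :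
    digamma x ≤ Real.log x ∧ Real.log x ≤ digamma (x + 1) := by
  have hc : ConvexOn ℝ (Set.Ioi 0) (fun t : ℝ => Real.log (Real.Gamma t)) :=
    Real.convexOn_log_Gamma
  have hx1 : 0 < x + 1 := by linarith
  have hs : slope (fun t : ℝ => Real.log (Real.Gamma t)) x (x + 1) = Real.log x := by
    rw [slope_def_field, Real.Gamma_add_one hx.ne',
      Real.log_mul hx.ne' (Real.Gamma_pos_of_pos hx).ne']
    ring
  constructor
  · rw [← hs]
    exact hc.le_slope_of_hasDerivAt hx hx1 (by linarith) (hasDerivAt_log_Gamma hx)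
  · rw [← hs]
    exact hc.slope_le_of_hasDerivAt hx hx1 (by linarith) (hasDerivAt_log_Gamma hx1)

lemma digamma_add_nat {x : ℝ} (hx : 0 < x) (n : ℕ) :
    digamma (x + n) = digamma x + ∑ k ∈ Finset.range n, 1 / (x + k) := by
  induction n with
  | zero => simp
  | succ n ih =>
    have : 0 < x + n := by positivity
    rw [Finset.sum_range_succ, ← add_assoc, ← ih, ← digamma_add_one this]
    push_cast
    ring_nf

lemma tendsto_log_add_sub_log (x y : ℝ) :
    Tendsto (fun n : ℕ => Real.log (x + n) - Real.log (y + n)) atTop (𝓝 0) := by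
  have h : ∀ z : ℝ, Tendsto (fun n : ℕ => Real.log (z + n) - Real.log n) atTop (𝓝 0) := by
    intro z
    have h1 : Tendsto (fun n : ℕ => 1 + z / (n : ℝ)) atTop (𝓝 1) := by
      simpa using (tendsto_const_div_atTop_nhds_zero_nat z).const_add 1
    have h2 := h1.log one_ne_zero
    rw [Real.log_one] at h2
    refine h2.congr' ?_
    have h3 : ∀ᶠ n : ℕ in atTop, -z < (n : ℝ) :=
      tendsto_natCast_atTop_atTop.eventually_gt_atTop _
    filter_upwards [eventually_gt_atTop 0, h3] with n hn hz
    have hn' : (0 : ℝ) < n := by exact_mod_cast hn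
    rw [← Real.log_div (by linarith) hn'.ne']
    congr 1
    field_simp
    ring
  simpa using (h x).sub (h y)

lemma tendsto_digamma_add_sub {x : ℝ} (hx : 0 < x) :
    Tendsto (fun n : ℕ => digamma (x + n) - Real.log (x + n)) atTop (𝓝 0) := by
  -- The lower bound is `ψ₀(y+1) ≥ ln y` at `y = x - 1 + n`, which is positive once `n ≥ 1`.
  have h0 := tendsto_log_add_sub_log (x - 1) x
  refine tendsto_of_tendsto_of_tendsto_of_le_of_le' h0 tendsto_const_nhds ?_ ?_
  · filter_upwards [eventually_ge_atTop 1] with n hn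
    have hn' : (1 : ℝ) ≤ n := by exact_mod_cast hn
    have := (digamma_le_log (show 0 < x - 1 + n by linarith)).2
    rw [show x - 1 + (n : ℝ) + 1 = x + n by ring] at this
    linarith
  · filter_upwards with n
    have := (digamma_le_log (show 0 < x + n by positivity)).1
    linarith

/-- The partial sums follow from the recurrence at `x` and at `1`; the remainders cancel because
`ψ₀` is asymptotic to the logarithm. -/
lemma hasSum_digamma {x : ℝ} (hx : 0 < x) :
    HasSum (fun k : ℕ => 1 / ((1 : ℝ) + k) - 1 / (x + k)) (digamma x - digamma 1) := by
  have hs : Summable (fun k : ℕ => 1 / ((1 : ℝ) + k) - 1 / (x + k)) := by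
    have h2 : Summable (fun k : ℕ => |x - 1| * (1 + 1 / x) * (1 / ((k : ℝ) + 1) ^ 2)) :=
      ((summable_nat_add_iff 1).2 (Real.summable_one_div_nat_pow.2 one_lt_two)).mul_left _
        |>.congr fun k => by push_cast; rfl
    refine Summable.of_norm_bounded h2 fun k => ?_
    have hk : (0 : ℝ) ≤ k := k.cast_nonneg
    have h3 : 1 / ((1 : ℝ) + k) - 1 / (x + k) = (x - 1) * (1 / ((1 + k) * (x + k))) := by
      field_simp
      ring
    rw [h3, norm_mul, Real.norm_eq_abs, mul_assoc]
    refine mul_le_mul_of_nonneg_left ?_ (abs_nonneg _)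
    rw [Real.norm_eq_abs, abs_of_pos (by positivity)]
    rw [show (1 + 1 / x) * (1 / ((k : ℝ) + 1) ^ 2) = (x + 1) / (x * (k + 1) ^ 2) by field_simp,
      div_le_div_iff₀ (by positivity) (by positivity)]
    nlinarith [mul_nonneg hk hk, mul_nonneg hk hx.le, mul_nonneg (mul_nonneg hk hk) hx.le]
  refine hs.hasSum_iff_tendsto_nat.2 ?_
  have h1 := tendsto_digamma_add_sub hx
  have h2 := tendsto_digamma_add_sub one_pos
  have h3 := tendsto_log_add_sub_log x 1
  have h4 := ((h2.sub h1).sub h3).const_add (digamma x - digamma 1)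
  simp only [sub_zero, add_zero] at h4
  refine h4.congr fun n => ?_
  rw [digamma_add_nat hx, digamma_add_nat one_pos, Finset.sum_sub_distrib]
  ring

/-- The series of the trigamma function. -/
theorem hasSum_trigamma {x : ℝ} (hx : 0 < x) :
    HasSum (fun k : ℕ => 1 / (x + k) ^ 2) (trigamma x) := by
  have hu : Summable (fun k : ℕ => (1 + 2 / x) ^ 2 * (1 / ((k : ℝ) + 1) ^ 2)) :=
    ((summable_nat_add_iff 1).2 (Real.summable_one_div_nat_pow.2 one_lt_two)).mul_left _
      |>.congr fun k => by push_cast; rfl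
  -- Termwise differentiation needs a bound uniform near `x`. For `y > x/2` one has `(1 + 2/x)(y+k)
  -- ≥ k + (2/x) y ≥ k + 1`.
  have hb : ∀ (k : ℕ) (y : ℝ), y ∈ Set.Ioi (x / 2) →
      ‖1 / (y + k) ^ 2‖ ≤ (1 + 2 / x) ^ 2 * (1 / ((k : ℝ) + 1) ^ 2) := by
    intro k y hy
    have hy' : x / 2 < y := hy
    have hy0 : 0 < y := by linarith
    rw [Real.norm_eq_abs, abs_of_pos (by positivity), mul_one_div, ← div_pow, ← one_div_pow]
    have hk : (0 : ℝ) ≤ k := k.cast_nonneg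
    refine pow_le_pow_left₀ (by positivity) ?_ 2
    rw [div_le_div_iff₀ (by positivity) (by positivity)]
    have h1 : 1 ≤ 2 / x * y := by
      rw [div_mul_eq_mul_div, le_div_iff₀ hx]
      linarith
    have h2 : 0 ≤ 2 / x * k := by positivity
    nlinarith
  have hd := hasDerivAt_tsum_of_isPreconnected (t := Set.Ioi (x / 2))
    (g := fun (k : ℕ) y => 1 / ((1 : ℝ) + k) - 1 / (y + k))
    (g' := fun (k : ℕ) y => 1 / (y + k) ^ 2) (y₀ := x) (y := x) hu isOpen_Ioi
    (convex_Ioi _).isPreconnected ?_ hb (by simp [hx]) (hasSum_digamma hx).summable (by simp [hx])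
  · have he : (fun y => ∑' k : ℕ, (1 / ((1 : ℝ) + k) - 1 / (y + k)))
        =ᶠ[𝓝 x] fun y => digamma y - digamma 1 := by
      filter_upwards [lt_mem_nhds hx] with y hy using (hasSum_digamma hy).tsum_eq
    have h1 := (he.hasDerivAt_iff.1 hd).add_const (digamma 1)
    simp only [sub_add_cancel] at h1
    have h2 : trigamma x = ∑' k : ℕ, 1 / (x + k) ^ 2 := by
      rw [trigamma, iteratedDeriv_succ, iteratedDeriv_one]
      exact h1.deriv
    rw [h2]
    exact (Summable.of_norm_bounded hu fun k => hb k x (by simp [hx])).hasSum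
  · intro k y hy
    have hy' : x / 2 < y := hy
    have hy0 : 0 < y + k := by
      have : (0 : ℝ) ≤ k := k.cast_nonneg
      linarith
    have := (((hasDerivAt_id y).add_const (k : ℝ)).inv hy0.ne').const_sub (1 / ((1 : ℝ) + k))
    simpa [one_div, neg_div] using this

lemma trigamma_add_one {x : ℝ} (hx : 0 < x) : trigamma (x + 1) = trigamma x - 1 / x ^ 2 := by
  have h := (hasSum_nat_add_iff' 1).2 (hasSum_trigamma hx)
  have h1 := hasSum_trigamma (show 0 < x + 1 by linarith)
  have h2 := h1.unique (h.congr_fun fun k => by push_cast; ring_nf)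
  simpa using h2

/-! ### The gamma ratio as a polynomial -/

/-- The polynomial `∏_{k<a} (s-k)(s+k+1)`, equal to `Γ(s+a+1)/Γ(s-a+1)`. -/
noncomputable def gammaRatio (a : ℕ) (s : ℝ) : ℝ :=
  ∏ k ∈ Finset.range a, ((s - k) * (s + k + 1))

lemma gammaRatio_zero (s : ℝ) : gammaRatio 0 s = 1 := by simp [gammaRatio]

lemma gammaRatio_succ (a : ℕ) (s : ℝ) :
    gammaRatio (a + 1) s = gammaRatio a s * ((s - a) * (s + a + 1)) := by
  simp [gammaRatio, Finset.prod_range_succ]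

lemma gammaRatio_add_one (a : ℕ) (s : ℝ) :
    gammaRatio a (s + 1) * (s + 1 - a) = gammaRatio a s * (s + 1 + a) := by
  induction a with
  | zero => simp [gammaRatio_zero]
  | succ a ih =>
    rw [gammaRatio_succ, gammaRatio_succ]
    push_cast
    linear_combination (s + a + 2) * (s - a) * ih

lemma gammaRatio_add_two (a : ℕ) (s : ℝ) :
    gammaRatio a (s + 2) * ((s + 1 - a) * (s + 2 - a)) =
      gammaRatio a s * ((s + 1 + a) * (s + 2 + a)) := by
  have h1 := gammaRatio_add_one a s
  have h2 := gammaRatio_add_one a (s + 1)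
  rw [show s + 1 + 1 = s + 2 by ring] at h2
  linear_combination (s + 1 - a) * h2 + (s + 2 + a) * h1

lemma gammaRatio_pos {a : ℕ} {s : ℝ} (h : (a : ℝ) ≤ s) : 0 < gammaRatio a s := by
  refine Finset.prod_pos fun k hk => ?_
  have h1 : (k : ℝ) + 1 ≤ a := by exact_mod_cast Finset.mem_range.1 hk
  have h2 : (0 : ℝ) ≤ k := k.cast_nonneg
  exact mul_pos (by linarith) (by linarith)

lemma gammaRatio_mono {a : ℕ} {s t : ℝ} (h : (a : ℝ) ≤ s) (hst : s ≤ t) :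
    gammaRatio a s ≤ gammaRatio a t := by
  refine Finset.prod_le_prod (fun k hk => ?_) fun k hk => ?_
  all_goals
    have h1 : (k : ℝ) + 1 ≤ a := by exact_mod_cast Finset.mem_range.1 hk
    have h2 : (0 : ℝ) ≤ k := k.cast_nonneg
  · exact mul_nonneg (by linarith) (by linarith)
  · exact mul_le_mul (by linarith) (by linarith) (by linarith) (by linarith)

/-- This zero lets column sums start at the parity `e ∈ {0,1}` rather than at `a`: the extra terms
vanish. -/
lemma gammaRatio_natCast_eq_zero {a s : ℕ} (h : s < a) : gammaRatio a (s : ℝ) = 0 :=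
  Finset.prod_eq_zero (Finset.mem_range.2 h) (by simp)

lemma tendsto_gammaRatio_atTop (a : ℕ) : Tendsto (gammaRatio (a + 1)) atTop atTop := by
  refine tendsto_atTop_mono' _ ?_ tendsto_id
  filter_upwards [eventually_ge_atTop ((a : ℝ) + 1)] with t ht
  have h0 : (0 : ℝ) ≤ a := a.cast_nonneg
  have h1 : gammaRatio a (a : ℝ) ≤ gammaRatio a t := gammaRatio_mono le_rfl (by linarith)
  have h2 : 1 ≤ gammaRatio a (a : ℝ) := by
    unfold gammaRatio
    refine Finset.prod_induction _ (fun y : ℝ => 1 ≤ y) (fun x y hx hy => ?_) le_rfl fun k hk => ?_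
    · nlinarith
    · have h1 : (k : ℝ) + 1 ≤ a := by exact_mod_cast Finset.mem_range.1 hk
      have h2 : (0 : ℝ) ≤ k := k.cast_nonneg
      nlinarith
  rw [gammaRatio_succ, id]
  have h3 : t ≤ (t - a) * (t + a + 1) := by nlinarith
  nlinarith

/-! ### Simple-pole row and column sums by telescoping -/

/-- The normalised logarithmic kernel summed over the larger index. -/
noncomputable def rowTerm (a : ℕ) (s t : ℝ) : ℝ :=
  gammaRatio (a + 1) s / gammaRatio (a + 1) t * ((t + 1 / 2) / ((t - s) * (t + s + 1)))

/-- The normalised logarithmic kernel summed over the smaller index. -/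
noncomputable def colTerm (a : ℕ) (u s : ℝ) : ℝ :=
  gammaRatio a u / gammaRatio a s * ((u + 1 / 2) / ((s - u) * (s + u + 1)))

/-- The telescoping certificate for `rowTerm`. -/
noncomputable def rowCert (b : ℕ) (s t : ℝ) : ℝ :=
  -(s + 3 / 2) * gammaRatio b (s + 2) / gammaRatio b t * ((t + b) * (t + b - 1)) /
    ((s + b + 1) * (s + b + 2) * ((t - s - 2) * (t + s + 1)))

/-- The telescoping certificate for `colTerm`. -/
noncomputable def colCert (a : ℕ) (s u : ℝ) : ℝ :=
  (s + 3 / 2) * gammaRatio a u / gammaRatio a s * ((u - a) * (u - a - 1)) /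
    ((s + a + 1) * (s + a + 2) * ((u - s - 2) * (u + s + 1)))

/-- A telescoping identity of Wilf–Zeilberger type: a shift of `s` in the summand is a shift of `t`
in the certificate. Once the gamma ratios are referred to common values it is an identity of
rational functions. -/
lemma rowTerm_sub {a : ℕ} {s t : ℝ} (hs : (a : ℝ) - 1 ≤ s) (ht : (a : ℝ) + 1 ≤ t)
    (hst : t ≠ s) (hst2 : t ≠ s + 2) (h1 : t + s + 1 ≠ 0) (h2 : t + s + 3 ≠ 0) :
    rowTerm a (s + 2) t - rowTerm a s t =
      rowCert (a + 1) s (t + 2) - rowCert (a + 1) s t := by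
  have h0 : (0 : ℝ) ≤ a := a.cast_nonneg
  have hP : gammaRatio (a + 1) t ≠ 0 := (gammaRatio_pos (by push_cast; linarith)).ne'
  have hP2 : gammaRatio (a + 1) (t + 2) ≠ 0 := (gammaRatio_pos (by push_cast; linarith)).ne'
  have e1 := gammaRatio_add_two (a + 1) s
  have e2 := gammaRatio_add_two (a + 1) t
  push_cast at e1 e2
  have d1 : s + a + 2 ≠ 0 := by linarith
  have d2 : s + a + 3 ≠ 0 := by linarith
  have d3 : t - a ≠ 0 := by linarith
  have d4 : t + 1 - a ≠ 0 := by linarith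
  have d5 : t + a + 2 ≠ 0 := by linarith
  have d6 : t + a + 3 ≠ 0 := by linarith
  -- The value at `s` is expressed through the one at `s + 2`; the reverse would divide by
  -- `(s-a)(s+1-a)`, which vanishes at the admissible points `s = a - 1` and `s = a`.
  have e1' : gammaRatio (a + 1) s =
      gammaRatio (a + 1) (s + 2) * ((s - a) * (s + 1 - a)) / ((s + a + 2) * (s + a + 3)) := by
    rw [eq_div_iff (mul_ne_zero d1 d2)]
    linear_combination -e1
  have e2' : gammaRatio (a + 1) t =
      gammaRatio (a + 1) (t + 2) * ((t - a) * (t + 1 - a)) / ((t + a + 2) * (t + a + 3)) := by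
    rw [eq_div_iff (mul_ne_zero d5 d6)]
    linear_combination -e2
  have g1 : t - s ≠ 0 := sub_ne_zero.2 hst
  have g2 : t - s - 2 ≠ 0 := by rw [sub_sub]; exact sub_ne_zero.2 hst2
  unfold rowTerm rowCert
  rw [e1', e2']
  generalize gammaRatio (a + 1) (t + 2) = Q at *
  generalize gammaRatio (a + 1) (s + 2) = R at *
  push_cast
  rw [show t + (s + 2) + 1 = t + s + 3 by ring, show t - (s + 2) = t - s - 2 by ring,
    show s + ((a : ℝ) + 1) + 1 = s + a + 2 by ring, show s + ((a : ℝ) + 1) + 2 = s + a + 3 by ring,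
    show t + 2 - s - 2 = t - s by ring, show t + 2 + s + 1 = t + s + 3 by ring,
    show t + 2 + ((a : ℝ) + 1) = t + a + 3 by ring, show t + a + 3 - 1 = t + a + 2 by ring,
    show t + ((a : ℝ) + 1) = t + a + 1 by ring, show t + a + 1 - 1 = t + a by ring]
  field_simp
  ring

lemma colTerm_sub {a : ℕ} {s u : ℝ} (hs : (a : ℝ) ≤ s) (hsu : u ≠ s) (hsu2 : u ≠ s + 2)
    (h1 : u + s + 1 ≠ 0) (h2 : u + s + 3 ≠ 0) :
    colTerm a u (s + 2) - colTerm a u s = colCert a s (u + 2) - colCert a s u := by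
  have h0 : (0 : ℝ) ≤ a := a.cast_nonneg
  have hP : gammaRatio a s ≠ 0 := (gammaRatio_pos hs).ne'
  have e1 := gammaRatio_add_two a s
  have e2 := gammaRatio_add_two a u
  have d1 : s + 1 - a ≠ 0 := by linarith
  have d2 : s + 2 - a ≠ 0 := by linarith
  have d3 : s + 1 + a ≠ 0 := by linarith
  have d4 : s + 2 + a ≠ 0 := by linarith
  have e1' : gammaRatio a (s + 2) =
      gammaRatio a s * ((s + 1 + a) * (s + 2 + a)) / ((s + 1 - a) * (s + 2 - a)) := by
    rw [eq_div_iff (mul_ne_zero d1 d2), e1]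
  have g1 : s - u ≠ 0 := sub_ne_zero.2 hsu.symm
  have g2 : u - s - 2 ≠ 0 := by rw [sub_sub]; exact sub_ne_zero.2 hsu2
  have hz : colCert a s (u + 2) = (s + 3 / 2) * (gammaRatio a u * ((u + 1 + a) * (u + 2 + a))) /
      gammaRatio a s / ((s + 1 + a) * (s + 2 + a) * (-(s - u) * (u + s + 3))) := by
    rw [← e2, colCert]
    ring_nf
  rw [hz]
  unfold colTerm colCert
  rw [e1']
  generalize gammaRatio a u = Q at *
  generalize gammaRatio a s = R at *
  rw [show s + 2 + u + 1 = u + s + 3 by ring, show s + u + 1 = u + s + 1 by ring,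
    show s + 2 - u = -(u - s - 2) by ring, show s + a + 1 = s + 1 + a by ring,
    show s + a + 2 = s + 2 + a by ring]
  field_simp
  ring

lemma tendsto_add_div_add (c d : ℝ) : Tendsto (fun t : ℝ => (t + c) / (t + d)) atTop (𝓝 1) := by
  have h : Tendsto (fun t : ℝ => 1 + (c - d) / (t + d)) atTop (𝓝 (1 + 0)) :=
    ((tendsto_atTop_add_const_right _ d tendsto_id).const_div_atTop (c - d)).const_add 1
  rw [add_zero] at h
  refine h.congr' ?_
  filter_upwards [eventually_gt_atTop (-d)] with t ht
  have : t + d ≠ 0 := by linarith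
  field_simp
  ring

lemma tendsto_rowCert (b : ℕ) (s : ℝ) : Tendsto (rowCert (b + 1) s) atTop (𝓝 0) := by
  have h := (((tendsto_gammaRatio_atTop b).const_div_atTop
    (-(s + 3 / 2) * gammaRatio (b + 1) (s + 2) / ((s + (b + 1 : ℕ) + 1) * (s + (b + 1 : ℕ) + 2)))).mul
    (tendsto_add_div_add ((b + 1 : ℕ) : ℝ) (-s - 2))).mul
    (tendsto_add_div_add (((b + 1 : ℕ) : ℝ) - 1) (s + 1))
  rw [zero_mul, zero_mul] at h
  refine h.congr fun t => ?_
  unfold rowCert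
  rw [show t + (-s - 2) = t - s - 2 by ring, show t + (s + 1) = t + s + 1 by ring,
    show t + (((b + 1 : ℕ) : ℝ) - 1) = t + ((b + 1 : ℕ) : ℝ) - 1 by ring]
  simp only [div_eq_mul_inv, mul_inv]
  ring

lemma tendsto_add_two_mul (τ : ℝ) : Tendsto (fun k : ℕ => τ + 2 * (k : ℝ)) atTop atTop :=
  tendsto_atTop_add_const_left _ _ (tendsto_natCast_atTop_atTop.const_mul_atTop two_pos)

lemma summable_one_div_add_one_sq : Summable (fun k : ℕ => 1 / ((k : ℝ) + 1) ^ 2) :=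
  ((summable_nat_add_iff 1).2 (Real.summable_one_div_nat_pow.2 one_lt_two)).congr
    fun k => by push_cast; rfl

lemma summable_rowTerm {a : ℕ} {s τ : ℝ} (hs : (a : ℝ) ≤ s) (hτ : s + 1 ≤ τ) :
    Summable fun k : ℕ => rowTerm a s (τ + 2 * k) := by
  refine Summable.of_nonneg_of_le (fun k => ?_) (fun k => ?_)
    (summable_one_div_add_one_sq.mul_left ((s - a) * (s + a + 1)))
  all_goals
    have h0 : (0 : ℝ) ≤ a := a.cast_nonneg
    have hk : (0 : ℝ) ≤ k := k.cast_nonneg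
    have ht : s + 1 + k ≤ τ + 2 * k := by linarith
    generalize τ + 2 * (k : ℝ) = t at ht ⊢
    have p1 := gammaRatio_pos hs
    have p2 := gammaRatio_pos (show (a : ℝ) ≤ t by linarith)
    have p3 := gammaRatio_mono hs (show s ≤ t by linarith)
    have q1 : 0 ≤ (s - a) * (s + a + 1) := mul_nonneg (by linarith) (by linarith)
    have q2 : 0 < (t - a) := by linarith
    have q3 : 0 < (t + a + 1) := by linarith
    have q4 : 0 < (t - s) := by linarith
    have q5 : 0 < (t + s + 1) := by linarith
    have q6 : 0 < t + 1 / 2 := by linarith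
    rw [rowTerm, gammaRatio_succ, gammaRatio_succ]
  · positivity
  -- Two factors are at most `1`; in the third, `t - a` and `(t-s)(t+s+1)` are each at least `k +
  -- 1`.
  · have e : gammaRatio a s * ((s - a) * (s + a + 1)) / (gammaRatio a t * ((t - a) * (t + a + 1))) *
        ((t + 1 / 2) / ((t - s) * (t + s + 1))) = (s - a) * (s + a + 1) *
        ((gammaRatio a s / gammaRatio a t) * (((t + 1 / 2) / (t + a + 1)) *
          (1 / ((t - a) * ((t - s) * (t + s + 1)))))) := by
      field_simp
    rw [e]
    refine mul_le_mul_of_nonneg_left ?_ q1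
    have b1 : gammaRatio a s / gammaRatio a t ≤ 1 := (div_le_one p2).2 p3
    have b2 : (t + 1 / 2) / (t + a + 1) ≤ 1 := (div_le_one q3).2 (by linarith)
    have b3 : 1 / ((t - a) * ((t - s) * (t + s + 1))) ≤ 1 / ((k : ℝ) + 1) ^ 2 := by
      refine one_div_le_one_div_of_le (by positivity) ?_
      rw [sq]
      refine mul_le_mul (by linarith) ?_ (by linarith) (by linarith)
      nlinarith
    calc _ ≤ 1 * (1 * (1 / ((k : ℝ) + 1) ^ 2)) := by gcongr
      _ = _ := by ring

lemma hasSum_of_telescoping {f y : ℕ → ℝ} (hf : Summable f) (h : ∀ k, f k = y (k + 1) - y k)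
    (hy : Tendsto y atTop (𝓝 0)) : HasSum f (-y 0) := by
  refine hf.hasSum_iff_tendsto_nat.2 ?_
  have : ∀ n, ∑ i ∈ Finset.range n, f i = y n - y 0 := fun n => by
    rw [Finset.sum_congr rfl fun i _ => h i, Finset.sum_range_sub]
  simp only [this]
  simpa using hy.sub_const (y 0)

lemma rowTerm_self_eq_zero (a : ℕ) (t : ℝ) : rowTerm a a t = 0 := by
  simp [rowTerm, gammaRatio_succ]

/-- A fictitious zero row below the first one: telescoping from it evaluates the row at `a + 1`. -/
lemma rowTerm_sub_one_eq_zero (a : ℕ) (t : ℝ) : rowTerm a (a - 1) t = 0 := by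
  cases a with
  | zero => simp [rowTerm, gammaRatio_succ]
  | succ a =>
    have : gammaRatio (a + 1) (a : ℝ) = 0 := gammaRatio_natCast_eq_zero (Nat.lt_succ_self a)
    rw [rowTerm, gammaRatio_succ]
    push_cast
    rw [show (a : ℝ) + 1 - 1 = a by ring, this]
    simp

/-- Differences of row sums; the row at `a - 1` is included, where all the terms vanish. -/
lemma tsum_rowTerm_sub {a : ℕ} {s τ : ℝ} (hs : s = (a : ℝ) - 1 ∨ (a : ℝ) ≤ s)
    (hτ : s + 3 ≤ τ) :
    ∑' k : ℕ, rowTerm a (s + 2) (τ + 2 * k) - ∑' k : ℕ, rowTerm a s (τ + 2 * k) =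
      -rowCert (a + 1) s τ := by
  have h0 : (0 : ℝ) ≤ a := a.cast_nonneg
  have hs1 : (a : ℝ) - 1 ≤ s := by rcases hs with h | h <;> linarith
  have s1 : Summable fun k : ℕ => rowTerm a (s + 2) (τ + 2 * k) :=
    summable_rowTerm (by linarith) (by linarith)
  have s2 : Summable fun k : ℕ => rowTerm a s (τ + 2 * k) := by
    rcases hs with h | h
    · exact summable_zero.congr fun k => by rw [h, rowTerm_sub_one_eq_zero]
    · exact summable_rowTerm h (by linarith)
  rw [← s1.tsum_sub s2]
  have := hasSum_of_telescoping (s1.sub s2) (y := fun k => rowCert (a + 1) s (τ + 2 * k))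
    (fun k => ?_) ((tendsto_rowCert a s).comp (tendsto_add_two_mul τ))
  · simpa using this.tsum_eq
  · have hk : (0 : ℝ) ≤ k := k.cast_nonneg
    rw [rowTerm_sub hs1 (by linarith) (by linarith) (by linarith) (by linarith) (by linarith)]
    push_cast
    ring_nf

lemma colTerm_eq_zero {a u : ℕ} (h : u < a) (s : ℝ) : colTerm a u s = 0 := by
  simp [colTerm, gammaRatio_natCast_eq_zero h]

/-- Either the gamma ratio or the factor `(u-a)(u-a-1)` vanishes at `u = 0, 1`, so telescoped column
sums have no lower boundary term. -/
lemma colCert_start (a : ℕ) {e : ℕ} (he : e ≤ 1) (s : ℝ) : colCert a s e = 0 := by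
  rcases lt_trichotomy e a with h | h | h
  · simp [colCert, gammaRatio_natCast_eq_zero h]
  · simp [colCert, h]
  · have h1 : a = 0 := by omega
    have h2 : e = 1 := by omega
    simp [colCert, h1, h2]

lemma sum_colTerm_sub {a e j : ℕ} {s : ℝ} (he : e ≤ 1) (hs : (a : ℝ) ≤ s)
    (hj : (e : ℝ) + 2 * j ≤ s + 1) :
    ∑ k ∈ Finset.range j, colTerm a ((e + 2 * k : ℕ) : ℝ) (s + 2) -
      ∑ k ∈ Finset.range j, colTerm a ((e + 2 * k : ℕ) : ℝ) s = colCert a s (e + 2 * j) := by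
  have h0 : (0 : ℝ) ≤ a := a.cast_nonneg
  have : ∀ k ∈ Finset.range j, colTerm a ((e + 2 * k : ℕ) : ℝ) (s + 2) -
      colTerm a ((e + 2 * k : ℕ) : ℝ) s =
      colCert a s (e + 2 * ((k + 1 : ℕ) : ℝ)) - colCert a s (e + 2 * (k : ℝ)) := by
    intro k hk
    have hk' : (k : ℝ) + 1 ≤ j := by exact_mod_cast Finset.mem_range.1 hk
    have hu : (0 : ℝ) ≤ ((e + 2 * k : ℕ) : ℝ) := Nat.cast_nonneg _
    have hu2 : ((e + 2 * k : ℕ) : ℝ) = e + 2 * k := by push_cast; ring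
    rw [colTerm_sub hs (by linarith) (by linarith) (by linarith) (by linarith)]
    push_cast
    ring_nf
  rw [← Finset.sum_sub_distrib, Finset.sum_congr rfl this,
    Finset.sum_range_sub (fun k : ℕ => colCert a s (e + 2 * (k : ℝ)))]
  simp [colCert_start a he]

lemma tsum_rowTerm_eq_add {a : ℕ} {s τ : ℝ} (hs : (a : ℝ) ≤ s) (hτ : s + 1 ≤ τ) :
    ∑' k : ℕ, rowTerm a s (τ + 2 * k) =
      rowTerm a s τ + ∑' k : ℕ, rowTerm a s (τ + 2 + 2 * k) := by
  rw [(summable_rowTerm hs hτ).tsum_eq_zero_add]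
  simp only [Nat.cast_zero, mul_zero, add_zero]
  congr 1
  refine tsum_congr fun k => ?_
  push_cast
  ring_nf

lemma gammaRatio_div_add_one {a : ℕ} {s : ℝ} (hs : (a : ℝ) ≤ s + 1) (h : 0 < s + 1 + a) :
    gammaRatio a s / gammaRatio a (s + 1) = (s + 1 - a) / (s + 1 + a) := by
  rw [div_eq_div_iff (gammaRatio_pos hs).ne' h.ne']
  linear_combination -gammaRatio_add_one a s

lemma gammaRatio_div_add_two {a : ℕ} {s : ℝ} (hs : (a : ℝ) ≤ s + 2) (h : 0 < s + 1 + a) :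
    gammaRatio a s / gammaRatio a (s + 2) =
      (s + 1 - a) * (s + 2 - a) / ((s + 1 + a) * (s + 2 + a)) := by
  have h2 : 0 < s + 2 + a := by linarith
  rw [div_eq_div_iff (gammaRatio_pos hs).ne' (by positivity)]
  linear_combination -gammaRatio_add_two a s

lemma rowTerm_div (a : ℕ) (s t : ℝ) : rowTerm a s t =
    gammaRatio (a + 1) s / gammaRatio (a + 1) t * ((t + 1 / 2) / ((t - s) * (t + s + 1))) := rfl

lemma rowCert_div (b : ℕ) (s t : ℝ) : rowCert b s t =
    gammaRatio b (s + 2) / gammaRatio b t * (-(s + 3 / 2) * ((t + b) * (t + b - 1)) /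
    ((s + b + 1) * (s + b + 2) * ((t - s - 2) * (t + s + 1)))) := by
  rw [rowCert]
  ring

lemma colCert_div (a : ℕ) (s u : ℝ) : colCert a s u =
    gammaRatio a u / gammaRatio a s * ((s + 3 / 2) * ((u - a) * (u - a - 1)) /
    ((s + a + 1) * (s + a + 2) * ((u - s - 2) * (u + s + 1)))) := by
  rw [colCert]
  ring

/-- The left side collects everything left over when `s` goes to `s + 2` in row minus column: the
dropped row term, the two certificates and the new column term. It equals the decrease of the closed
form. -/
lemma even_boundary {a : ℕ} {s : ℝ} (hs : (a : ℝ) ≤ s) :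
    rowTerm a s (s + 2) + rowCert (a + 1) s (s + 4) + colCert a s s
      + colTerm a s (s + 2) = (s - a) / (4 * (s + 1 / 2) * (s + a + 1))
        - (s + 2 - a) / (4 * (s + 2 + 1 / 2) * (s + 2 + a + 1)) := by
  have h0 : (0 : ℝ) ≤ a := a.cast_nonneg
  have f1 := gammaRatio_div_add_two (a := a) (s := s) (by linarith) (by linarith)
  have f2 := gammaRatio_div_add_two (a := a + 1) (s := s) (by push_cast; linarith)
    (by push_cast; linarith)
  have f3 := gammaRatio_div_add_two (a := a + 1) (s := s + 2) (by push_cast; linarith)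
    (by push_cast; linarith)
  have f4 : gammaRatio a s / gammaRatio a s = 1 := div_self (gammaRatio_pos hs).ne'
  rw [show s + 2 + 2 = s + 4 by ring] at f3
  rw [rowTerm_div, rowCert_div, colCert_div, colTerm, f1, f2, f3, f4]
  push_cast
  rw [show s + 4 - s - 2 = 2 by ring, show s + 2 - s = 2 by ring, show s - s - 2 = -2 by ring]
  have d1 : s + 1 + a ≠ 0 := by linarith
  have d2 : s + 2 + a ≠ 0 := by linarith
  have d3 : s + 3 + a ≠ 0 := by linarith
  have d4 : s + 4 + a ≠ 0 := by linarith
  have d5 : s + 5 + a ≠ 0 := by linarith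
  have d6 : 2 * s + 1 ≠ 0 := by linarith
  have d7 : 2 * s + 3 ≠ 0 := by linarith
  have d8 : 2 * s + 5 ≠ 0 := by linarith
  rw [show s + 1 + ((a : ℝ) + 1) = s + 2 + a by ring, show s + 2 + ((a : ℝ) + 1) = s + 3 + a by ring,
    show s + 2 + 1 + ((a : ℝ) + 1) = s + 4 + a by ring,
    show s + 4 + ((a : ℝ) + 1) = s + 5 + a by ring,
    show s + ((a : ℝ) + 1) + 1 = s + 2 + a by ring,
    show s + ((a : ℝ) + 1) + 2 = s + 3 + a by ring, show s + (a : ℝ) + 1 = s + 1 + a by ring,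
    show s + (a : ℝ) + 2 = s + 2 + a by ring, show s + 2 + (a : ℝ) + 1 = s + 3 + a by ring,
    show s + 2 + s + 1 = 2 * s + 3 by ring, show s + 4 + s + 1 = 2 * s + 5 by ring,
    show s + s + 1 = 2 * s + 1 by ring,
    show s + 1 / 2 = (2 * s + 1) / 2 by ring, show s + 2 + 1 / 2 = (2 * s + 5) / 2 by ring]
  have hs0 : 0 ≤ s := h0.trans hs
  field_simp
  ring

/-- The same bookkeeping for indices of parity opposite to `s`; here the leftovers cancel, so row
minus column is constant in `s`. -/
lemma odd_boundary {a : ℕ} {s : ℝ} (hs : (a : ℝ) ≤ s) :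
    rowTerm a s (s + 1) + rowCert (a + 1) s (s + 3) + colCert a s (s + 1)
      + colTerm a (s + 1) (s + 2) = 0 := by
  have h0 : (0 : ℝ) ≤ a := a.cast_nonneg
  have f1 := gammaRatio_div_add_one (a := a + 1) (s := s) (by push_cast; linarith)
    (by push_cast; linarith)
  have f2 := gammaRatio_div_add_one (a := a + 1) (s := s + 2) (by push_cast; linarith)
    (by push_cast; linarith)
  have f3 := gammaRatio_div_add_one (a := a) (s := s) (by linarith) (by linarith)
  have f4 := gammaRatio_div_add_one (a := a) (s := s + 1) (by linarith) (by linarith)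
  rw [← inv_inj, inv_div, inv_div] at f3
  rw [show s + 2 + 1 = s + 3 by ring] at f2
  rw [show s + 1 + 1 = s + 2 by ring] at f4
  rw [rowTerm_div, rowCert_div, colCert_div, colTerm, f1, f2, f3, f4]
  push_cast
  rw [show s + 3 - s - 2 = 1 by ring, show s + 1 - s = 1 by ring, show (1 : ℝ) - 2 = -1 by ring,
    show s + 2 - (s + 1) = 1 by ring]
  have d1 : s + 1 + a ≠ 0 := by linarith
  have d2 : s + 2 + a ≠ 0 := by linarith
  have d3 : s + 3 + a ≠ 0 := by linarith
  have d4 : s + 4 + a ≠ 0 := by linarith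
  have d5 : s + 1 - a ≠ 0 := by linarith
  have d6 : 2 * s + 2 ≠ 0 := by linarith
  have d8 : 2 * s + 4 ≠ 0 := by linarith
  rw [show s + 1 + ((a : ℝ) + 1) = s + 2 + a by ring, show s + 3 + ((a : ℝ) + 1) = s + 4 + a by ring,
    show s + ((a : ℝ) + 1) + 1 = s + 2 + a by ring,
    show s + ((a : ℝ) + 1) + 2 = s + 3 + a by ring, show s + (a : ℝ) + 1 = s + 1 + a by ring,
    show s + (a : ℝ) + 2 = s + 2 + a by ring,
    show s + 1 + s + 1 = 2 * s + 2 by ring, show s + 3 + s + 1 = 2 * s + 4 by ring,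
    show s + 2 + (s + 1) + 1 = 2 * s + 4 by ring]
  field_simp
  ring

/-- `(s-a)/(4(s+1/2)(s+a+1))` is the difference of the row and the column sum over indices of
the same parity. -/
theorem tsum_rowTerm_sub_sum_colTerm_even {a e : ℕ} (he : e ≤ 1) (j : ℕ) (h : a ≤ e + 2 * j) :
    ∑' k : ℕ, rowTerm a (e + 2 * j : ℝ) (e + 2 * j + 2 + 2 * k) -
      ∑ k ∈ Finset.range j, colTerm a ((e + 2 * k : ℕ) : ℝ) (e + 2 * j : ℝ) =
    (e + 2 * j - a) / (4 * (e + 2 * j + 1 / 2) * (e + 2 * j + a + 1)) := by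
  have h0 : (0 : ℝ) ≤ a := a.cast_nonneg
  -- The first row of the given parity that is not below `a` is `a` or `a + 1`; its column terms all
  -- have index below `a` and vanish.
  have base : ∀ i : ℕ, (e + 2 * i = a ∨ e + 2 * i = a + 1) →
      ∑' k : ℕ, rowTerm a (e + 2 * i : ℝ) (e + 2 * i + 2 + 2 * k) -
      ∑ k ∈ Finset.range i, colTerm a ((e + 2 * k : ℕ) : ℝ) (e + 2 * i : ℝ) =
    (e + 2 * i - a) / (4 * (e + 2 * i + 1 / 2) * (e + 2 * i + a + 1)) := by
    intro i hi
    have hc : ∑ k ∈ Finset.range i, colTerm a ((e + 2 * k : ℕ) : ℝ) (e + 2 * i : ℝ) = 0 :=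
      Finset.sum_eq_zero fun k hk => colTerm_eq_zero (by have := Finset.mem_range.1 hk; omega) _
    rw [hc, sub_zero]
    rcases hi with hi | hi
    · have hi' : (e : ℝ) + 2 * i = a := by exact_mod_cast hi
      simp [hi', rowTerm_self_eq_zero]
    · have hi' : (e : ℝ) + 2 * i = a + 1 := by exact_mod_cast hi
      rw [hi']
      -- The row at `a + 1` telescopes from the vanishing row at `a - 1`, leaving one certificate
      -- value.
      have := tsum_rowTerm_sub (a := a) (s := a - 1) (τ := a + 1 + 2) (Or.inl rfl) (by linarith)
      simp only [rowTerm_sub_one_eq_zero, tsum_zero, sub_zero] at this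
      rw [show (a : ℝ) - 1 + 2 = a + 1 by ring] at this
      rw [this]
      have e1 := gammaRatio_div_add_two (a := a + 1) (s := a + 1) (by push_cast; linarith)
        (by positivity)
      have hp := (gammaRatio_pos (a := a + 1) (s := (a : ℝ) + 1 + 2) (by push_cast; linarith)).ne'
      rw [div_eq_iff hp] at e1
      unfold rowCert
      rw [show (a : ℝ) - 1 + 2 = a + 1 by ring, e1]
      push_cast at hp ⊢
      rw [show (a : ℝ) + 1 + 2 - (a - 1) - 2 = 2 by ring]
      have d1 : (a : ℝ) - 1 + (a + 1) + 1 ≠ 0 := by linarith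
      have d2 : (a : ℝ) - 1 + (a + 1) + 2 ≠ 0 := by linarith
      have d3 : (a : ℝ) + 1 + 2 + (a - 1) + 1 ≠ 0 := by linarith
      field_simp
      ring
  induction j with
  | zero => exact base 0 (by omega)
  | succ j ih =>
    by_cases hj : a ≤ e + 2 * j
    · have ih := ih hj
      have hs : (a : ℝ) ≤ e + 2 * j := by exact_mod_cast hj
      generalize hs' : (e : ℝ) + 2 * j = s at *
      have r1 := tsum_rowTerm_sub (a := a) (s := s) (τ := s + 4) (Or.inr hs) (by linarith)
      have r2 := tsum_rowTerm_eq_add (a := a) (s := s) (τ := s + 2) hs (by linarith)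
      have c1 := sum_colTerm_sub (a := a) (e := e) (j := j) (s := s) he hs (by linarith)
      rw [hs'] at c1
      rw [show s + 2 + 2 = s + 4 by ring] at r2
      rw [Finset.sum_range_succ]
      push_cast at c1 ih ⊢
      rw [show (e : ℝ) + 2 * (j + 1) = s + 2 by rw [← hs']; ring, hs',
        show s + 2 + 2 = s + 4 by ring]
      have e2 := even_boundary hs
      linarith
    · exact base (j + 1) (by omega)

/-- The row and the column sum over indices of the opposite parity agree. -/
theorem tsum_rowTerm_sub_sum_colTerm_odd {a e : ℕ} (he : e ≤ 1) (j : ℕ) (h : a + 1 ≤ e + 2 * j) :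
    ∑' k : ℕ, rowTerm a (e + 2 * j - 1 : ℝ) (e + 2 * j + 2 * k) -
      ∑ k ∈ Finset.range j, colTerm a ((e + 2 * k : ℕ) : ℝ) (e + 2 * j - 1 : ℝ) = 0 := by
  have h0 : (0 : ℝ) ≤ a := a.cast_nonneg
  induction j with
  | zero =>
    have h1 : a = 0 := by omega
    have h2 : e = 1 := by omega
    subst h1 h2
    have := rowTerm_self_eq_zero 0
    push_cast at this ⊢
    simp [this]
  | succ j ih =>
    rw [Finset.sum_range_succ]
    by_cases hj : a + 1 ≤ e + 2 * j
    · have ih := ih hj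
      have hs : (a : ℝ) ≤ e + 2 * j - 1 := by
        have : (a : ℝ) + 1 ≤ e + 2 * j := by exact_mod_cast hj
        linarith
      obtain ⟨s, hs'⟩ : ∃ s : ℝ, (e : ℝ) + 2 * j = s + 1 := ⟨e + 2 * j - 1, by ring⟩
      have c1 := sum_colTerm_sub (a := a) (e := e) (j := j) (s := s) he (by linarith) (by linarith)
      push_cast at c1 ih ⊢
      rw [show (e : ℝ) + 2 * (j + 1) = s + 3 by linarith, hs', show s + 3 - 1 = s + 2 by ring]
      rw [hs', show s + 1 - 1 = s by ring] at ih hs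
      rw [hs'] at c1
      have r1 := tsum_rowTerm_sub (a := a) (s := s) (τ := s + 3) (Or.inr hs) (by linarith)
      have r2 := tsum_rowTerm_eq_add (a := a) (s := s) (τ := s + 1) hs (by linarith)
      rw [show s + 1 + 2 = s + 3 by ring] at r2
      linarith [odd_boundary hs]
    · have hc : ∑ k ∈ Finset.range j, colTerm a ((e + 2 * k : ℕ) : ℝ)
          (e + 2 * ((j + 1 : ℕ) : ℝ) - 1) = 0 :=
        Finset.sum_eq_zero fun k hk => colTerm_eq_zero (by have := Finset.mem_range.1 hk; omega) _
      rw [hc, zero_add]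
      -- The row is `a` or `a + 1`. At `a` both sums vanish; at `a + 1` the only surviving column
      -- term, `u = a`, balances the telescoped row.
      rcases (show e + 2 * (j + 1) = a + 1 ∨ e + 2 * (j + 1) = a + 2 by omega) with hi | hi
      · have hi' : (e : ℝ) + 2 * ((j + 1 : ℕ) : ℝ) = a + 1 := by exact_mod_cast hi
        rw [hi', colTerm_eq_zero (by omega)]
        simp [rowTerm_self_eq_zero]
      · have hi' : (e : ℝ) + 2 * ((j + 1 : ℕ) : ℝ) = a + 2 := by exact_mod_cast hi
        have hu : e + 2 * j = a := by omega
        rw [hi', hu, show (a : ℝ) + 2 - 1 = a + 1 by ring]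
        have := tsum_rowTerm_sub (a := a) (s := a - 1) (τ := a + 2) (Or.inl rfl) (by linarith)
        simp only [rowTerm_sub_one_eq_zero, tsum_zero, sub_zero] at this
        rw [show (a : ℝ) - 1 + 2 = a + 1 by ring] at this
        rw [this]
        have f1 := gammaRatio_div_add_one (a := a + 1) (s := a + 1) (by push_cast; linarith)
          (by push_cast; linarith)
        have f4 := gammaRatio_div_add_one (a := a) (s := a) (by linarith) (by linarith)
        rw [show (a : ℝ) + 1 + 1 = a + 2 by ring] at f1
        rw [rowCert_div, colTerm, show (a : ℝ) - 1 + 2 = a + 1 by ring, f1, f4]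
        push_cast
        rw [show (a : ℝ) + 2 - (a - 1) - 2 = 1 by ring, show (a : ℝ) + 1 - a = 1 by ring,
          show (a : ℝ) + 2 - (a + 1) = 1 by ring]
        have d1 : (a : ℝ) - 1 + (a + 1) + 1 ≠ 0 := by linarith
        have d2 : (a : ℝ) - 1 + (a + 1) + 2 ≠ 0 := by linarith
        have d3 : (a : ℝ) + 2 + (a - 1) + 1 ≠ 0 := by linarith
        field_simp
        ring

/-! ### Duplication formula of the trigamma function -/

lemma one_div_two_mul_sq (y : ℝ) : 1 / (2 * y) ^ 2 = 1 / y ^ 2 / 4 := by ring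

lemma hasSum_trigamma_two_mul {x : ℝ} (hx : 0 < x) :
    HasSum (fun k : ℕ => 1 / (x + 2 * k) ^ 2) (trigamma (x / 2) / 4) := by
  refine ((hasSum_trigamma (half_pos hx)).div_const 4).congr_fun fun k => ?_
  have : x + 2 * (k : ℝ) = 2 * (x / 2 + k) := by ring
  rw [this, one_div_two_mul_sq]

/-- The duplication formula of the trigamma function. -/
lemma trigamma_two_mul {x : ℝ} (hx : 0 < x) :
    4 * trigamma (2 * x) = trigamma x + trigamma (x + 1 / 2) := by
  have h1 : HasSum (fun k : ℕ => 1 / (2 * x + (2 * k : ℕ)) ^ 2) (trigamma x / 4) := by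
    have := hasSum_trigamma_two_mul (show 0 < 2 * x by linarith)
    rw [mul_div_cancel_left₀ x two_ne_zero] at this
    exact this.congr_fun fun k => by simp only [Nat.cast_mul, Nat.cast_ofNat]
  have h2 : HasSum (fun k : ℕ => 1 / (2 * x + (2 * k + 1 : ℕ)) ^ 2) (trigamma (x + 1 / 2) / 4) := by
    have := hasSum_trigamma_two_mul (show 0 < 2 * x + 1 by linarith)
    rw [show (2 * x + 1) / 2 = x + 1 / 2 by ring] at this
    exact this.congr_fun fun k => by
      simp only [Nat.cast_add, Nat.cast_mul, Nat.cast_ofNat, Nat.cast_one]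
      ring_nf
  have h3 := HasSum.even_add_odd (f := fun k : ℕ => 1 / (2 * x + (k : ℝ)) ^ 2) h1 h2
  have h4 := h3.unique (hasSum_trigamma (show 0 < 2 * x by linarith))
  linarith

lemma trigamma_one_half : trigamma (1 / 2) = 3 * trigamma 1 := by
  have := trigamma_two_mul (show (0 : ℝ) < 1 / 2 by norm_num)
  norm_num at this ⊢
  linarith

/-! ### Double-pole sums -/

/-- Products of two matrix elements of `ln(1-x)`. -/
noncomputable def logTerm (a : ℕ) (s t : ℝ) : ℝ :=
  gammaRatio a s / gammaRatio a t *
    ((s + 1 / 2) * (t + 1 / 2) / ((t - s) * (t + s + 1)) ^ 2)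

lemma summable_logTerm {a : ℕ} {s τ : ℝ} (hs : (a : ℝ) ≤ s) (hτ : s + 1 ≤ τ) :
    Summable fun k : ℕ => logTerm a s (τ + 2 * k) := by
  refine Summable.of_nonneg_of_le (fun k => ?_) (fun k => ?_)
    (summable_one_div_add_one_sq.mul_left (s + 1 / 2))
  all_goals
    have h0 : (0 : ℝ) ≤ a := a.cast_nonneg
    have hk : (0 : ℝ) ≤ k := k.cast_nonneg
    have ht : s + 1 + k ≤ τ + 2 * k := by linarith
    generalize τ + 2 * (k : ℝ) = t at ht ⊢
    have p1 := gammaRatio_pos hs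
    have p2 := gammaRatio_pos (show (a : ℝ) ≤ t by linarith)
    have p3 := gammaRatio_mono hs (show s ≤ t by linarith)
    have q4 : 0 < (t - s) := by linarith
    have q5 : 0 < (t + s + 1) := by linarith
    have q6 : 0 < t + 1 / 2 := by linarith
    have q7 : 0 < s + 1 / 2 := by linarith
    rw [logTerm]
  · positivity
  · have e : gammaRatio a s / gammaRatio a t *
        ((s + 1 / 2) * (t + 1 / 2) / ((t - s) * (t + s + 1)) ^ 2) = (s + 1 / 2) *
        ((gammaRatio a s / gammaRatio a t) * (((t + 1 / 2) / (t + s + 1)) *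
          (1 / ((t - s) * ((t - s) * (t + s + 1)))))) := by
      field_simp
    rw [e]
    refine mul_le_mul_of_nonneg_left ?_ q7.le
    have b1 : gammaRatio a s / gammaRatio a t ≤ 1 := (div_le_one p2).2 p3
    have b2 : (t + 1 / 2) / (t + s + 1) ≤ 1 := (div_le_one q5).2 (by linarith)
    have b3 : 1 / ((t - s) * ((t - s) * (t + s + 1))) ≤ 1 / ((k : ℝ) + 1) ^ 2 := by
      refine one_div_le_one_div_of_le (by positivity) ?_
      rw [sq]
      refine mul_le_mul (by linarith) ?_ (by linarith) (by linarith)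
      nlinarith
    calc _ ≤ 1 * (1 * (1 / ((k : ℝ) + 1) ^ 2)) := by gcongr
      _ = _ := by ring

/-- Raising `a` multiplies the term by `(s-a)(s+a+1)/((t-a)(t+a+1))`. The difference of these two
products is `(t-s)(t+s+1)`, which cancels one of the double poles. -/
lemma logTerm_sub_row {a : ℕ} {s t : ℝ} (hs : (a : ℝ) + 1 ≤ s) (hst : s < t) :
    logTerm a s t = logTerm (a + 1) s t +
      (s + 1 / 2) / ((s - a) * (s + a + 1)) * rowTerm a s t := by
  have h0 : (0 : ℝ) ≤ a := a.cast_nonneg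
  have p2 := (gammaRatio_pos (show (a : ℝ) ≤ t by linarith)).ne'
  have d1 : s - a ≠ 0 := by linarith
  have d2 : s + a + 1 ≠ 0 := by linarith
  have d3 : t - a ≠ 0 := by linarith
  have d4 : t + a + 1 ≠ 0 := by linarith
  have d5 : t - s ≠ 0 := by linarith
  have d6 : t + s + 1 ≠ 0 := by linarith
  rw [logTerm, logTerm, rowTerm, gammaRatio_succ, gammaRatio_succ]
  field_simp
  ring

lemma logTerm_sub_col {a : ℕ} {u s : ℝ} (hs : (a : ℝ) + 1 ≤ s) (hu : 0 ≤ u) (hus : u < s) :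
    logTerm a u s = logTerm (a + 1) u s +
      (s + 1 / 2) / ((s - a) * (s + a + 1)) * colTerm a u s := by
  have h0 : (0 : ℝ) ≤ a := a.cast_nonneg
  have p2 := (gammaRatio_pos (show (a : ℝ) ≤ s by linarith)).ne'
  have d1 : s - a ≠ 0 := by linarith
  have d2 : s + a + 1 ≠ 0 := by linarith
  have d5 : s - u ≠ 0 := by linarith
  have d6 : s + u + 1 ≠ 0 := by linarith
  rw [logTerm, logTerm, colTerm, gammaRatio_succ, gammaRatio_succ]
  field_simp
  ring

/-- Difference of a row and a column sum of `logTerm`. -/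
noncomputable def logSum (a e j : ℕ) (s τ : ℝ) : ℝ :=
  ∑' k : ℕ, logTerm a s (τ + 2 * k) -
    ∑ k ∈ Finset.range j, logTerm a ((e + 2 * k : ℕ) : ℝ) s

/-- The coefficient in front of `rowTerm` and `colTerm` is the same function of `s`, so only the
known difference of simple-pole sums enters. -/
lemma logSum_succ {a e j : ℕ} {s τ : ℝ} (hs : (a : ℝ) + 1 ≤ s) (hτ : s + 1 ≤ τ)
    (hj : (e : ℝ) + 2 * j < s + 2) :
    logSum a e j s τ = logSum (a + 1) e j s τ + (s + 1 / 2) / ((s - a) * (s + a + 1)) *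
      (∑' k : ℕ, rowTerm a s (τ + 2 * k) -
        ∑ k ∈ Finset.range j, colTerm a ((e + 2 * k : ℕ) : ℝ) s) := by
  have s1 : Summable fun k : ℕ => logTerm (a + 1) s (τ + 2 * k) :=
    summable_logTerm (by push_cast; linarith) hτ
  have s2 : Summable fun k : ℕ => rowTerm a s (τ + 2 * k) := summable_rowTerm (by linarith) hτ
  have e1 : ∑' k : ℕ, logTerm a s (τ + 2 * k) = ∑' k : ℕ, (logTerm (a + 1) s (τ + 2 * k) +
      (s + 1 / 2) / ((s - a) * (s + a + 1)) * rowTerm a s (τ + 2 * k)) :=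
    tsum_congr fun k => logTerm_sub_row hs (by
      have hk : (0 : ℝ) ≤ k := k.cast_nonneg
      linarith)
  have e2 : ∑ k ∈ Finset.range j, logTerm a ((e + 2 * k : ℕ) : ℝ) s =
      ∑ k ∈ Finset.range j, (logTerm (a + 1) ((e + 2 * k : ℕ) : ℝ) s +
      (s + 1 / 2) / ((s - a) * (s + a + 1)) * colTerm a ((e + 2 * k : ℕ) : ℝ) s) :=
    Finset.sum_congr rfl fun k hk => logTerm_sub_col hs (Nat.cast_nonneg _) (by
      have hk' : (k : ℝ) + 1 ≤ j := by exact_mod_cast Finset.mem_range.1 hk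
      push_cast
      linarith)
  rw [logSum, logSum, e1, e2, s1.tsum_add (s2.mul_left _), tsum_mul_left, Finset.sum_add_distrib,
    ← Finset.mul_sum]
  ring

/-- Partial fractions, from `(t+s+1)² - (t-s)² = 4 (s+1/2)(t+1/2)`; both pieces sum to trigamma
values. -/
lemma logTerm_zero {s t : ℝ} (h1 : t - s ≠ 0) (h2 : t + s + 1 ≠ 0) :
    logTerm 0 s t = (1 / (t - s) ^ 2 - 1 / (t + s + 1) ^ 2) / 4 := by
  rw [logTerm, gammaRatio_zero, gammaRatio_zero]
  field_simp
  ring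

lemma tsum_logTerm_zero {s d : ℝ} (hs : 0 ≤ s) (hd : 0 < d) :
    ∑' k : ℕ, logTerm 0 s (s + d + 2 * k) =
      (trigamma (d / 2) - trigamma ((2 * s + d + 1) / 2)) / 16 := by
  have h1 := hasSum_trigamma_two_mul hd
  have h2 := hasSum_trigamma_two_mul (show 0 < 2 * s + d + 1 by linarith)
  have := ((h1.sub h2).div_const 4).congr_fun (g := fun k : ℕ => logTerm 0 s (s + d + 2 * k))
    fun k => by
      have hk : (0 : ℝ) ≤ k := k.cast_nonneg
      rw [logTerm_zero (by linarith) (by linarith)]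
      ring_nf
  rw [this.tsum_eq]
  ring

lemma sum_one_div_sq_shift (c : ℝ) (j : ℕ) :
    ∑ k ∈ Finset.range (j + 1), 1 / (c + 2 + 2 * (k : ℝ)) ^ 2 =
      ∑ k ∈ Finset.range j, 1 / (c + 2 * (k : ℝ)) ^ 2 - 1 / c ^ 2 +
        1 / (c + 2 * j) ^ 2 + 1 / (c + 2 * j + 2) ^ 2 := by
  induction j with
  | zero => simp
  | succ j ih =>
    rw [Finset.sum_range_succ, ih, Finset.sum_range_succ]
    push_cast
    ring_nf

lemma sum_one_div_sq_reflect (s : ℝ) (e j : ℕ) :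
    ∑ k ∈ Finset.range (j + 1), 1 / (s + 2 - (e + 2 * (k : ℝ))) ^ 2 =
      ∑ k ∈ Finset.range j, 1 / (s - (e + 2 * (k : ℝ))) ^ 2 + 1 / (s + 2 - e) ^ 2 := by
  rw [Finset.sum_range_succ']
  congr 1
  · refine Finset.sum_congr rfl fun k _ => ?_
    push_cast
    ring_nf
  · simp

lemma sum_logTerm_zero {e j : ℕ} {s : ℝ} (hs : (e : ℝ) + 2 * j < s + 2) :
    ∑ k ∈ Finset.range j, logTerm 0 ((e + 2 * k : ℕ) : ℝ) s =
      (∑ k ∈ Finset.range j, 1 / (s - (e + 2 * (k : ℝ))) ^ 2 -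
        ∑ k ∈ Finset.range j, 1 / (s + e + 1 + 2 * (k : ℝ)) ^ 2) / 4 := by
  rw [← Finset.sum_sub_distrib, Finset.sum_div]
  refine Finset.sum_congr rfl fun k hk => ?_
  have hk' : (k : ℝ) + 1 ≤ j := by exact_mod_cast Finset.mem_range.1 hk
  have he : (0 : ℝ) ≤ e := e.cast_nonneg
  have hk0 : (0 : ℝ) ≤ k := k.cast_nonneg
  push_cast
  rw [logTerm_zero (by linarith) (by linarith)]
  ring_nf

lemma logSum_zero_odd {e : ℕ} (he : e ≤ 1) (j : ℕ) (h : 1 ≤ e + 2 * j) :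
    logSum 0 e j (e + 2 * j - 1) (e + 2 * j) = trigamma (e + 2 * j) / 8 := by
  have key : ∀ i : ℕ, 1 ≤ e + 2 * i → trigamma (1 / 2) - trigamma (e + 2 * i) -
      4 * (∑ k ∈ Finset.range i, 1 / ((e + 2 * i - 1 : ℝ) - (e + 2 * (k : ℝ))) ^ 2 -
        ∑ k ∈ Finset.range i, 1 / ((e + 2 * i - 1 : ℝ) + e + 1 + 2 * (k : ℝ)) ^ 2) =
      2 * trigamma (e + 2 * i) := by
    intro i
    induction i with
    | zero =>
      intro h
      have h1 : e = 1 := by omega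
      subst h1
      have := trigamma_one_half
      simp only [Nat.cast_one, Nat.cast_zero, mul_zero, add_zero, Finset.range_zero,
        Finset.sum_empty, sub_zero]
      linarith
    | succ i ih =>
      intro _
      -- For `e = 0` the index `i = 0` is not admissible, so `i = 1` is a second base case.
      rcases (show e + 2 * i = 0 ∨ 1 ≤ e + 2 * i by omega) with h0 | h0
      · have h1 : e = 0 := by omega
        have h2 : i = 0 := by omega
        subst h1 h2
        have := trigamma_add_one (show (0 : ℝ) < 1 by norm_num)
        norm_num at this ⊢
        have h3 := trigamma_one_half
        norm_num at h3
        rw [h3, this]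
        ring
      · have ih := ih h0
        have h1 : (1 : ℝ) ≤ e + 2 * i := by exact_mod_cast h0
        push_cast at ih ⊢
        obtain ⟨s, hs⟩ : ∃ s : ℝ, (e : ℝ) + 2 * i = s + 1 := ⟨e + 2 * i - 1, by ring⟩
        have t1 := trigamma_add_one (show 0 < s + 1 by linarith)
        have t2 := trigamma_add_one (show 0 < s + 2 by linarith)
        rw [show (e : ℝ) + 2 * (i + 1) - 1 = s + 2 by linarith,
          show (e : ℝ) + 2 * (i + 1) = s + 3 by linarith]
        rw [show (e : ℝ) + 2 * i - 1 = s by linarith, hs] at ih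
        have c1 := sum_one_div_sq_reflect s e i
        have c2 := sum_one_div_sq_shift (s + e + 1) i
        rw [show s + e + 1 + 2 * (i : ℝ) = 2 * (s + 1) by linarith,
          show 2 * (s + 1) + 2 = 2 * (s + 2) by ring] at c2
        rw [show s + 2 + e + 1 = s + e + 1 + 2 by ring]
        rw [show s + 1 + 1 = s + 2 by ring] at t1
        rw [show s + 2 + 1 = s + 3 by ring] at t2
        -- The two parities only swap the two fractions that enter when `s` moves to `s + 2`, which
        -- is why the result depends on `s` alone.
        have c3 : 1 / (s + 2 - e) ^ 2 + 1 / (s + e + 1) ^ 2 =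
            1 / (s + 1) ^ 2 + 1 / (s + 2) ^ 2 := by
          interval_cases e
          · norm_num
            ring
          · norm_num
            ring_nf
        have c4 : 1 / (2 * (s + 1)) ^ 2 = 1 / (s + 1) ^ 2 / 4 := one_div_two_mul_sq _
        have c5 : 1 / (2 * (s + 2)) ^ 2 = 1 / (s + 2) ^ 2 / 4 := one_div_two_mul_sq _
        rw [c1, c2, c4, c5]
        linarith
  have h1 : (1 : ℝ) ≤ e + 2 * j := by exact_mod_cast h
  have := tsum_logTerm_zero (s := e + 2 * j - 1) (d := 1) (by linarith) one_pos
  rw [show (e : ℝ) + 2 * j - 1 + 1 = e + 2 * j by ring] at this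
  rw [logSum, this, sum_logTerm_zero (by linarith),
    show (2 * ((e : ℝ) + 2 * j - 1) + 1 + 1) / 2 = e + 2 * j by ring]
  linarith [key j h]

lemma logSum_zero_even {e : ℕ} (he : e ≤ 1) (j : ℕ) :
    logSum 0 e j (e + 2 * j) (e + 2 * j + 2) =
      (trigamma (e + 2 * j + 1) - trigamma (e + 2 * j + 3 / 2) / 2
        - 1 / (2 * (e + 2 * j) + 1) ^ 2) / 4 := by
  have key : ∀ i : ℕ, (trigamma 1 - trigamma (e + 2 * i + 3 / 2)) / 4 -
      (∑ k ∈ Finset.range i, 1 / ((e + 2 * i : ℝ) - (e + 2 * (k : ℝ))) ^ 2 -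
        ∑ k ∈ Finset.range i, 1 / ((e + 2 * i : ℝ) + e + 1 + 2 * (k : ℝ)) ^ 2) =
      trigamma (e + 2 * i + 1) - trigamma (e + 2 * i + 3 / 2) / 2
        - 1 / (2 * (e + 2 * i) + 1) ^ 2 := by
    intro i
    induction i with
    | zero =>
      have h1 := trigamma_add_one (show (0 : ℝ) < 1 by norm_num)
      have h2 := trigamma_add_one (show (0 : ℝ) < 1 / 2 by norm_num)
      have h3 := trigamma_add_one (show (0 : ℝ) < 3 / 2 by norm_num)
      have h4 := trigamma_one_half
      interval_cases e
      · norm_num at h1 h2 h3 h4 ⊢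
        linarith
      · norm_num at h1 h2 h3 h4 ⊢
        linarith
    | succ i ih =>
      have h0 : (0 : ℝ) ≤ e + 2 * i := by positivity
      push_cast at ih ⊢
      obtain ⟨s, hs⟩ : ∃ s : ℝ, (e : ℝ) + 2 * i = s := ⟨e + 2 * i, by ring⟩
      have t1 := trigamma_add_one (show 0 < s + 1 by linarith)
      have t2 := trigamma_add_one (show 0 < s + 2 by linarith)
      have t3 := trigamma_add_one (show 0 < s + 3 / 2 by linarith)
      have t4 := trigamma_add_one (show 0 < s + 5 / 2 by linarith)
      rw [show (e : ℝ) + 2 * (i + 1) = s + 2 by linarith]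
      rw [hs] at ih
      have c1 := sum_one_div_sq_reflect s e i
      have c2 := sum_one_div_sq_shift (s + e + 1) i
      rw [show s + e + 1 + 2 * (i : ℝ) = 2 * s + 1 by linarith,
        show 2 * s + 1 + 2 = 2 * s + 3 by ring] at c2
      rw [show s + 2 + e + 1 = s + e + 1 + 2 by ring]
      rw [show s + 1 + 1 = s + 2 by ring] at t1
      rw [show s + 3 / 2 + 1 = s + 5 / 2 by ring] at t3
      rw [show s + 5 / 2 + 1 = s + 2 + 3 / 2 by ring] at t4
      have c3 : 1 / (s + 2 - e) ^ 2 + 1 / (s + e + 1) ^ 2 =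
          1 / (s + 1) ^ 2 + 1 / (s + 2) ^ 2 := by
        interval_cases e
        · norm_num
          ring
        · norm_num
          ring_nf
      have c4 : 1 / (s + 3 / 2) ^ 2 = 4 * (1 / (2 * s + 3) ^ 2) := by
        rw [show 2 * s + 3 = 2 * (s + 3 / 2) by ring, one_div_two_mul_sq]
        ring
      have c5 : 1 / (s + 5 / 2) ^ 2 = 4 * (1 / (2 * (s + 2) + 1) ^ 2) := by
        rw [show 2 * (s + 2) + 1 = 2 * (s + 5 / 2) by ring, one_div_two_mul_sq]
        ring
      rw [c1, c2]
      rw [c4] at t3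
      rw [c5] at t4
      linarith
  have h0 : (0 : ℝ) ≤ e + 2 * j := by positivity
  have := tsum_logTerm_zero (s := e + 2 * j) (d := 2) (by linarith) two_pos
  rw [logSum, this, sum_logTerm_zero (by linarith), div_self two_ne_zero,
    show (2 * ((e : ℝ) + 2 * j) + 2 + 1) / 2 = e + 2 * j + 3 / 2 by ring]
  linarith [key j]

/-- Independent of `a`: the simple-pole correction vanishes for opposite parities. -/
theorem logSum_odd {a e : ℕ} (he : e ≤ 1) (j : ℕ) (h : a + 1 ≤ e + 2 * j) :
    logSum a e j (e + 2 * j - 1) (e + 2 * j) = trigamma (e + 2 * j) / 8 := by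
  induction a with
  | zero => exact logSum_zero_odd he j h
  | succ a ih =>
    have h1 : (a : ℝ) + 1 + 1 ≤ e + 2 * j := by exact_mod_cast h
    have := logSum_succ (a := a) (e := e) (j := j) (s := e + 2 * j - 1) (τ := e + 2 * j)
      (by linarith) (by linarith) (by linarith)
    rw [tsum_rowTerm_sub_sum_colTerm_odd he j (by omega), mul_zero, add_zero] at this
    rw [← this, ih (by omega)]

/-- Each increase of `a` removes `1/(4 (s+a+1)²)`, which is one step of the trigamma recurrence. -/
theorem logSum_even {a e : ℕ} (he : e ≤ 1) (j : ℕ) (h : a ≤ e + 2 * j) :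
    logSum a e j (e + 2 * j) (e + 2 * j + 2) =
      (trigamma (e + 2 * j + a + 1) - trigamma (e + 2 * j + 3 / 2) / 2
        - 1 / (2 * (e + 2 * j) + 1) ^ 2) / 4 := by
  induction a with
  | zero => simpa using logSum_zero_even he j
  | succ a ih =>
    have h0 : (0 : ℝ) ≤ a := a.cast_nonneg
    have h1 : (a : ℝ) + 1 ≤ e + 2 * j := by exact_mod_cast h
    have h2 := logSum_succ (a := a) (e := e) (j := j) (s := e + 2 * j) (τ := e + 2 * j + 2)
      (by linarith) (by linarith) (by linarith)
    rw [tsum_rowTerm_sub_sum_colTerm_even he j (by omega), ih (by omega)] at h2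
    have h3 := trigamma_add_one (show (0 : ℝ) < e + 2 * j + a + 1 by linarith)
    generalize (e : ℝ) + 2 * j = s at *
    have d1 : s - a ≠ 0 := by linarith
    have d2 : s + a + 1 ≠ 0 := by linarith
    have d3 : s + 1 / 2 ≠ 0 := by linarith
    have h4 : (s + 1 / 2) / ((s - a) * (s + a + 1)) * ((s - a) / (4 * (s + 1 / 2) * (s + a + 1)))
        = 1 / (s + a + 1) ^ 2 / 4 := by
      generalize s + 1 / 2 = w at d3
      field_simp
    rw [h4] at h2
    push_cast
    rw [← add_assoc s, h3]
    linarith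

/-! ### Partial fractions of the squared entropy matrix elements -/

/-- The rational factor of the matrix elements of `(1-x) ln(1-x)`. -/
noncomputable def entKernel (a s t : ℝ) : ℝ :=
  1 / ((t - s) * (t + s + 1)) - (s + a + 1) / (2 * s + 1) * (1 / ((t - s - 1) * (t + s + 2))) -
    (s - a) / (2 * s + 1) * (1 / ((t - s + 1) * (t + s)))

/-- The squared matrix elements of the entropy function. -/
noncomputable def entTerm (a : ℕ) (s t : ℝ) : ℝ :=
  4 * (gammaRatio a s / gammaRatio a t * ((s + 1 / 2) * (t + 1 / 2) * entKernel a s t ^ 2))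

/-- The denominators are `t(t+1) - c(c+1)` for `c = s, s+1, s-1`. As functions of `t(t+1)` their
cross products split into simple poles, leaving three squares and three linear terms. -/
lemma entKernel_sq {a s t : ℝ} (hs : s ≠ 0) (hs1 : s + 1 ≠ 0) (hs2 : 2 * s + 1 ≠ 0)
    (h1 : t - s ≠ 0) (h2 : t + s + 1 ≠ 0) (h3 : t - s - 1 ≠ 0) (h4 : t + s + 2 ≠ 0)
    (h5 : t - s + 1 ≠ 0) (h6 : t + s ≠ 0) :
    entKernel a s t ^ 2 = (1 / ((t - s) * (t + s + 1))) ^ 2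
      + ((s + a + 1) / (2 * s + 1) * (1 / ((t - s - 1) * (t + s + 2)))) ^ 2
      + ((s - a) / (2 * s + 1) * (1 / ((t - s + 1) * (t + s)))) ^ 2
      + a / (s * (s + 1)) * (1 / ((t - s) * (t + s + 1)))
      + (s + a + 1) / (2 * s + 1) * (-1 / (s + 1) + (s - a) / (2 * s + 1) ^ 2)
        * (1 / ((t - s - 1) * (t + s + 2)))
      + (s - a) / (2 * s + 1) * (1 / s - (s + a + 1) / (2 * s + 1) ^ 2)
        * (1 / ((t - s + 1) * (t + s))) := by
  have hs3 : s * 2 + 1 ≠ 0 := by rwa [mul_comm]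
  have r1 : (1 / ((t - s) * (t + s + 1))) * (1 / ((t - s - 1) * (t + s + 2))) =
      (1 / ((t - s - 1) * (t + s + 2)) - 1 / ((t - s) * (t + s + 1))) / (2 * (s + 1)) := by
    field_simp
    ring
  have r2 : (1 / ((t - s) * (t + s + 1))) * (1 / ((t - s + 1) * (t + s))) =
      (1 / ((t - s) * (t + s + 1)) - 1 / ((t - s + 1) * (t + s))) / (2 * s) := by
    field_simp
    ring
  have r3 : (1 / ((t - s - 1) * (t + s + 2))) * (1 / ((t - s + 1) * (t + s))) =
      (1 / ((t - s - 1) * (t + s + 2)) - 1 / ((t - s + 1) * (t + s))) / (2 * (2 * s + 1)) := by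
    field_simp
    ring
  unfold entKernel
  generalize 1 / ((t - s) * (t + s + 1)) = X at *
  generalize 1 / ((t - s - 1) * (t + s + 2)) = Y at *
  generalize 1 / ((t - s + 1) * (t + s)) = Z at *
  have e : (X - (s + a + 1) / (2 * s + 1) * Y - (s - a) / (2 * s + 1) * Z) ^ 2 =
      X ^ 2 + ((s + a + 1) / (2 * s + 1) * Y) ^ 2 + ((s - a) / (2 * s + 1) * Z) ^ 2
      - 2 * ((s + a + 1) / (2 * s + 1)) * (X * Y) - 2 * ((s - a) / (2 * s + 1)) * (X * Z)
      + 2 * ((s + a + 1) / (2 * s + 1)) * ((s - a) / (2 * s + 1)) * (Y * Z) := by ring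
  rw [e, r1, r2, r3]
  field_simp
  ring

/-- Down a column the summation variable is the first index, but the kernel has its coefficients
there. Exchanging the indices, at the cost of `a → -a` and a sign, makes the partial fractions of
`entKernel_sq` available in the summation variable. -/
lemma entKernel_swap {a s u : ℝ} (hs : 2 * s + 1 ≠ 0) (hu : 2 * u + 1 ≠ 0)
    (h1 : s - u ≠ 0) (h2 : s + u + 1 ≠ 0) (h3 : s - u - 1 ≠ 0) (h4 : s + u + 2 ≠ 0)
    (h5 : s - u + 1 ≠ 0) (h6 : s + u ≠ 0) :
    entKernel a u s = -entKernel (-a) s u := by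
  have hs3 : s * 2 + 1 ≠ 0 := by rwa [mul_comm]
  have hu3 : u * 2 + 1 ≠ 0 := by rwa [mul_comm]
  unfold entKernel
  rw [show u - s = -(s - u) by ring, show -(s - u) - 1 = -(s - u + 1) by ring,
    show -(s - u) + 1 = -(s - u - 1) by ring, show u + s + 1 = s + u + 1 by ring,
    show u + s + 2 = s + u + 2 by ring, show u + s = s + u by ring]
  field_simp
  ring

/-- The coefficient relating consecutive rows of squared kernels. -/
noncomputable def weightUp (a s : ℝ) : ℝ := (s + a + 1) * (s + 1 - a) / ((2 * s + 1) * (2 * s + 3))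

/-- The coefficient of the kernel at `s + 1` in the partial fractions of `entTerm`. -/
noncomputable def coeffUp (a s : ℝ) : ℝ :=
  (s + 1 - a) * (-1 / (2 * (s + 1)) + (s - a) / (2 * (2 * s + 1) ^ 2))

/-- The coefficient of the kernel at `s - 1` in the partial fractions of `entTerm`. -/
noncomputable def coeffDown (a s : ℝ) : ℝ :=
  (s + a) * (1 / (2 * s) - (s + a + 1) / (2 * (2 * s + 1) ^ 2))

/-- Up to the gamma ratio, a row term is the simple pole minus its counterpart with `s` replaced by
`a`, a subtraction independent of `s`. -/
lemma rowTerm_eq {a : ℕ} {s t : ℝ} (h1 : t - s ≠ 0) (h2 : t + s + 1 ≠ 0) (h3 : t - a ≠ 0)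
    (h4 : t + a + 1 ≠ 0) :
    rowTerm a s t = gammaRatio a s / gammaRatio a t * (t + 1 / 2) *
      (1 / ((t - s) * (t + s + 1)) - 1 / ((t - a) * (t + a + 1))) := by
  rw [rowTerm, gammaRatio_succ, gammaRatio_succ, mul_div_mul_comm]
  have : (s - a) * (s + a + 1) / ((t - a) * (t + a + 1)) * ((t + 1 / 2) / ((t - s) * (t + s + 1))) =
      (t + 1 / 2) * (1 / ((t - s) * (t + s + 1)) - 1 / ((t - a) * (t + a + 1))) := by
    field_simp
    ring
  rw [mul_assoc, this, mul_assoc]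

lemma entTerm_row {a : ℕ} {s t : ℝ} (hs : (a : ℝ) + 1 ≤ s) (ht : s + 2 ≤ t) :
    entTerm a s t = 4 * (logTerm a s t + weightUp a s * logTerm a (s + 1) t
      + weightUp a (s - 1) * logTerm a (s - 1) t
      + a / (s * (s + 1)) * (s + 1 / 2) * rowTerm a s t
      + coeffUp a s * rowTerm a (s + 1) t + coeffDown a s * rowTerm a (s - 1) t) := by
  have h0 : (0 : ℝ) ≤ a := a.cast_nonneg
  have g1 : gammaRatio a (s + 1) = gammaRatio a s * ((s + 1 + a) / (s + 1 - a)) := by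
    rw [mul_div_assoc', eq_div_iff (by linarith), gammaRatio_add_one]
  have g2 : gammaRatio a (s - 1) = gammaRatio a s * ((s - a) / (s + a)) := by
    rw [mul_div_assoc', eq_div_iff (by linarith)]
    have := gammaRatio_add_one a (s - 1)
    rw [sub_add_cancel] at this
    exact this.symm
  rw [entTerm, entKernel_sq (by linarith) (by linarith) (by linarith) (by linarith) (by linarith)
    (by linarith) (by linarith) (by linarith) (by linarith),
    rowTerm_eq (by linarith) (by linarith) (by linarith) (by linarith),
    rowTerm_eq (s := s + 1) (by linarith) (by linarith) (by linarith) (by linarith),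
    rowTerm_eq (s := s - 1) (by linarith) (by linarith) (by linarith) (by linarith),
    logTerm, logTerm, logTerm, g1, g2]
  have i0 (x y : ℝ) : x / y ^ 2 = x * (1 / y) ^ 2 := by ring
  have i1 (x y z : ℝ) : x * y / z = (x / z) * y := by ring
  rw [i0 _ ((t - s) * (t + s + 1)), i0 _ ((t - (s + 1)) * (t + (s + 1) + 1)),
    i0 _ ((t - (s - 1)) * (t + (s - 1) + 1)),
    show t - (s + 1) = t - s - 1 by ring, show t + (s + 1) + 1 = t + s + 2 by ring,
    show t - (s - 1) = t - s + 1 by ring, show t + (s - 1) + 1 = t + s by ring,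
    i1 (gammaRatio a s), i1 (gammaRatio a s)]
  generalize 1 / ((t - s) * (t + s + 1)) = X at *
  generalize 1 / ((t - s - 1) * (t + s + 2)) = Y at *
  generalize 1 / ((t - s + 1) * (t + s)) = Z at *
  generalize 1 / ((t - a) * (t + a + 1)) = W at *
  generalize gammaRatio a s / gammaRatio a t = G at *
  unfold weightUp coeffUp coeffDown
  have d1 : s + 1 - a ≠ 0 := by linarith
  have d2 : s + a ≠ 0 := by linarith
  have d3 : s ≠ 0 := by linarith
  have d4 : s + 1 ≠ 0 := by linarith
  have d5 : 2 * s + 1 ≠ 0 := by linarith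
  have d6 : 2 * s + 3 ≠ 0 := by linarith
  have d7 : 2 * s - 1 ≠ 0 := by linarith
  have c5 : s * 2 + 1 ≠ 0 := by linarith
  have c6 : s * 2 + 3 ≠ 0 := by linarith
  have c7 : s * 2 - 1 ≠ 0 := by linarith
  rw [show 2 * (s - 1) + 1 = 2 * s - 1 by ring, show 2 * (s - 1) + 3 = 2 * s + 1 by ring]
  have e1 : G * ((s + 1 + a) / (s + 1 - a)) * ((s + 1 + 1 / 2) * (t + 1 / 2) * Y ^ 2) *
      ((s + a + 1) * (s + 1 - a) / ((2 * s + 1) * (2 * s + 3))) =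
      G * ((s + 1 / 2) * (t + 1 / 2)) * ((s + a + 1) / (2 * s + 1) * Y) ^ 2 := by
    field_simp
    ring
  have e2 : G * ((s - a) / (s + a)) * ((s - 1 + 1 / 2) * (t + 1 / 2) * Z ^ 2) *
      ((s - 1 + a + 1) * (s - 1 + 1 - a) / ((2 * s - 1) * (2 * s + 1))) =
      G * ((s + 1 / 2) * (t + 1 / 2)) * ((s - a) / (2 * s + 1) * Z) ^ 2 := by
    field_simp
    ring
  -- The three simple-pole coefficients sum to zero once the gamma ratios are aligned, so the common
  -- subtraction `W` disappears.
  have e3 : a / (s * (s + 1)) * (s + 1 / 2) +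
      (s + 1 - a) * (-1 / (2 * (s + 1)) + (s - a) / (2 * (2 * s + 1) ^ 2))
        * ((s + 1 + a) / (s + 1 - a)) +
      (s + a) * (1 / (2 * s) - (s + a + 1) / (2 * (2 * s + 1) ^ 2)) * ((s - a) / (s + a)) = 0 := by
    field_simp
    ring
  have e4 : (s + 1 - a) * (-1 / (2 * (s + 1)) + (s - a) / (2 * (2 * s + 1) ^ 2))
        * ((s + 1 + a) / (s + 1 - a)) = (s + 1 / 2) * ((s + a + 1) / (2 * s + 1) *
        (-1 / (s + 1) + (s - a) / (2 * s + 1) ^ 2)) := by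
    field_simp
    ring
  have e5 : (s + a) * (1 / (2 * s) - (s + a + 1) / (2 * (2 * s + 1) ^ 2)) * ((s - a) / (s + a)) =
      (s + 1 / 2) * ((s - a) / (2 * s + 1) * (1 / s - (s + a + 1) / (2 * s + 1) ^ 2)) := by
    field_simp
  linear_combination (-4) * e1 - 4 * e2 + 4 * G * (t + 1 / 2) * W * e3
    - 4 * G * (t + 1 / 2) * Y * e4 - 4 * G * (t + 1 / 2) * Z * e5

lemma entTerm_col {a : ℕ} {s u : ℝ} (hs : (a : ℝ) + 1 ≤ s) (hu : 0 ≤ u) (hus : u + 2 ≤ s) :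
    entTerm a u s = 4 * (logTerm a u s + weightUp a s * logTerm a u (s + 1)
      + weightUp a (s - 1) * logTerm a u (s - 1)
      + a / (s * (s + 1)) * (s + 1 / 2) * colTerm a u s
      - coeffUp (-a) s * colTerm a u (s + 1) - coeffDown (-a) s * colTerm a u (s - 1)) := by
  have h0 : (0 : ℝ) ≤ a := a.cast_nonneg
  have p0 := (gammaRatio_pos (show (a : ℝ) ≤ s by linarith)).ne'
  have d1 : s + 1 - a ≠ 0 := by linarith
  have d2 : s + a ≠ 0 := by linarith
  have d3 : s ≠ 0 := by linarith
  have d4 : s + 1 ≠ 0 := by linarith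
  have d5 : 2 * s + 1 ≠ 0 := by linarith
  have d6 : 2 * s + 3 ≠ 0 := by linarith
  have d7 : 2 * s - 1 ≠ 0 := by linarith
  have c5 : s * 2 + 1 ≠ 0 := by linarith
  have c6 : s * 2 + 3 ≠ 0 := by linarith
  have c7 : s * 2 - 1 ≠ 0 := by linarith
  have d8 : s - a ≠ 0 := by linarith
  have d9 : s + 1 + a ≠ 0 := by linarith
  have d10 : s + 1 - (-a) ≠ 0 := by linarith
  have g1 : gammaRatio a u / gammaRatio a (s + 1) =
      gammaRatio a u / gammaRatio a s * ((s + 1 - a) / (s + 1 + a)) := by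
    rw [← gammaRatio_div_add_one (by linarith) (by linarith)]
    field_simp
  have g2 : gammaRatio a u / gammaRatio a (s - 1) =
      gammaRatio a u / gammaRatio a s * ((s + a) / (s - a)) := by
    have h := gammaRatio_div_add_one (a := a) (s := s - 1) (by linarith) (by linarith)
    rw [sub_add_cancel] at h
    have p1 := (gammaRatio_pos (show (a : ℝ) ≤ s - 1 by linarith)).ne'
    rw [div_eq_div_iff p0 d2] at h
    field_simp
    linear_combination (-gammaRatio a u) * h
  rw [entTerm, entKernel_swap (by linarith) (by linarith) (by linarith) (by linarith)
    (by linarith) (by linarith) (by linarith) (by linarith), neg_sq,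
    entKernel_sq (by linarith) (by linarith) (by linarith) (by linarith) (by linarith)
    (by linarith) (by linarith) (by linarith) (by linarith),
    logTerm, logTerm, logTerm, colTerm, colTerm, colTerm, g1, g2]
  have i0 (x y : ℝ) : x / y ^ 2 = x * (1 / y) ^ 2 := by ring
  have i2 (y : ℝ) : (u + 1 / 2) / y = (u + 1 / 2) * (1 / y) := by ring
  have j0 : 1 / ((s - u) * (s + u + 1)) = -(1 / ((u - s) * (u + s + 1))) := by
    rw [← one_div_neg_eq_neg_one_div]
    ring_nf
  have j1 : 1 / ((s + 1 - u) * (s + 1 + u + 1)) = -(1 / ((u - s - 1) * (u + s + 2))) := by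
    rw [← one_div_neg_eq_neg_one_div]
    ring_nf
  have j2 : 1 / ((s - 1 - u) * (s - 1 + u + 1)) = -(1 / ((u - s + 1) * (u + s))) := by
    rw [← one_div_neg_eq_neg_one_div]
    ring_nf
  rw [i0 _ ((s - u) * (s + u + 1)), i0 _ ((s + 1 - u) * (s + 1 + u + 1)),
    i0 _ ((s - 1 - u) * (s - 1 + u + 1)), i2, i2, i2, j0, j1, j2]
  generalize 1 / ((u - s) * (u + s + 1)) = X at *
  generalize 1 / ((u - s - 1) * (u + s + 2)) = Y at *
  generalize 1 / ((u - s + 1) * (u + s)) = Z at *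
  generalize gammaRatio a u / gammaRatio a s = G at *
  unfold weightUp coeffUp coeffDown
  rw [show 2 * (s - 1) + 1 = 2 * s - 1 by ring, show 2 * (s - 1) + 3 = 2 * s + 1 by ring,
    sub_neg_eq_add, sub_neg_eq_add, ← sub_eq_add_neg]
  have e1 : G * ((s + 1 - a) / (s + 1 + a)) * ((u + 1 / 2) * (s + 1 + 1 / 2) * (-Y) ^ 2) *
      ((s + a + 1) * (s + 1 - a) / ((2 * s + 1) * (2 * s + 3))) =
      G * ((u + 1 / 2) * (s + 1 / 2)) * ((s - a + 1) / (2 * s + 1) * Y) ^ 2 := by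
    field_simp
    ring
  have e2 : G * ((s + a) / (s - a)) * ((u + 1 / 2) * (s - 1 + 1 / 2) * (-Z) ^ 2) *
      ((s - 1 + a + 1) * (s - 1 + 1 - a) / ((2 * s - 1) * (2 * s + 1))) =
      G * ((u + 1 / 2) * (s + 1 / 2)) * ((s + a) / (2 * s + 1) * Z) ^ 2 := by
    field_simp
    ring
  have e4 : (s + 1 + a) * (-1 / (2 * (s + 1)) + (s + a) / (2 * (2 * s + 1) ^ 2))
        * ((s + 1 - a) / (s + 1 + a)) = (s + 1 / 2) * ((s - a + 1) / (2 * s + 1) *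
        (-1 / (s + 1) + (s + a) / (2 * s + 1) ^ 2)) := by
    field_simp
    ring
  have e5 : (s - a) * (1 / (2 * s) - (s - a + 1) / (2 * (2 * s + 1) ^ 2)) * ((s + a) / (s - a)) =
      (s + 1 / 2) * ((s + a) / (2 * s + 1) * (1 / s - (s - a + 1) / (2 * s + 1) ^ 2)) := by
    field_simp
  linear_combination (-4) * e1 - 4 * e2
    - 4 * G * (u + 1 / 2) * Y * e4 - 4 * G * (u + 1 / 2) * Z * e5

lemma weightUp_mul_logTerm {a : ℕ} {s : ℝ} (hs : (a : ℝ) ≤ s + 1) (h : 0 < s + 1 + a)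
    (h0 : 0 < s + 1 / 2) :
    weightUp a s * logTerm a s (s + 1) = (s + 1 - a) ^ 2 / (16 * (s + 1) ^ 2) := by
  have h1 : 2 * s + 1 ≠ 0 := by linarith
  have h1' : s * 2 + 1 ≠ 0 := by linarith
  have h2 : 2 * s + 3 ≠ 0 := by linarith
  have h2' : s * 2 + 3 ≠ 0 := by linarith
  have h3 : s + 1 ≠ 0 := by linarith
  have h4 : s + 1 + a ≠ 0 := h.ne'
  have h5 : s + a + 1 ≠ 0 := by linarith
  rw [logTerm, gammaRatio_div_add_one hs h, weightUp, show s + 1 - s = 1 by ring,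
    show s + 1 + s + 1 = 2 * (s + 1) by ring, show s + 1 + a = s + a + 1 by ring,
    show s + 1 + 1 / 2 = (2 * s + 3) / 2 by ring, show s + 1 / 2 = (2 * s + 1) / 2 by ring]
  field_simp
  ring

lemma colTerm_succ {a : ℕ} {s : ℝ} (hs : (a : ℝ) ≤ s + 1) (h : 0 < s + 1 + a) :
    colTerm a s (s + 1) = (s + 1 - a) / (s + 1 + a) * ((s + 1 / 2) / (2 * (s + 1))) := by
  rw [colTerm, gammaRatio_div_add_one hs h, show s + 1 - s = 1 by ring,
    show s + 1 + s + 1 = 2 * (s + 1) by ring, one_mul]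

/-- Once the column sums in `entSum` are traded for row sums, this leaves only a difference of the
rows at `s + 1` and `s - 1`, which telescopes. -/
lemma coeffUp_add (a s : ℝ) (hs : s ≠ 0) (hs1 : s + 1 ≠ 0) (hs2 : 2 * s + 1 ≠ 0) :
    coeffUp a s + coeffUp (-a) s = -(coeffDown a s + coeffDown (-a) s) := by
  have h : s * 2 + 1 ≠ 0 := by rwa [mul_comm]
  unfold coeffUp coeffDown
  field_simp
  ring

/-- At `s = a` the coefficient `s - a` of the lower neighbour vanishes. A separate expansion is
needed because `entTerm_row` divides by `s`, and `a` may be `0`. -/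
lemma entTerm_row_self {a : ℕ} {t : ℝ} (ht : (a : ℝ) + 2 ≤ t) :
    entTerm a a t = 4 * (logTerm a a t + weightUp a a * logTerm a (a + 1) t
      + coeffUp a a * rowTerm a (a + 1) t) := by
  have h0 : (0 : ℝ) ≤ a := a.cast_nonneg
  have g1 : gammaRatio a ((a : ℝ) + 1) = gammaRatio a a * (2 * a + 1) := by
    have := gammaRatio_add_one a a
    linear_combination this
  have d1 : (2 * a + 1 : ℝ) ≠ 0 := by linarith
  have d2 : (2 * a + 3 : ℝ) ≠ 0 := by linarith
  have d3 : (a + 1 : ℝ) ≠ 0 := by linarith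
  have h1 : t - a ≠ 0 := by linarith
  have h2 : t + a + 1 ≠ 0 := by linarith
  have h3 : t - a - 1 ≠ 0 := by linarith
  have h4 : t + a + 2 ≠ 0 := by linarith
  have r1 : (1 / ((t - a) * (t + a + 1))) * (1 / ((t - a - 1) * (t + a + 2))) =
      (1 / ((t - a - 1) * (t + a + 2)) - 1 / ((t - a) * (t + a + 1))) / (2 * (a + 1)) := by
    field_simp
    ring
  rw [rowTerm_eq (s := (a : ℝ) + 1) (by linarith) (by linarith) h1 h2, entTerm, entKernel, logTerm,
    logTerm, g1, sub_self, zero_div, zero_mul, sub_zero]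
  have i0 (x y : ℝ) : x / y ^ 2 = x * (1 / y) ^ 2 := by ring
  have i1 (x y z : ℝ) : x * y / z = (x / z) * y := by ring
  rw [i0 _ ((t - a) * (t + a + 1)), i0 _ ((t - (a + 1)) * (t + (a + 1) + 1)),
    show t - ((a : ℝ) + 1) = t - a - 1 by ring, show t + ((a : ℝ) + 1) + 1 = t + a + 2 by ring,
    i1 (gammaRatio a a), show (a + a + 1 : ℝ) / (2 * a + 1) = 1 by field_simp; ring]
  generalize 1 / ((t - a) * (t + a + 1)) = X at *
  generalize 1 / ((t - a - 1) * (t + a + 2)) = Y at *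
  generalize gammaRatio a a / gammaRatio a t = G at *
  rw [weightUp, coeffUp, sub_self, zero_div, add_zero,
    show (a + a + 1 : ℝ) * (a + 1 - a) = 2 * a + 1 by ring,
    show (a + 1 - a : ℝ) = 1 by ring]
  have e1 : (2 * a + 1 : ℝ) / ((2 * a + 1) * (2 * a + 3)) *
      (G * (2 * a + 1) * ((a + 1 + 1 / 2) * (t + 1 / 2) * Y ^ 2)) =
      G * ((a + 1 / 2) * (t + 1 / 2)) * Y ^ 2 := by
    field_simp
    ring
  have e2 : (1 : ℝ) * (-1 / (2 * (a + 1))) * (G * (2 * a + 1) * (t + 1 / 2) * (Y - X)) =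
      G * (t + 1 / 2) * (a + 1 / 2) * (-2 * ((Y - X) / (2 * (a + 1)))) := by
    field_simp
  rw [← r1] at e2
  linear_combination -4 * e1 - 4 * e2

/-- The sum of the squared matrix elements along the row and the column through `s`. -/
noncomputable def entSum (a e j : ℕ) : ℝ :=
  ∑' k : ℕ, entTerm a (e + 2 * j) (e + 2 * j + 2 + 2 * k) -
    ∑ k ∈ Finset.range j, entTerm a ((e + 2 * k : ℕ) : ℝ) (e + 2 * j)

lemma summable_entTerm {a : ℕ} {s : ℝ} (hs : s = a ∨ (a : ℝ) + 1 ≤ s) :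
    Summable fun k : ℕ => entTerm a s (s + 2 + 2 * k) := by
  have h0 : (0 : ℝ) ≤ a := a.cast_nonneg
  rcases hs with rfl | hs
  · have h1 := summable_logTerm (a := a) (s := a) (τ := a + 2) le_rfl (by linarith)
    have h2 := summable_logTerm (a := a) (s := a + 1) (τ := a + 2) (by linarith) (by linarith)
    have h3 := summable_rowTerm (a := a) (s := a + 1) (τ := a + 2) (by linarith) (by linarith)
    refine (((h1.add (h2.mul_left (weightUp a a))).add (h3.mul_left (coeffUp a a))).mul_left
      4).congr fun k => ?_
    have hk : (0 : ℝ) ≤ k := k.cast_nonneg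
    rw [entTerm_row_self (by linarith)]
  · have h1 := summable_logTerm (a := a) (s := s) (τ := s + 2) (by linarith) (by linarith)
    have h2 := summable_logTerm (a := a) (s := s + 1) (τ := s + 2) (by linarith) (by linarith)
    have h3 := summable_logTerm (a := a) (s := s - 1) (τ := s + 2) (by linarith) (by linarith)
    have h4 := summable_rowTerm (a := a) (s := s) (τ := s + 2) (by linarith) (by linarith)
    have h5 := summable_rowTerm (a := a) (s := s + 1) (τ := s + 2) (by linarith) (by linarith)
    have h6 := summable_rowTerm (a := a) (s := s - 1) (τ := s + 2) (by linarith) (by linarith)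
    refine ((((((h1.add (h2.mul_left (weightUp a s))).add (h3.mul_left (weightUp a (s - 1)))).add
      (h4.mul_left (a / (s * (s + 1)) * (s + 1 / 2)))).add (h5.mul_left (coeffUp a s))).add
      (h6.mul_left (coeffDown a s))).mul_left 4).congr fun k => ?_
    have hk : (0 : ℝ) ≤ k := k.cast_nonneg
    rw [entTerm_row hs (by linarith)]

lemma tsum_logTerm_eq_add {a : ℕ} {s τ : ℝ} (hs : (a : ℝ) ≤ s) (hτ : s + 1 ≤ τ) :
    ∑' k : ℕ, logTerm a s (τ + 2 * k) =
      logTerm a s τ + ∑' k : ℕ, logTerm a s (τ + 2 + 2 * k) := by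
  rw [(summable_logTerm hs hτ).tsum_eq_zero_add]
  simp only [Nat.cast_zero, mul_zero, add_zero]
  congr 1
  refine tsum_congr fun k => ?_
  push_cast
  ring_nf

lemma rowCert_boundary {a : ℕ} {s : ℝ} (hs : (a : ℝ) + 1 ≤ s) :
    rowCert (a + 1) (s - 1) (s + 2) =
      -(s + 1 / 2) * (s + 1 - a) / (2 * (s + 1) * (s + a + 1)) := by
  have h0 : (0 : ℝ) ≤ a := a.cast_nonneg
  have h1 := gammaRatio_div_add_one (a := a + 1) (s := s + 1) (by push_cast; linarith)
    (by push_cast; linarith)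
  rw [show s + 1 + 1 = s + 2 by ring] at h1
  rw [rowCert_div, show s - 1 + 2 = s + 1 by ring, h1]
  push_cast
  rw [show s - 1 + (a + 1 : ℝ) + 1 = s + a + 1 by ring,
    show s - 1 + (a + 1 : ℝ) + 2 = s + a + 2 by ring,
    show s + 2 + (a + 1 : ℝ) - 1 = s + a + 2 by ring,
    show s + 2 - (s - 1) - 2 = 1 by ring, show s + 2 + (s - 1) + 1 = 2 * (s + 1) by ring,
    show s + 2 + (a + 1 : ℝ) = s + a + 3 by ring]
  have d1 : s + a + 1 ≠ 0 := by linarith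
  have d2 : s + a + 2 ≠ 0 := by linarith
  have d3 : s + a + 3 ≠ 0 := by linarith
  have d4 : s + 1 ≠ 0 := by linarith
  field_simp
  ring

lemma rowTerm_pred {a : ℕ} {s : ℝ} (hs : (a : ℝ) + 1 ≤ s) :
    rowTerm a (s - 1) s = (s - a - 1) / (s + a + 1) * ((s + 1 / 2) / (2 * s)) := by
  have h0 : (0 : ℝ) ≤ a := a.cast_nonneg
  have h1 := gammaRatio_div_add_one (a := a + 1) (s := s - 1) (by push_cast; linarith)
    (by push_cast; linarith)
  rw [sub_add_cancel] at h1
  rw [rowTerm_div, h1]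
  push_cast
  ring_nf

/-- Expand row and column by `entTerm_row` and `entTerm_col`. The sums through `s` are of equal
parity, those through `s ± 1` of opposite parity; the explicit fractions are terms at the ends that
the two ranges do not share. -/
lemma entSum_eq {a e : ℕ} (he : e ≤ 1) (j : ℕ) (h : a + 1 ≤ e + 2 * j) (s : ℝ)
    (hs : s = e + 2 * j) :
    entSum a e j = 4 * ((trigamma (s + a + 1) - trigamma (s + 3 / 2) / 2
        - 1 / (2 * s + 1) ^ 2) / 4
      + weightUp a s * (trigamma (s + 2) / 8) + (s + 1 - a) ^ 2 / (16 * (s + 1) ^ 2)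
      + weightUp a (s - 1) * (trigamma s / 8) - (s - a) ^ 2 / (16 * s ^ 2)
      + a / (s * (s + 1)) * (s + 1 / 2) * ((s - a) / (4 * (s + 1 / 2) * (s + a + 1)))
      + (coeffUp a s + coeffUp (-a) s) *
        ((s + 1 / 2) * (s + 1 - a) / (2 * (s + 1) * (s + a + 1)))
      - coeffUp (-a) s * ((s + 1 - a) / (s + 1 + a) * ((s + 1 / 2) / (2 * (s + 1))))
      + coeffDown (-a) s * ((s - a - 1) / (s + a + 1) * ((s + 1 / 2) / (2 * s)))) := by
  have h0 : (0 : ℝ) ≤ a := a.cast_nonneg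
  have hs1 : (a : ℝ) + 1 ≤ s := by rw [hs]; exact_mod_cast h
  have S1 := summable_logTerm (a := a) (s := s) (τ := s + 2) (by linarith) (by linarith)
  have S2 := summable_logTerm (a := a) (s := s + 1) (τ := s + 2) (by linarith) (by linarith)
  have S3 := summable_logTerm (a := a) (s := s - 1) (τ := s + 2) (by linarith) (by linarith)
  have S4 := summable_rowTerm (a := a) (s := s) (τ := s + 2) (by linarith) (by linarith)
  have S5 := summable_rowTerm (a := a) (s := s + 1) (τ := s + 2) (by linarith) (by linarith)
  have S6 := summable_rowTerm (a := a) (s := s - 1) (τ := s + 2) (by linarith) (by linarith)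
  have row : ∑' k : ℕ, entTerm a s (s + 2 + 2 * k) =
      4 * (∑' k : ℕ, logTerm a s (s + 2 + 2 * k)
        + weightUp a s * ∑' k : ℕ, logTerm a (s + 1) (s + 2 + 2 * k)
        + weightUp a (s - 1) * ∑' k : ℕ, logTerm a (s - 1) (s + 2 + 2 * k)
        + a / (s * (s + 1)) * (s + 1 / 2) * ∑' k : ℕ, rowTerm a s (s + 2 + 2 * k)
        + coeffUp a s * ∑' k : ℕ, rowTerm a (s + 1) (s + 2 + 2 * k)
        + coeffDown a s * ∑' k : ℕ, rowTerm a (s - 1) (s + 2 + 2 * k)) := by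
    refine HasSum.tsum_eq ?_
    refine ((((((S1.hasSum.add (S2.hasSum.mul_left _)).add (S3.hasSum.mul_left _)).add
      (S4.hasSum.mul_left _)).add (S5.hasSum.mul_left _)).add
      (S6.hasSum.mul_left _)).mul_left 4).congr_fun ?_
    intro k
    have hk : (0 : ℝ) ≤ k := k.cast_nonneg
    exact entTerm_row hs1 (by linarith)
  have col : ∑ k ∈ Finset.range j, entTerm a ((e + 2 * k : ℕ) : ℝ) s =
      4 * (∑ k ∈ Finset.range j, logTerm a ((e + 2 * k : ℕ) : ℝ) s
        + weightUp a s * ∑ k ∈ Finset.range j, logTerm a ((e + 2 * k : ℕ) : ℝ) (s + 1)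
        + weightUp a (s - 1) * ∑ k ∈ Finset.range j, logTerm a ((e + 2 * k : ℕ) : ℝ) (s - 1)
        + a / (s * (s + 1)) * (s + 1 / 2) *
          ∑ k ∈ Finset.range j, colTerm a ((e + 2 * k : ℕ) : ℝ) s
        - coeffUp (-a) s * ∑ k ∈ Finset.range j, colTerm a ((e + 2 * k : ℕ) : ℝ) (s + 1)
        - coeffDown (-a) s * ∑ k ∈ Finset.range j, colTerm a ((e + 2 * k : ℕ) : ℝ) (s - 1)) := by
    simp only [Finset.mul_sum, ← Finset.sum_add_distrib, ← Finset.sum_sub_distrib]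
    refine Finset.sum_congr rfl fun k hk => ?_
    have hk' : (k : ℝ) + 1 ≤ j := by exact_mod_cast Finset.mem_range.1 hk
    exact entTerm_col hs1 (Nat.cast_nonneg _) (by rw [hs]; push_cast; linarith)
  have l0 := logSum_even he j (show a ≤ e + 2 * j by omega)
  have l1 := logSum_odd he (j + 1) (show a + 1 ≤ e + 2 * (j + 1) by omega)
  have l2 := logSum_odd he j h
  have c0 := tsum_rowTerm_sub_sum_colTerm_even he j (show a ≤ e + 2 * j by omega)
  have c1 := tsum_rowTerm_sub_sum_colTerm_odd he (j + 1) (show a + 1 ≤ e + 2 * (j + 1) by omega)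
  have c2 := tsum_rowTerm_sub_sum_colTerm_odd he j h
  have E1 : (e : ℝ) + 2 * ((j + 1 : ℕ) : ℝ) = s + 2 := by rw [hs]; push_cast; ring
  have E2 : ((e + 2 * j : ℕ) : ℝ) = s := by rw [hs]; push_cast; ring
  rw [E1, show s + 2 - 1 = s + 1 by ring] at l1 c1
  rw [← hs] at l0 l2 c0 c2
  rw [Finset.sum_range_succ, E2] at c1
  rw [logSum] at l0 l1 l2
  rw [Finset.sum_range_succ, E2] at l1
  have hc : 0 < s + 1 + a := by linarith
  have t2 := tsum_logTerm_eq_add (a := a) (s := s - 1) (τ := s) (by linarith) (by linarith)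
  have c3 := tsum_rowTerm_eq_add (a := a) (s := s - 1) (τ := s) (by linarith) (by linarith)
  have hsa : s - 1 = (a : ℝ) - 1 ∨ (a : ℝ) ≤ s - 1 := Or.inr (by linarith)
  have c4 := tsum_rowTerm_sub (a := a) (s := s - 1) (τ := s + 2) hsa (by linarith)
  rw [rowCert_boundary hs1, show s - 1 + 2 = s + 1 by ring] at c4
  have r0 := rowTerm_pred hs1
  have k0 := colTerm_succ (a := a) (s := s) (by linarith) hc
  have w0 := weightUp_mul_logTerm (a := a) (s := s) (by linarith) hc (by linarith)
  have w1 := weightUp_mul_logTerm (a := a) (s := s - 1) (by linarith) (by linarith) (by linarith)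
  rw [show s - 1 + 1 = s by ring] at w1
  -- Both opposite-parity differences being zero, the remaining row sums at `s ± 1` have opposite
  -- total coefficients and combine through `c4`.
  have K := coeffUp_add a s (by linarith) (by linarith) (by linarith)
  have hE : entSum a e j = ∑' k : ℕ, entTerm a s (s + 2 + 2 * k) -
      ∑ k ∈ Finset.range j, entTerm a ((e + 2 * k : ℕ) : ℝ) s := by rw [entSum, hs]
  rw [hE, row, col, ← w0, ← w1, ← r0, ← k0]
  generalize coeffUp a s = cu at *
  generalize coeffUp (-a) s = cu' at *
  generalize coeffDown a s = cd at *
  generalize coeffDown (-a) s = cd' at *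
  generalize weightUp a s = w at *
  generalize weightUp a (s - 1) = w' at *
  linear_combination 4 * l0 + 4 * w * l1 + 4 * w' * l2 - 4 * w' * t2 +
    4 * (a / (s * (s + 1)) * (s + 1 / 2)) * c0 - 4 * cu' * c1 -
    4 * cd' * c2 + 4 * cd' * c3 + 4 * (∑' k : ℕ, rowTerm a (s - 1) (s + 2 + 2 * (k : ℝ))) * K +
    4 * (cu + cu') * c4

lemma entSum_self {a e : ℕ} (he : e ≤ 1) (j : ℕ) (h : e + 2 * j = a) :
    entSum a e j = 4 * ((trigamma (2 * a + 1) - trigamma (a + 3 / 2) / 2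
        - 1 / (2 * a + 1) ^ 2) / 4
      + weightUp a a * (trigamma (a + 2) / 8) + 1 / (16 * ((a : ℝ) + 1) ^ 2)
      + coeffUp a a * (1 / (2 * a + 1) * ((a + 1 / 2) / (2 * (a + 1))))) := by
  have h0 : (0 : ℝ) ≤ a := a.cast_nonneg
  have hs : (a : ℝ) = e + 2 * j := by rw [← h]; push_cast; ring
  have S1 := summable_logTerm (a := a) (s := a) (τ := a + 2) le_rfl (by linarith)
  have S2 := summable_logTerm (a := a) (s := a + 1) (τ := a + 2) (by linarith) (by linarith)
  have S5 := summable_rowTerm (a := a) (s := a + 1) (τ := a + 2) (by linarith) (by linarith)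
  have row : ∑' k : ℕ, entTerm a a (a + 2 + 2 * k) =
      4 * (∑' k : ℕ, logTerm a a (a + 2 + 2 * k)
        + weightUp a a * ∑' k : ℕ, logTerm a (a + 1) (a + 2 + 2 * k)
        + coeffUp a a * ∑' k : ℕ, rowTerm a (a + 1) (a + 2 + 2 * k)) := by
    refine HasSum.tsum_eq ?_
    refine (((S1.hasSum.add (S2.hasSum.mul_left _)).add (S5.hasSum.mul_left _)).mul_left
      4).congr_fun ?_
    intro k
    have hk : (0 : ℝ) ≤ k := k.cast_nonneg
    exact entTerm_row_self (by linarith)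
  have z (k) (hk : k ∈ Finset.range j) : gammaRatio a ((e + 2 * k : ℕ) : ℝ) = 0 :=
    gammaRatio_natCast_eq_zero (by have := Finset.mem_range.1 hk; omega)
  have colE : ∑ k ∈ Finset.range j, entTerm a ((e + 2 * k : ℕ) : ℝ) a = 0 :=
    Finset.sum_eq_zero fun k hk => by rw [entTerm, z k hk]; simp
  have colL (t : ℝ) : ∑ k ∈ Finset.range j, logTerm a ((e + 2 * k : ℕ) : ℝ) t = 0 :=
    Finset.sum_eq_zero fun k hk => by rw [logTerm, z k hk]; simp
  have colC (t : ℝ) : ∑ k ∈ Finset.range j, colTerm a ((e + 2 * k : ℕ) : ℝ) t = 0 :=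
    Finset.sum_eq_zero fun k hk => by rw [colTerm, z k hk]; simp
  have l0 := logSum_even he j (show a ≤ e + 2 * j by omega)
  have l1 := logSum_odd he (j + 1) (show a + 1 ≤ e + 2 * (j + 1) by omega)
  have c1 := tsum_rowTerm_sub_sum_colTerm_odd he (j + 1) (show a + 1 ≤ e + 2 * (j + 1) by omega)
  have E1 : (e : ℝ) + 2 * ((j + 1 : ℕ) : ℝ) = a + 2 := by rw [hs]; push_cast; ring
  have E2 : ((e + 2 * j : ℕ) : ℝ) = a := by rw [h]
  rw [E1, show (a : ℝ) + 2 - 1 = a + 1 by ring] at l1 c1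
  rw [← hs] at l0
  rw [Finset.sum_range_succ, E2, colC, zero_add] at c1
  rw [logSum] at l0 l1
  rw [Finset.sum_range_succ, E2, colL, zero_add] at l1
  rw [colL] at l0
  have hc : 0 < (a : ℝ) + 1 + a := by linarith
  have k0 := colTerm_succ (a := a) (s := a) (by linarith) hc
  have w0 := weightUp_mul_logTerm (a := a) (s := a) (by linarith) hc (by linarith)
  rw [show (a : ℝ) + 1 - a = 1 by ring] at w0 k0
  rw [show (a : ℝ) + 1 + a = 2 * a + 1 by ring] at k0
  rw [show (a : ℝ) + a + 1 = 2 * a + 1 by ring] at l0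
  have hE : entSum a e j = ∑' k : ℕ, entTerm a a (a + 2 + 2 * k) -
      ∑ k ∈ Finset.range j, entTerm a ((e + 2 * k : ℕ) : ℝ) a := by rw [entSum, hs]
  rw [hE, row, colE, ← k0]
  linear_combination 4 * l0 + 4 * weightUp a a * l1 + 4 * coeffUp a a * c1 + 4 * w0

/-! ### Increments of the closed form and the double sum -/

/-- The closed form of the variance of the entropy. -/
noncomputable def varianceFormula (m n : ℝ) : ℝ :=
  (1 / 2 - m - n) * trigamma (2 * m + 2 * n) + (n - 1 / 2) * trigamma (2 * n)
    + (m * (2 * m + n - 1) / (2 * m + 2 * n - 1) - 1 / 8) * trigamma (m + n)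
    + trigamma n / 8 - 1 / 2 * (digamma (2 * m + 2 * n) - digamma (2 * n))

lemma rational_part_sub {s a : ℝ} (hs : 1 ≤ s) (ha : 0 ≤ a) :
    4 * (-1 / (2 * s + 1) ^ 2 / 4 - weightUp a s * ((1 / s ^ 2 + 1 / (s + 1) ^ 2) / 8)
      + (s + 1 - a) ^ 2 / (16 * (s + 1) ^ 2) - (s - a) ^ 2 / (16 * s ^ 2)
      + a / (s * (s + 1)) * (s + 1 / 2) * ((s - a) / (4 * (s + 1 / 2) * (s + a + 1)))
      + (coeffUp a s + coeffUp (-a) s) *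
        ((s + 1 / 2) * (s + 1 - a) / (2 * (s + 1) * (s + a + 1)))
      - coeffUp (-a) s * ((s + 1 - a) / (s + 1 + a) * ((s + 1 / 2) / (2 * (s + 1))))
      + coeffDown (-a) s * ((s - a - 1) / (s + a + 1) * ((s + 1 / 2) / (2 * s))))
      + 2 * (1 / (2 * s) ^ 2 + 1 / (2 * s + 1) ^ 2) - 1 / s ^ 2 / 2 =
    (3 / 2 + s) * (1 / (2 * s) ^ 2 + 1 / (2 * s + 1) ^ 2 + 1 / (2 * s + 2) ^ 2
        + 1 / (2 * s + 3) ^ 2)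
      - (((s - a) / 2 + 1) * ((s - a) + (s + a) / 2 + 2) / (2 * s + 3) - 1 / 8) *
        (1 / s ^ 2 + 1 / (s + 1) ^ 2)
      - 1 / 2 * (1 / (2 * s) + 1 / (2 * s + 1) + 1 / (2 * s + 2) + 1 / (2 * s + 3)) := by
  have d1 : s * 2 + 1 ≠ 0 := by linarith
  have d2 : s * 2 + 3 ≠ 0 := by linarith
  have d3 : s + 1 ≠ 0 := by linarith
  have d4 : s ≠ 0 := by linarith
  have d5 : s + a + 1 ≠ 0 := by linarith
  unfold weightUp coeffUp coeffDown
  rw [show s + 1 + a = s + a + 1 by ring, show 2 * s + 2 = 2 * (s + 1) by ring,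
    show s + 1 / 2 = (s * 2 + 1) / 2 by ring, mul_comm 2 s]
  field_simp
  ring

/-- With `s = m + n` and `a = n - m` this matches the coefficient of `ψ₁(s)` in `entSum` with the
increment of the coefficient of `ψ₁(m+n)`. -/
lemma trigamma_coeff_sub {s a : ℝ} (hs : 1 ≤ s) :
    (1 + weightUp a s + weightUp a (s - 1)) / 2 =
      ((s - a) / 2 + 1) * ((s - a) + (s + a) / 2 + 2) / (2 * s + 3)
      - (s - a) / 2 * ((s - a) + (s + a) / 2 - 1) / (2 * s - 1) := by
  have d1 : s * 2 + 1 ≠ 0 := by linarith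
  have d2 : s * 2 + 3 ≠ 0 := by linarith
  have d3 : s * 2 - 1 ≠ 0 := by linarith
  unfold weightUp
  rw [show 2 * (s - 1) + 1 = s * 2 - 1 by ring, show 2 * (s - 1) + 3 = s * 2 + 1 by ring,
    mul_comm 2 s]
  field_simp
  ring

lemma entSum_eq_sub {a e : ℕ} (he : e ≤ 1) (j m : ℕ) (hm : 1 ≤ m) (h : e + 2 * j = a + 2 * m) :
    entSum a e j = varianceFormula (m + 1) (m + 1 + a) - varianceFormula m (m + a) := by
  have h0 : (0 : ℝ) ≤ a := a.cast_nonneg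
  have hm1 : (1 : ℝ) ≤ m := by exact_mod_cast hm
  obtain ⟨s, hs⟩ : ∃ s : ℝ, s = a + 2 * m := ⟨_, rfl⟩
  obtain ⟨n, hn⟩ : ∃ n : ℝ, n = m + a := ⟨_, rfl⟩
  have hs' : s = e + 2 * j := by rw [hs]; exact_mod_cast h.symm
  rw [entSum_eq he j (by omega) s hs']
  have R := rational_part_sub (s := s) (a := a) (by linarith) h0
  have C := trigamma_coeff_sub (s := s) (a := a) (by linarith)
  have s0 : 0 < s := by linarith
  have n0 : 0 < n := by linarith
  have t1 := trigamma_add_one (x := 2 * s) (by linarith)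
  have t2 := trigamma_add_one (x := 2 * s + 1) (by linarith)
  have t3 := trigamma_add_one (x := 2 * s + 2) (by linarith)
  have t4 := trigamma_add_one (x := 2 * s + 3) (by linarith)
  have t5 := trigamma_add_one s0
  have t6 := trigamma_add_one (x := s + 1) (by linarith)
  have t7 := trigamma_add_one n0
  have t8 := trigamma_add_one (x := 2 * n) (by linarith)
  have t9 := trigamma_add_one (x := 2 * n + 1) (by linarith)
  have t10 := trigamma_two_mul (x := s + 1) (by linarith)
  have g1 := digamma_add_one (x := 2 * s) (by linarith)
  have g2 := digamma_add_one (x := 2 * s + 1) (by linarith)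
  have g3 := digamma_add_one (x := 2 * s + 2) (by linarith)
  have g4 := digamma_add_one (x := 2 * s + 3) (by linarith)
  have g8 := digamma_add_one (x := 2 * n) (by linarith)
  have g9 := digamma_add_one (x := 2 * n + 1) (by linarith)
  rw [show 2 * s + 1 + 1 = 2 * s + 2 by ring] at t2 g2
  rw [show 2 * s + 2 + 1 = 2 * s + 3 by ring] at t3 g3
  rw [show 2 * s + 3 + 1 = 2 * s + 4 by ring] at t4 g4
  rw [show s + 1 + 1 = s + 2 by ring] at t6
  rw [show 2 * n + 1 + 1 = 2 * n + 2 by ring] at t9 g9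
  rw [show 2 * (s + 1) = 2 * s + 2 by ring, show s + 1 + 1 / 2 = s + 3 / 2 by ring] at t10
  -- The part depending on `n` alone: the recurrences at `2n` and `n` leave exactly the `1/(2n)²`
  -- that separates `ψ₁(s+a+1) = ψ₁(2n+1)` from `ψ₁(2n)`.
  have N : (n + 1 / 2) * (1 / (2 * n) ^ 2 + 1 / (2 * n + 1) ^ 2) + 1 / n ^ 2 / 8
      - 1 / 2 * (1 / (2 * n) + 1 / (2 * n + 1)) = 1 / (2 * n) ^ 2 := by
    have : n * 2 + 1 ≠ 0 := by linarith
    rw [mul_comm 2 n]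
    field_simp
    ring
  have hm' : (m : ℝ) = (s - a) / 2 := by linarith
  rw [varianceFormula, varianceFormula,
    show 2 * ((m : ℝ) + 1) + 2 * (m + 1 + a) = 2 * s + 4 by rw [hs]; ring,
    show 2 * (m : ℝ) + 2 * (m + a) = 2 * s by rw [hs]; ring,
    show (m : ℝ) + 1 + (m + 1 + a) = s + 2 by rw [hs]; ring,
    show (m : ℝ) + (m + a) = s by rw [hs]; ring,
    show (m : ℝ) + 1 + a = n + 1 by rw [hn]; ring, ← hn,
    show 2 * (n + 1) = 2 * n + 2 by ring]
  have e1 : trigamma (s + a + 1) = trigamma (2 * n) - 1 / (2 * n) ^ 2 := by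
    rw [← t8]
    congr 1
    rw [hs, hn]
    ring
  have e2 : trigamma (s + 3 / 2) = 4 * (trigamma (2 * s) - 1 / (2 * s) ^ 2
      - 1 / (2 * s + 1) ^ 2) - (trigamma s - 1 / s ^ 2) := by
    rw [← t5, ← t1, ← t2]
    linarith
  rw [e1, e2, t4, t3, t2, t1, t6, t5, t9, t8, t7, g4, g3, g2, g1, g9, g8, hm',
    show (n : ℝ) = (s + a) / 2 by linarith]
  rw [show (n : ℝ) = (s + a) / 2 by linarith] at N
  generalize trigamma (2 * s) = A1
  generalize trigamma s = A2
  generalize trigamma (2 * ((s + a) / 2)) = A3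
  generalize trigamma ((s + a) / 2) = A4
  generalize digamma (2 * s) = A5
  generalize digamma (2 * ((s + a) / 2)) = A6
  -- All special functions now sit at `2s`, `s`, `2n`, `n`. `R` and `N` settle the rational part and
  -- `C` the coefficient of `ψ₁(s)`; the other coefficients agree identically.
  linear_combination R + A2 * C + N

lemma entSum_eq_self {a e : ℕ} (he : e ≤ 1) (j : ℕ) (h : e + 2 * j = a) :
    entSum a e j = varianceFormula 1 (1 + a) := by
  have h0 : (0 : ℝ) ≤ a := a.cast_nonneg
  rw [entSum_self he j h]
  generalize (a : ℝ) = s at *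
  have t2 := trigamma_add_one (x := 2 * s + 1) (by linarith)
  have t3 := trigamma_add_one (x := 2 * s + 2) (by linarith)
  have t4 := trigamma_add_one (x := 2 * s + 3) (by linarith)
  have t6 := trigamma_add_one (x := s + 1) (by linarith)
  have t10 := trigamma_two_mul (x := s + 1) (by linarith)
  have g3 := digamma_add_one (x := 2 * s + 2) (by linarith)
  have g4 := digamma_add_one (x := 2 * s + 3) (by linarith)
  rw [show 2 * s + 1 + 1 = 2 * s + 2 by ring] at t2
  rw [show 2 * s + 2 + 1 = 2 * s + 3 by ring] at t3 g3
  rw [show 2 * s + 3 + 1 = 2 * s + 4 by ring] at t4 g4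
  rw [show s + 1 + 1 = s + 2 by ring] at t6
  rw [show 2 * (s + 1) = 2 * s + 2 by ring, show s + 1 + 1 / 2 = s + 3 / 2 by ring] at t10
  have e2 : trigamma (s + 3 / 2) = 4 * (trigamma (2 * s + 1) - 1 / (2 * s + 1) ^ 2)
      - trigamma (s + 1) := by
    rw [← t2]
    linarith
  rw [varianceFormula, show 2 * (1 : ℝ) + 2 * (1 + s) = 2 * s + 4 by ring,
    show 2 * (1 + s) = 2 * s + 2 by ring, show 1 + (1 + s) = s + 2 by ring,
    show 1 + s = s + 1 by ring, e2, t4, t3, t2, t6, g4, g3]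
  generalize trigamma (2 * s + 1) = A1
  generalize trigamma (s + 1) = A2
  generalize digamma (2 * s + 2) = A5
  have d1 : s * 2 + 1 ≠ 0 := by linarith
  have d2 : s * 2 + 3 ≠ 0 := by linarith
  have d3 : s + 1 ≠ 0 := by linarith
  unfold weightUp coeffUp
  rw [show s + s + 1 = s * 2 + 1 by ring, show s + 1 - s = 1 by ring, sub_self, zero_div, add_zero,
    show 2 * s + 2 = 2 * (s + 1) by ring, mul_comm 2 s,
    show 2 * (1 : ℝ) + (s + 1) - 1 = s + 2 by ring,
    show s * 2 + 4 - 1 = s * 2 + 3 by ring]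
  field_simp
  ring

lemma entTerm_eq_zero {a u : ℕ} (h : u < a) (s : ℝ) : entTerm a u s = 0 := by
  simp [entTerm, gammaRatio_natCast_eq_zero h]

lemma sum_entTerm_lattice {a e j₀ : ℕ} (h : e + 2 * j₀ = a) (m : ℕ) (s : ℝ) :
    ∑ k ∈ Finset.range (j₀ + m), entTerm a ((e + 2 * k : ℕ) : ℝ) s =
      ∑ j ∈ Finset.range m, entTerm a ((a + 2 * j : ℕ) : ℝ) s := by
  rw [Finset.sum_range_add, Finset.sum_eq_zero, zero_add]
  · refine Finset.sum_congr rfl fun j _ => ?_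
    rw [← h]
    congr 2
    ring
  · intro k hk
    exact entTerm_eq_zero (by have := Finset.mem_range.1 hk; omega) s

lemma summable_entTerm_shift (a j m : ℕ) (h : j < m) :
    Summable fun k : ℕ => entTerm a ((a + 2 * j : ℕ) : ℝ) ((a + 2 * (m + k) : ℕ) : ℝ) := by
  have hs : ((a + 2 * j : ℕ) : ℝ) = a ∨ (a : ℝ) + 1 ≤ ((a + 2 * j : ℕ) : ℝ) := by
    rcases Nat.eq_zero_or_pos j with rfl | h
    · simp
    · right
      exact_mod_cast (by omega : a + 1 ≤ a + 2 * j)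
  refine ((summable_nat_add_iff (m - (j + 1))).2 (summable_entTerm hs)).congr fun k => ?_
  congr 1
  exact_mod_cast (by omega : a + 2 * j + 2 + 2 * (k + (m - (j + 1))) = a + 2 * (m + k))

/-- Induction on `m`: the index set `{j < m ≤ k}` gains the row `j = m` over `k > m` and loses the
column `k = m` over `j < m`, a net change of `entSum`. -/
theorem sum_tsum_entTerm (a m : ℕ) (hm : 1 ≤ m) :
    ∑ j ∈ Finset.range m, ∑' k : ℕ,
      entTerm a ((a + 2 * j : ℕ) : ℝ) ((a + 2 * (m + k) : ℕ) : ℝ) =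
    varianceFormula m (m + a) := by
  obtain ⟨e, j₀, he, h⟩ : ∃ e j₀ : ℕ, e ≤ 1 ∧ e + 2 * j₀ = a :=
    ⟨a % 2, a / 2, by omega, by omega⟩
  have row (m : ℕ) : ∑' k : ℕ, entTerm a ((a + 2 * m : ℕ) : ℝ) ((a + 2 * (m + 1 + k) : ℕ) : ℝ)
      - ∑ j ∈ Finset.range m, entTerm a ((a + 2 * j : ℕ) : ℝ) ((a + 2 * m : ℕ) : ℝ) =
      entSum a e (j₀ + m) := by
    rw [entSum, ← sum_entTerm_lattice h]
    have : (e : ℝ) + 2 * ((j₀ + m : ℕ) : ℝ) = ((a + 2 * m : ℕ) : ℝ) := by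
      rw [← h]
      push_cast
      ring
    rw [this]
    congr 1
    refine tsum_congr fun k => ?_
    congr 1
    push_cast
    ring
  induction m, hm using Nat.le_induction with
  | base =>
    have := row 0
    rw [Finset.range_zero, Finset.sum_empty, sub_zero, add_zero, entSum_eq_self he j₀ h] at this
    simpa using this
  | succ m hm ih =>
    have r := row m
    rw [entSum_eq_sub he (j₀ + m) m hm (by omega), ← ih] at r
    have step (j) (hj : j ∈ Finset.range m) :
        ∑' k : ℕ, entTerm a ((a + 2 * j : ℕ) : ℝ) ((a + 2 * (m + k) : ℕ) : ℝ) =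
        entTerm a ((a + 2 * j : ℕ) : ℝ) ((a + 2 * m : ℕ) : ℝ) +
        ∑' k : ℕ, entTerm a ((a + 2 * j : ℕ) : ℝ) ((a + 2 * (m + 1 + k) : ℕ) : ℝ) := by
      rw [(summable_entTerm_shift a j m (Finset.mem_range.1 hj)).tsum_eq_zero_add]
      congr 1
      refine tsum_congr fun k => ?_
      rw [show m + (k + 1) = m + 1 + k by ring]
    rw [Finset.sum_congr rfl step, Finset.sum_add_distrib] at r
    rw [Finset.sum_range_succ]
    push_cast
    push_cast at r
    linear_combination r

/-! ### Ultraspherical polynomials and their differential equation -/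

open Polynomial

/-- The ultraspherical polynomials with parameter `a + 1/2`, normalised by the value `1` at `1`. -/
noncomputable def gegen (a : ℕ) : ℕ → ℝ[X]
  | 0 => 1
  | 1 => X
  | i + 2 => C ((i + 2 * a + 2 : ℝ)⁻¹) *
      (C (2 * i + 2 * a + 3 : ℝ) * X * gegen a (i + 1) - C (i + 1 : ℝ) * gegen a i)

lemma gegen_zero (a : ℕ) : gegen a 0 = 1 := rfl

lemma gegen_one (a : ℕ) : gegen a 1 = X := rfl

lemma gegen_rec (a i : ℕ) : C (i + 2 * a + 2 : ℝ) * gegen a (i + 2) =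
    C (2 * i + 2 * a + 3 : ℝ) * X * gegen a (i + 1) - C (i + 1 : ℝ) * gegen a i := by
  have h : (i + 2 * a + 2 : ℝ) ≠ 0 := by positivity
  rw [gegen, ← mul_assoc, ← C_mul, mul_inv_cancel₀ h, C_1, one_mul]

lemma degree_gegen (a i : ℕ) : (gegen a i).degree = i := by
  induction i using Nat.twoStepInduction with
  | zero => simp [gegen_zero]
  | one => simp [gegen_one]
  | more i h0 h1 =>
    have h : (i + 2 * a + 2 : ℝ)⁻¹ ≠ 0 := by positivity
    have h' : (2 * i + 2 * a + 3 : ℝ) ≠ 0 := by positivity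
    have e1 : (C (2 * i + 2 * a + 3 : ℝ) * X * gegen a (i + 1)).degree =
        ((i + 2 : ℕ) : WithBot ℕ) := by
      rw [mul_assoc, degree_C_mul h', mul_comm, degree_mul, degree_X, h1]
      rfl
    rw [gegen, degree_C_mul h, degree_sub_eq_left_of_degree_lt, e1]
    rw [e1]
    rw [degree_C_mul (by positivity), h0]
    exact_mod_cast (by omega : i < i + 2)

lemma eval_one_gegen (a i : ℕ) : (gegen a i).eval 1 = 1 := by
  induction i using Nat.twoStepInduction with
  | zero => simp [gegen_zero]
  | one => simp [gegen_one]
  | more i h0 h1 =>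
    have h : (i + 2 * a + 2 : ℝ) ≠ 0 := by positivity
    have := congrArg (Polynomial.eval 1) (gegen_rec a i)
    simp only [eval_mul, eval_sub, eval_C, eval_X, h0, h1] at this
    refine mul_left_cancel₀ h ?_
    rw [this]
    ring

lemma eval_neg_gegen (a i : ℕ) (x : ℝ) : (gegen a i).eval (-x) = (-1) ^ i * (gegen a i).eval x := by
  induction i using Nat.twoStepInduction with
  | zero => simp [gegen_zero]
  | one => simp [gegen_one]
  | more i h0 h1 =>
    have h : (i + 2 * a + 2 : ℝ) ≠ 0 := by positivity
    have e1 := congrArg (Polynomial.eval x) (gegen_rec a i)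
    have e2 := congrArg (Polynomial.eval (-x)) (gegen_rec a i)
    simp only [eval_mul, eval_sub, eval_C, eval_X, h0, h1] at e1 e2
    refine mul_left_cancel₀ h ?_
    rw [e2]
    rw [pow_succ, pow_succ] at *
    linear_combination (-(-1) ^ i) * e1

/-- The lowering and raising relations need each other, hence the joint induction; the lowering step
differentiates the three-term recurrence. -/
lemma gegen_deriv_aux (a i : ℕ) :
    (1 - X ^ 2) * derivative (gegen a (i + 1)) =
        C (i + 1 : ℝ) * (gegen a i - X * gegen a (i + 1)) ∧
      (1 - X ^ 2) * derivative (gegen a i) =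
        C (i + 2 * a + 1 : ℝ) * (X * gegen a i - gegen a (i + 1)) := by
  induction i with
  | zero => constructor <;> simp [gegen_zero, gegen_one]; ring
  | succ i ih =>
    obtain ⟨h1, h2⟩ := ih
    have r := gegen_rec a i
    have r' := congrArg derivative r
    simp only [derivative_mul, derivative_sub, derivative_C, derivative_X, zero_mul, zero_add,
      mul_one] at r'
    have hc : C (i + 2 * a + 2 : ℝ) ≠ 0 := by
      rw [Ne, C_eq_zero]; positivity
    simp only [C_add, C_mul, C_1, map_natCast, C_ofNat, Nat.cast_add, Nat.cast_one] at *
    constructor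
    · refine mul_left_cancel₀ hc ?_
      linear_combination (1 - X ^ 2) * r' + (2 * i + 2 * a + 3) * X * h1 - (i + 1) * h2 + (i + 2) * X * r
    · linear_combination h1 + r

lemma gegen_deriv_succ (a i : ℕ) : (1 - X ^ 2) * derivative (gegen a (i + 1)) =
    C (i + 1 : ℝ) * (gegen a i - X * gegen a (i + 1)) := (gegen_deriv_aux a i).1

lemma gegen_deriv (a i : ℕ) : (1 - X ^ 2) * derivative (gegen a i) =
    C (i + 2 * a + 1 : ℝ) * (X * gegen a i - gegen a (i + 1)) := (gegen_deriv_aux a i).2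

/-- The operator with `(1-x²)^a · (weightedDeriv a q) = d/dx ((1-x²)^(a+1) q)`. -/
noncomputable def weightedDeriv (a : ℕ) (q : ℝ[X]) : ℝ[X] :=
  (1 - X ^ 2) * derivative q - C (2 * (a + 1) : ℝ) * X * q

lemma one_sub_X_sq_ne_zero : (1 - X ^ 2 : ℝ[X]) ≠ 0 := by
  intro h
  have := congrArg (Polynomial.eval 0) h
  simp at this

lemma gegen_ode (a i : ℕ) :
    weightedDeriv a (derivative (gegen a i)) = -(C (i * (i + 2 * a + 1) : ℝ) * gegen a i) := by
  rcases i with _ | i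
  · simp [gegen_zero, weightedDeriv]
  refine mul_left_cancel₀ one_sub_X_sq_ne_zero ?_
  have h1 := gegen_deriv_succ a i
  have h2 := gegen_deriv a i
  have h3 := congrArg derivative h1
  simp only [derivative_mul, derivative_sub, derivative_C, derivative_X, zero_mul, zero_add,
      derivative_one, derivative_X_pow, one_mul] at h3
  unfold weightedDeriv
  simp only [C_add, C_mul, C_1, map_natCast, C_ofNat, Nat.cast_add, Nat.cast_one, Nat.cast_ofNat] at *
  linear_combination (1 - X ^ 2) * h3 + (i + 1) * h2 - (i + 1) * X * h1 - 2 * a * X * h1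

/-- Lagrange's identity: the eigenvalue difference times a product of eigenfunctions is, with the
weight, an exact derivative. -/
lemma weightedDeriv_wronskian (a i l : ℕ) :
    weightedDeriv a (derivative (gegen a i) * gegen a l - gegen a i * derivative (gegen a l)) =
      C ((l * (l + 2 * a + 1) - i * (i + 2 * a + 1) : ℝ)) * (gegen a i * gegen a l) := by
  have h1 := gegen_ode a i
  have h2 := gegen_ode a l
  unfold weightedDeriv at *
  simp only [derivative_mul, derivative_sub, C_sub] at *
  linear_combination gegen a l * h1 - gegen a i * h2

/-- The combination of the two ladder relations in which a factor `1 - X` cancels; integrated, it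
gives the recursion of `boundaryConst`. -/
lemma gegen_deriv_succ_combination (a l : ℕ) :
    (1 + X) * (C (l + 2 * a + 1 : ℝ) * derivative (gegen a (l + 1)) -
      C (l + 1 : ℝ) * derivative (gegen a l)) =
    C ((l + 1) * (l + 2 * a + 1) : ℝ) * (gegen a l + gegen a (l + 1)) := by
  have h1 := gegen_deriv_succ a l
  have h2 := gegen_deriv a l
  have h : (1 - X : ℝ[X]) ≠ 0 := by
    intro h
    have := congrArg (Polynomial.eval 0) h
    simp at this
  refine mul_left_cancel₀ h ?_
  simp only [C_add, C_mul, C_1, map_natCast, C_ofNat] at *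
  linear_combination (l + 2 * a + 1) * h1 - (l + 1) * h2

/-- The polynomials `gegen a` as a polynomial sequence. -/
noncomputable def gegenSeq (a : ℕ) : Polynomial.Sequence ℝ where
  elems' := gegen a
  degree_eq' := degree_gegen a

lemma mem_span_gegen {a l : ℕ} {p : ℝ[X]} (hp : p.degree < l) :
    p ∈ Submodule.span ℝ (gegen a '' Set.Iio l) := by
  have := (gegenSeq a).span_degreeLT (m := l) fun i _ => by
    rw [isUnit_iff_ne_zero, Ne, leadingCoeff_eq_zero]
    exact (gegenSeq a).ne_zero i
  have h : p ∈ degreeLT ℝ l := mem_degreeLT.2 hp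
  rw [← this] at h
  exact h

/-! ### Matrix elements of `ln(1-x)` and `(1-x) ln(1-x)` -/

lemma intervalIntegrable_eval_mul (a : ℕ) (p : ℝ[X]) (b c : ℝ) :
    IntervalIntegrable (fun x : ℝ => p.eval x * (1 - x ^ 2) ^ a) volume b c :=
  Continuous.intervalIntegrable (by fun_prop) _ _

lemma intervalIntegrable_eval_mul_log (a : ℕ) (p : ℝ[X]) :
    IntervalIntegrable (fun x : ℝ => p.eval x * (1 - x ^ 2) ^ a * Real.log (1 - x))
      volume (-1) 1 := by
  have h : IntervalIntegrable (fun x : ℝ => Real.log (1 - x)) volume (-1) 1 := by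
    have := (intervalIntegral.intervalIntegrable_log' (a := 2) (b := 0)).comp_sub_left 1
    norm_num at this
    exact this
  exact h.continuousOn_mul (Continuous.continuousOn (by fun_prop))

/-- Integration against the weight `(1-x²)^a` on `[-1,1]`. -/
noncomputable def weightInt (a : ℕ) : ℝ[X] →ₗ[ℝ] ℝ where
  toFun p := ∫ x in (-1 : ℝ)..1, p.eval x * (1 - x ^ 2) ^ a
  map_add' p q := by
    rw [← intervalIntegral.integral_add (intervalIntegrable_eval_mul a p _ _)
      (intervalIntegrable_eval_mul a q _ _)]
    simp only [eval_add, add_mul]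
  map_smul' c p := by
    rw [RingHom.id_apply, smul_eq_mul, ← intervalIntegral.integral_const_mul]
    simp only [eval_smul, smul_eq_mul, mul_assoc]

/-- Integration against the weight `(1-x²)^a ln(1-x)` on `[-1,1]`. -/
noncomputable def logInt (a : ℕ) : ℝ[X] →ₗ[ℝ] ℝ where
  toFun p := ∫ x in (-1 : ℝ)..1, p.eval x * (1 - x ^ 2) ^ a * Real.log (1 - x)
  map_add' p q := by
    rw [← intervalIntegral.integral_add (intervalIntegrable_eval_mul_log a p)
      (intervalIntegrable_eval_mul_log a q)]
    simp only [eval_add, add_mul]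
  map_smul' c p := by
    rw [RingHom.id_apply, smul_eq_mul, ← intervalIntegral.integral_const_mul]
    simp only [eval_smul, smul_eq_mul, mul_assoc]

lemma weightInt_apply (a : ℕ) (p : ℝ[X]) :
    weightInt a p = ∫ x in (-1 : ℝ)..1, p.eval x * (1 - x ^ 2) ^ a := rfl

lemma logInt_apply (a : ℕ) (p : ℝ[X]) :
    logInt a p = ∫ x in (-1 : ℝ)..1, p.eval x * (1 - x ^ 2) ^ a * Real.log (1 - x) := rfl

lemma weightInt_C_mul (a : ℕ) (c : ℝ) (p : ℝ[X]) : weightInt a (C c * p) = c * weightInt a p := by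
  rw [← smul_eq_C_mul, map_smul, smul_eq_mul]

lemma logInt_C_mul (a : ℕ) (c : ℝ) (p : ℝ[X]) : logInt a (C c * p) = c * logInt a p := by
  rw [← smul_eq_C_mul, map_smul, smul_eq_mul]

lemma hasDerivAt_weighted (a : ℕ) (q : ℝ[X]) (x : ℝ) :
    HasDerivAt (fun x : ℝ => q.eval x * (1 - x ^ 2) ^ (a + 1))
      ((weightedDeriv a q).eval x * (1 - x ^ 2) ^ a) x := by
  have h1 : HasDerivAt (fun x : ℝ => 1 - x ^ 2) (-(2 * x)) x := by
    simpa using (hasDerivAt_pow 2 x).const_sub 1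
  have h2 := (q.hasDerivAt x).mul (h1.pow (a + 1))
  refine h2.congr_deriv ?_
  simp only [weightedDeriv, eval_sub, eval_mul, eval_one, eval_pow, eval_X, eval_C,
    add_tsub_cancel_right, Nat.cast_add, Nat.cast_one, Pi.pow_apply, pow_succ]
  ring

lemma weightInt_weightedDeriv (a : ℕ) (q : ℝ[X]) : weightInt a (weightedDeriv a q) = 0 := by
  rw [weightInt_apply, intervalIntegral.integral_eq_sub_of_hasDerivAt
    (fun x _ => hasDerivAt_weighted a q x) (intervalIntegrable_eval_mul a _ _ _)]
  simp

/-- Integration by parts: differentiating `ln(1-x)` turns `(1-x²)^(a+1)` into `(1+x)(1-x²)^a`, and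
the boundary terms vanish because `(1-x) ln(1-x) → 0` at `1`. -/
lemma logInt_weightedDeriv (a : ℕ) (q : ℝ[X]) :
    logInt a (weightedDeriv a q) = weightInt a ((1 + X) * q) := by
  have hF : ContinuousOn (fun x : ℝ => q.eval x * (1 - x ^ 2) ^ (a + 1) * Real.log (1 - x))
      (Set.Icc (-1) 1) := by
    have : Continuous fun x : ℝ => q.eval x * (1 - x ^ 2) ^ a * (1 + x) *
        ((1 - x) * Real.log (1 - x)) := by
      have := Real.continuous_mul_log.comp
        (continuous_const.sub continuous_id : Continuous fun x : ℝ => 1 - x)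
      refine Continuous.mul (by fun_prop) this
    refine this.continuousOn.congr fun x _ => ?_
    simp only [pow_succ]
    ring
  have hd : ∀ x ∈ Set.Ioo (-1 : ℝ) 1,
      HasDerivAt (fun x : ℝ => q.eval x * (1 - x ^ 2) ^ (a + 1) * Real.log (1 - x))
      ((weightedDeriv a q).eval x * (1 - x ^ 2) ^ a * Real.log (1 - x) -
        ((1 + X) * q).eval x * (1 - x ^ 2) ^ a) x := by
    intro x hx
    have hx1 : 1 - x ≠ 0 := by linarith [hx.2]
    have h1 : HasDerivAt (fun x : ℝ => 1 - x) (-1) x := by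
      simpa using (hasDerivAt_id x).const_sub 1
    refine ((hasDerivAt_weighted a q x).mul (h1.log hx1)).congr_deriv ?_
    simp only [eval_mul, eval_add, eval_one, eval_X, pow_succ]
    field_simp
    ring
  have hi := intervalIntegral.integral_eq_sub_of_hasDerivAt_of_le (by norm_num) hF hd
    ((intervalIntegrable_eval_mul_log a _).sub (intervalIntegrable_eval_mul a _ _ _))
  rw [intervalIntegral.integral_sub (intervalIntegrable_eval_mul_log a _)
    (intervalIntegrable_eval_mul a _ _ _), ← logInt_apply, ← weightInt_apply] at hi
  norm_num at hi
  linarith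

lemma eigenvalue_sub (a i l : ℝ) :
    l * (l + 2 * a + 1) - i * (i + 2 * a + 1) = (l - i) * (l + i + 2 * a + 1) := by ring

lemma weightInt_gegen_mul_gegen {a i l : ℕ} (h : i ≠ l) :
    weightInt a (gegen a i * gegen a l) = 0 := by
  have := weightInt_weightedDeriv a
    (derivative (gegen a i) * gegen a l - gegen a i * derivative (gegen a l))
  rw [weightedDeriv_wronskian, weightInt_C_mul, eigenvalue_sub, mul_eq_zero, mul_eq_zero] at this
  rcases this with (h1 | h1) | h1
  · exact absurd (Nat.cast_injective (R := ℝ) (by linarith)) h.symm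
  · exact absurd h1 (by positivity)
  · exact h1

lemma weightInt_mul_gegen {a l : ℕ} {p : ℝ[X]} (hp : p.degree < l) :
    weightInt a (p * gegen a l) = 0 := by
  have h := mem_span_gegen (a := a) hp
  clear hp
  induction h using Submodule.span_induction with
  | mem p hp =>
    obtain ⟨i, hi, rfl⟩ := hp
    exact weightInt_gegen_mul_gegen (ne_of_lt hi)
  | zero => simp
  | add p q _ _ h1 h2 => rw [add_mul, map_add, h1, h2, add_zero]
  | smul c p _ h1 => rw [smul_mul_assoc, map_smul, h1, smul_zero]

/-- The boundary constant of the `l`-th polynomial. -/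
noncomputable def boundaryConst (a l : ℕ) : ℝ := weightInt a ((1 + X) * derivative (gegen a l))

/-- The squared norm of the `l`-th polynomial on `[-1,1]`. -/
noncomputable def sqNorm (a l : ℕ) : ℝ := weightInt a (gegen a l * gegen a l)

/-- Independent of `i`: as `gegen a i` equals `1` at `1`, it is `1 + (X-1) r`. The ladder relation
turns `(1 - X²) r` times the derivative into polynomials of too low degree times `gegen a (l-1)` and
`gegen a l`. -/
lemma weightInt_gegen_mul_deriv {a i l : ℕ} (h : i < l) :
    weightInt a ((1 + X) * (gegen a i * derivative (gegen a l))) = boundaryConst a l := by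
  obtain ⟨r, hr⟩ : (X - C 1 : ℝ[X]) ∣ gegen a i - 1 := by
    rw [dvd_iff_isRoot]
    simp [eval_one_gegen]
  obtain ⟨l, rfl⟩ : ∃ k, l = k + 1 := ⟨l - 1, by omega⟩
  have e : (1 + X) * (gegen a i * derivative (gegen a (l + 1))) =
      (1 + X) * derivative (gegen a (l + 1)) -
      C (l + 1 : ℝ) * (r * gegen a l - (X * r) * gegen a (l + 1)) := by
    have h1 := gegen_deriv_succ a l
    rw [C_1] at hr
    linear_combination (1 + X) * derivative (gegen a (l + 1)) * hr - r * h1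
  have hd : r = 0 ∨ (X * r).degree ≤ (i : WithBot ℕ) := by
    by_cases h0 : r = 0
    · exact Or.inl h0
    · right
      have : (X * r).degree = ((X - C 1) * r).degree := by
        rw [degree_mul, degree_mul, degree_X, degree_X_sub_C]
      rw [this, ← hr]
      refine (degree_sub_le _ _).trans ?_
      rw [degree_gegen, degree_one]
      simp
  rcases hd with rfl | hd
  · rw [e, boundaryConst]
    simp
  have hd' : r.degree < l := by
    rcases eq_or_ne r 0 with rfl | h0
    · simp
    rw [degree_mul, degree_X, degree_eq_natDegree h0] at hd
    rw [degree_eq_natDegree h0]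
    have hd'' : 1 + r.natDegree ≤ i := by exact_mod_cast hd
    exact_mod_cast (by omega : r.natDegree < l)
  have hd1 : (X * r).degree < ((l + 1 : ℕ) : WithBot ℕ) :=
    hd.trans_lt (by exact_mod_cast h)
  rw [e, map_sub, weightInt_C_mul, map_sub, weightInt_mul_gegen hd', weightInt_mul_gegen hd1,
    sub_zero, mul_zero, sub_zero, boundaryConst]

/-- Lagrange's identity and integration by parts. Of the two halves of the Wronskian, the one with
the derivative of the lower polynomial is orthogonal to `gegen a l`; the other is the boundary
constant. -/
lemma logInt_gegen_mul_gegen {a i l : ℕ} (h : i < l) :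
    logInt a (gegen a i * gegen a l) = -boundaryConst a l / ((l - i) * (l + i + 2 * a + 1)) := by
  have hil : (i : ℝ) < l := by exact_mod_cast h
  have h1 := logInt_weightedDeriv a
    (derivative (gegen a i) * gegen a l - gegen a i * derivative (gegen a l))
  rw [weightedDeriv_wronskian, logInt_C_mul, eigenvalue_sub, mul_sub, map_sub,
    weightInt_gegen_mul_deriv h, ← mul_assoc, weightInt_mul_gegen, zero_sub] at h1
  · rw [eq_div_iff, mul_comm, h1]
    exact mul_ne_zero (by linarith) (by positivity)
  · rcases i with _ | i
    · simp [gegen_zero]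
    refine lt_of_le_of_lt ?_ (Nat.cast_lt.2 h)
    rw [degree_mul]
    have d1 : (1 + X : ℝ[X]).degree = 1 := by
      rw [add_comm, ← C_1, degree_X_add_C]
    have d2 := degree_derivative_lt (p := gegen a (i + 1)) (by
      rw [Ne, ← degree_eq_bot, degree_gegen]; exact WithBot.coe_ne_bot)
    rw [degree_gegen] at d2
    rw [d1]
    by_cases h0 : derivative (gegen a (i + 1)) = 0
    · simp [h0]
    rw [degree_eq_natDegree h0] at d2 ⊢
    have : (derivative (gegen a (i + 1))).natDegree < i + 1 := by exact_mod_cast d2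
    exact_mod_cast (by omega : 1 + (derivative (gegen a (i + 1))).natDegree ≤ i + 1)

lemma boundaryConst_one (a : ℕ) : boundaryConst a 1 = sqNorm a 0 := by
  have h := weightInt_mul_gegen (a := a) (l := 1) (p := 1) (by simp)
  rw [gegen_one, one_mul] at h
  rw [boundaryConst, sqNorm, gegen_one, gegen_zero, derivative_X, mul_one, mul_one, map_add, h,
    add_zero]

lemma boundaryConst_succ {a l : ℕ} (hl : 1 ≤ l) :
    (l + 2 * a + 1) * boundaryConst a (l + 1) = (l + 1) * boundaryConst a l := by
  have h := congrArg (weightInt a) (gegen_deriv_succ_combination a l)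
  have h1 := weightInt_mul_gegen (a := a) (l := l) (p := 1) (by rw [degree_one]; exact_mod_cast hl)
  have h2 := weightInt_mul_gegen (a := a) (l := l + 1) (p := 1) (by
    rw [degree_one]; exact_mod_cast Nat.succ_pos l)
  rw [one_mul] at h1 h2
  rw [weightInt_C_mul, map_add (weightInt a), h1, h2, add_zero, mul_zero, mul_sub,
    map_sub (weightInt a), mul_left_comm, weightInt_C_mul, mul_left_comm, weightInt_C_mul,
    ← boundaryConst, ← boundaryConst] at h
  linarith

/-- The three-term recurrence, tested against either neighbour, expresses both norms through the
same integral of `X * gegen a i * gegen a (i+1)`. -/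
lemma sqNorm_succ (a i : ℕ) :
    (i + a + 3 / 2) * (i + 2 * a + 1) * sqNorm a (i + 1) =
      (i + a + 1 / 2) * (i + 1) * sqNorm a i := by
  have h1 : (i + 2 * a + 1) * sqNorm a (i + 1) =
      (2 * i + 2 * a + 1) * weightInt a (X * (gegen a i * gegen a (i + 1))) := by
    rcases i with _ | i
    · rw [sqNorm, zero_add, gegen_zero, gegen_one, one_mul]
      simp
    · have h := congrArg (fun p => weightInt a (p * gegen a (i + 2))) (gegen_rec a i)
      simp only [sub_mul, map_sub, mul_assoc, weightInt_C_mul] at h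
      rw [weightInt_gegen_mul_gegen (show i ≠ i + 2 by omega)] at h
      rw [sqNorm]
      push_cast
      linear_combination h
  have h2 : (i + 1) * sqNorm a i =
      (2 * i + 2 * a + 3) * weightInt a (X * (gegen a i * gegen a (i + 1))) := by
    have h := congrArg (fun p => weightInt a (p * gegen a i)) (gegen_rec a i)
    simp only [sub_mul, map_sub, mul_assoc, weightInt_C_mul] at h
    rw [weightInt_gegen_mul_gegen (show i + 2 ≠ i by omega), mul_comm (gegen a (i + 1))] at h
    rw [sqNorm]
    linear_combination h
  linear_combination (i + a + 3 / 2) * h1 - (i + a + 1 / 2) * h2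

lemma sqNorm_zero_pos (a : ℕ) : 0 < sqNorm a 0 := by
  rw [sqNorm, gegen_zero, weightInt_apply]
  simp only [mul_one, eval_one, one_mul]
  refine intervalIntegral.intervalIntegral_pos_of_pos_on
    (Continuous.intervalIntegrable (by fun_prop) _ _) (fun x hx => ?_) (by norm_num)
  have : 0 < 1 - x ^ 2 := by nlinarith [hx.1, hx.2]
  positivity

lemma sqNorm_mul_gammaRatio (a i : ℕ) :
    (i + a + 1 / 2) * sqNorm a i * gammaRatio a (i + a) =
      (a + 1 / 2) * sqNorm a 0 * gammaRatio a a := by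
  induction i with
  | zero => simp
  | succ i ih =>
    rw [← ih]
    have h1 := sqNorm_succ a i
    have h2 := gammaRatio_add_one a (i + a)
    have h3 : (i + 1 : ℝ) * (i + 2 * a + 1) ≠ 0 := by positivity
    push_cast
    rw [show (i : ℝ) + 1 + a = i + a + 1 by ring]
    refine mul_left_cancel₀ h3 ?_
    linear_combination (i + 1) * gammaRatio a (i + a + 1) * h1 +
      (i + a + 1 / 2) * (i + 1) * sqNorm a i * h2

/-- Like the weighted norm, this product is constant in the degree. The factor `2` comes from `l =
1`, where the gamma ratio has grown by `2a + 1`; `l = 0` is excluded since its derivative is zero.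
-/
lemma boundaryConst_mul_gammaRatio (a l : ℕ) (hl : 1 ≤ l) :
    boundaryConst a l * gammaRatio a (l + a) = 2 * ((a + 1 / 2) * sqNorm a 0 * gammaRatio a a) := by
  induction l, hl using Nat.le_induction with
  | base =>
    have h2 := gammaRatio_add_one a a
    rw [boundaryConst_one, Nat.cast_one, add_comm (1 : ℝ)]
    linear_combination sqNorm a 0 * h2
  | succ l hl ih =>
    rw [← ih]
    have h1 := boundaryConst_succ (a := a) hl
    have h2 := gammaRatio_add_one a (l + a)
    have h3 : (l + 1 : ℝ) * (l + 2 * a + 1) ≠ 0 := by positivity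
    push_cast
    rw [show (l : ℝ) + 1 + a = l + a + 1 by ring]
    refine mul_left_cancel₀ h3 ?_
    linear_combination (l + 1) * gammaRatio a (l + a + 1) * h1 +
      (l + 1) * boundaryConst a l * h2

lemma sqNorm_pos (a i : ℕ) : 0 < sqNorm a i := by
  have h := sqNorm_mul_gammaRatio a i
  have h1 : 0 < gammaRatio a ((i : ℝ) + a) := gammaRatio_pos (by simp)
  have h2 : 0 < gammaRatio a (a : ℝ) := gammaRatio_pos le_rfl
  have h3 := sqNorm_zero_pos a
  have h4 : 0 < (i + a + 1 / 2 : ℝ) * gammaRatio a ((i : ℝ) + a) := by positivity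
  have h5 : 0 < (a + 1 / 2 : ℝ) * sqNorm a 0 * gammaRatio a a := by positivity
  refine pos_of_mul_pos_right (b := sqNorm a i)
    (a := (i + a + 1 / 2 : ℝ) * gammaRatio a ((i : ℝ) + a)) ?_ h4.le
  rw [← h] at h5
  linarith

lemma boundaryConst_sq_div (a : ℕ) {i l : ℕ} (hl : 1 ≤ l) :
    boundaryConst a l ^ 2 / (sqNorm a i * sqNorm a l) =
      4 * (i + a + 1 / 2) * (l + a + 1 / 2) * (gammaRatio a (i + a) / gammaRatio a (l + a)) := by
  have h1 := sqNorm_mul_gammaRatio a i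
  have h2 := sqNorm_mul_gammaRatio a l
  have h3 := boundaryConst_mul_gammaRatio a l hl
  have p1 : 0 < gammaRatio a ((i : ℝ) + a) := gammaRatio_pos (by simp)
  have p2 : 0 < gammaRatio a ((l : ℝ) + a) := gammaRatio_pos (by simp)
  have q1 := sqNorm_pos a i
  have q2 := sqNorm_pos a l
  rw [mul_div_assoc', div_eq_div_iff (by positivity) (by positivity)]
  refine mul_left_cancel₀ p2.ne' ?_
  set K := (a + 1 / 2) * sqNorm a 0 * gammaRatio a a
  linear_combination (boundaryConst a l * gammaRatio a (l + a) + 2 * K) * h3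
    - 4 * (l + a + 1 / 2) * sqNorm a l * gammaRatio a (l + a) * h1 - 4 * K * h2

/-- The three-term recurrence moves `X * gegen a i` to the neighbours `i ± 1`; all of them stay
below `l`, so `boundaryConst a l` factors out. -/
lemma logInt_one_sub_mul {a i l : ℕ} (h : i + 1 < l) :
    logInt a ((1 - X) * (gegen a i * gegen a l)) =
      -boundaryConst a l * entKernel a (i + a) (l + a) := by
  have hil : (i : ℝ) + 1 < l := by exact_mod_cast h
  have e0 := logInt_gegen_mul_gegen (a := a) (show i < l by omega)
  have e1 := logInt_gegen_mul_gegen (a := a) h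
  have k : entKernel a (i + a) (l + a) = 1 / ((l - i) * (l + i + 2 * a + 1)) -
      (i + 2 * a + 1) / (2 * i + 2 * a + 1) * (1 / ((l - (i + 1)) * (l + (i + 1) + 2 * a + 1))) -
      i / (2 * i + 2 * a + 1) * (1 / ((l - i + 1) * (l + i + 2 * a))) := by
    rw [entKernel, show (l + a - (i + a) : ℝ) = l - i by ring,
      show (l + a + (i + a) + 1 : ℝ) = l + i + 2 * a + 1 by ring,
      show (l + a + (i + a) + 2 : ℝ) = l + (i + 1) + 2 * a + 1 by ring,
      show (l + a + (i + a) : ℝ) = l + i + 2 * a by ring,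
      show (i + a + a + 1 : ℝ) = i + 2 * a + 1 by ring,
      show (2 * (i + a) + 1 : ℝ) = 2 * i + 2 * a + 1 by ring,
      show (i + a - a : ℝ) = i by ring, show (l - i - 1 : ℝ) = l - (i + 1) by ring]
  have hX : (2 * i + 2 * a + 1) * logInt a (X * (gegen a i * gegen a l)) =
      -boundaryConst a l * ((i + 2 * a + 1) * (1 / ((l - (i + 1)) * (l + (i + 1) + 2 * a + 1))) +
      i * (1 / ((l - i + 1) * (l + i + 2 * a)))) := by
    rcases i with _ | i
    · rw [gegen_zero, one_mul, ← gegen_one a, e1]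
      push_cast
      ring
    · have e2 := logInt_gegen_mul_gegen (a := a) (show i < l by omega)
      have h := congrArg (fun p => logInt a (p * gegen a l)) (gegen_rec a i)
      simp only [sub_mul, map_sub, mul_assoc, logInt_C_mul] at h
      rw [e1, e2] at h
      push_cast at *
      rw [show (l - (i + 1) + 1 : ℝ) = l - i by ring,
        show (l + (i + 1) + 2 * a : ℝ) = l + i + 2 * a + 1 by ring]
      linear_combination -h
  have hp : (2 * i + 2 * a + 1 : ℝ) ≠ 0 := by positivity
  rw [sub_mul, one_mul, map_sub, e0, k]
  refine mul_left_cancel₀ hp ?_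
  rw [mul_sub, hX]
  field_simp
  ring

theorem logInt_sq_div {a i l : ℕ} (h : i + 1 < l) :
    logInt a ((1 - X) * (gegen a i * gegen a l)) ^ 2 / (sqNorm a i * sqNorm a l) =
      entTerm a ((a + i : ℕ) : ℝ) ((a + l : ℕ) : ℝ) := by
  have hb := boundaryConst_sq_div a (i := i) (l := l) (by omega)
  rw [logInt_one_sub_mul h, mul_pow, neg_sq, mul_div_right_comm, hb, entTerm]
  push_cast
  rw [add_comm (a : ℝ) i, add_comm (a : ℝ) l]
  ring

/-! ### The entropy function on `[0,1]` and Parseval's identity -/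

lemma continuous_v : Continuous v := by
  unfold v
  have h1 : Continuous fun x : ℝ => (1 - x) / 2 := by fun_prop
  have h2 : Continuous fun x : ℝ => (1 + x) / 2 := by fun_prop
  exact (Real.continuous_mul_log.comp h1).add (Real.continuous_mul_log.comp h2)

lemma v_neg (x : ℝ) : v (-x) = v x := by
  unfold v
  rw [sub_neg_eq_add, ← sub_eq_add_neg, add_comm]

lemma integrableOn_mul_weight (a : ℕ) (f : C(ℝ, ℝ)) :
    IntegrableOn (fun x : ℝ => f x * (1 - x ^ 2) ^ a) (Set.Icc 0 1) :=
  Continuous.integrableOn_Icc (by fun_prop)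

/-- Integration against the weight `(1-x²)^a` on `[0,1]`. -/
noncomputable def unitInt (a : ℕ) : C(ℝ, ℝ) →ₗ[ℝ] ℝ where
  toFun f := ∫ x in Set.Icc (0 : ℝ) 1, f x * (1 - x ^ 2) ^ a
  map_add' f g := by
    rw [← integral_add (integrableOn_mul_weight a f) (integrableOn_mul_weight a g)]
    simp only [ContinuousMap.add_apply, add_mul]
  map_smul' c f := by
    rw [RingHom.id_apply, smul_eq_mul, ← integral_const_mul]
    simp only [ContinuousMap.smul_apply, smul_eq_mul, mul_assoc]

lemma unitInt_apply (a : ℕ) (f : C(ℝ, ℝ)) :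
    unitInt a f = ∫ x in Set.Icc (0 : ℝ) 1, f x * (1 - x ^ 2) ^ a := rfl

lemma unitInt_mono (a : ℕ) {f g : C(ℝ, ℝ)} (h : ∀ x ∈ Set.Icc (0 : ℝ) 1, f x ≤ g x) :
    unitInt a f ≤ unitInt a g := by
  refine setIntegral_mono_on (integrableOn_mul_weight a f) (integrableOn_mul_weight a g)
    measurableSet_Icc fun x hx => ?_
  have : 0 ≤ 1 - x ^ 2 := by nlinarith [hx.1, hx.2]
  exact mul_le_mul_of_nonneg_right (h x hx) (by positivity)

lemma intervalIntegral_eq_two_mul_of_even {f : ℝ → ℝ} (hf : Continuous f)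
    (h : ∀ x, f (-x) = f x) :
    ∫ x in (-1 : ℝ)..1, f x = 2 * ∫ x in Set.Icc (0 : ℝ) 1, f x := by
  rw [← intervalIntegral.integral_add_adjacent_intervals (b := 0)
    (hf.intervalIntegrable _ _) (hf.intervalIntegrable _ _)]
  have : ∫ x in (-1 : ℝ)..0, f x = ∫ x in (0 : ℝ)..1, f x := by
    have := intervalIntegral.integral_comp_neg (a := -1) (b := 0) f
    simp only [h, neg_zero, neg_neg] at this
    exact this
  rw [this, integral_Icc_eq_integral_Ioc, ← intervalIntegral.integral_of_le zero_le_one]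
  ring

lemma weightInt_eq_two_mul_unitInt (a : ℕ) {p : ℝ[X]} (h : ∀ x, p.eval (-x) = p.eval x) :
    weightInt a p = 2 * unitInt a p.toContinuousMap := by
  rw [weightInt_apply, unitInt_apply]
  exact intervalIntegral_eq_two_mul_of_even (by fun_prop) fun x => by rw [h, neg_sq]

/-- The entropy function as a continuous map. -/
noncomputable def vMap : C(ℝ, ℝ) := ⟨v, continuous_v⟩

/-- The two halves of `v` are mirror images, so against an even weight on `[-1,1]` each contributes
the same. -/
lemma two_mul_unitInt_v (a : ℕ) {p : ℝ[X]} (h : ∀ x, p.eval (-x) = p.eval x) :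
    2 * unitInt a (vMap * p.toContinuousMap) =
      logInt a ((1 - X) * p) - Real.log 2 * weightInt a ((1 - X) * p) := by
  have hc : Continuous fun x : ℝ => (1 - x) / 2 * Real.log ((1 - x) / 2) :=
    Real.continuous_mul_log.comp (by fun_prop : Continuous fun x : ℝ => (1 - x) / 2)
  have hc' : Continuous fun x : ℝ => (1 + x) / 2 * Real.log ((1 + x) / 2) :=
    Real.continuous_mul_log.comp (by fun_prop : Continuous fun x : ℝ => (1 + x) / 2)
  have hg : Continuous fun x : ℝ =>
      (1 - x) / 2 * Real.log ((1 - x) / 2) * (p.eval x * (1 - x ^ 2) ^ a) :=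
    hc.mul (by fun_prop)
  have hg' : Continuous fun x : ℝ =>
      (1 + x) / 2 * Real.log ((1 + x) / 2) * (p.eval x * (1 - x ^ 2) ^ a) :=
    hc'.mul (by fun_prop)
  have hv := continuous_v
  rw [unitInt_apply, ← intervalIntegral_eq_two_mul_of_even]
  · have e1 : ∫ x in (-1 : ℝ)..1, (vMap * p.toContinuousMap) x * (1 - x ^ 2) ^ a =
        2 * ∫ x in (-1 : ℝ)..1,
          (1 - x) / 2 * Real.log ((1 - x) / 2) * (p.eval x * (1 - x ^ 2) ^ a) := by
      have r := intervalIntegral.integral_comp_neg (a := -1) (b := 1) fun x : ℝ =>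
        (1 - x) / 2 * Real.log ((1 - x) / 2) * (p.eval x * (1 - x ^ 2) ^ a)
      simp only [sub_neg_eq_add, h, neg_sq, neg_neg] at r
      rw [two_mul]
      nth_rewrite 2 [← r]
      rw [← intervalIntegral.integral_add (hg.intervalIntegrable _ _)
        (hg'.intervalIntegrable _ _)]
      refine intervalIntegral.integral_congr fun x _ => ?_
      simp only [ContinuousMap.mul_apply, vMap, ContinuousMap.coe_mk, v,
        toContinuousMap_apply]
      ring
    rw [e1, ← intervalIntegral.integral_const_mul, logInt_apply, weightInt_apply,
      ← intervalIntegral.integral_const_mul, ← intervalIntegral.integral_sub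
      (intervalIntegrable_eval_mul_log a _) ((intervalIntegrable_eval_mul a _ _ _).const_mul _)]
    refine intervalIntegral.integral_congr fun x _ => ?_
    simp only [eval_mul, eval_sub, eval_one, eval_X]
    -- The logarithm of the quotient does not split at `x = 1`, but the factor `1 - x` vanishes
    -- there.
    rcases eq_or_ne x 1 with rfl | hx
    · simp
    · rw [Real.log_div (sub_ne_zero.2 hx.symm) two_ne_zero]
      ring
  · fun_prop
  · intro x
    simp [vMap, v_neg, h]

/-- The orthonormal even polynomials for the weight `(1-x²)^a` on `[0,1]`. -/
noncomputable def orthoPoly (a j : ℕ) : C(ℝ, ℝ) :=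
  (√(sqNorm a (2 * j) / 2))⁻¹ • (gegen a (2 * j)).toContinuousMap

lemma eval_neg_gegen_even (a j : ℕ) (x : ℝ) :
    (gegen a (2 * j)).eval (-x) = (gegen a (2 * j)).eval x := by
  rw [eval_neg_gegen, pow_mul]
  simp

lemma toContinuousMap_mul (p q : ℝ[X]) :
    (p * q).toContinuousMap = p.toContinuousMap * q.toContinuousMap := by
  ext x
  simp

lemma unitInt_orthoPoly_mul (a j k : ℕ) :
    unitInt a (orthoPoly a j * orthoPoly a k) = if j = k then 1 else 0 := by
  have h := weightInt_eq_two_mul_unitInt a (p := gegen a (2 * j) * gegen a (2 * k)) fun x => by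
    rw [eval_mul, eval_mul, eval_neg_gegen_even, eval_neg_gegen_even]
  rw [toContinuousMap_mul] at h
  rw [orthoPoly, orthoPoly, smul_mul_smul_comm, map_smul, smul_eq_mul]
  split_ifs with hjk
  · subst hjk
    rw [← sqNorm] at h
    have := sqNorm_pos a (2 * j)
    rw [← mul_inv, Real.mul_self_sqrt (by positivity)]
    field_simp
    linarith
  · rw [weightInt_gegen_mul_gegen (by omega)] at h
    rw [show unitInt a ((gegen a (2 * j)).toContinuousMap * (gegen a (2 * k)).toContinuousMap) = 0
      by linarith, mul_zero]

/-- The `ln 2` term drops out: `(1-X) * gegen a (2j)` has degree `2j + 1 < 2k`. -/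
lemma unitInt_v_mul_orthoPoly_sq {a j k : ℕ} (h : j < k) :
    unitInt a (vMap * (orthoPoly a j * orthoPoly a k)) ^ 2 =
      entTerm a ((a + 2 * j : ℕ) : ℝ) ((a + 2 * k : ℕ) : ℝ) := by
  have h1 := two_mul_unitInt_v a (p := gegen a (2 * j) * gegen a (2 * k)) fun x => by
    rw [eval_mul, eval_mul, eval_neg_gegen_even, eval_neg_gegen_even]
  have h2 : weightInt a ((1 - X) * (gegen a (2 * j) * gegen a (2 * k))) = 0 := by
    rw [sub_mul, one_mul, map_sub, weightInt_gegen_mul_gegen (by omega), zero_sub, neg_eq_zero,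
      ← mul_assoc]
    refine weightInt_mul_gegen ?_
    rw [degree_mul, degree_X, degree_gegen]
    exact_mod_cast (by omega : 1 + 2 * j < 2 * k)
  rw [h2, mul_zero, sub_zero, toContinuousMap_mul] at h1
  rw [← logInt_sq_div (show 2 * j + 1 < 2 * k by omega), ← h1, orthoPoly, orthoPoly,
    smul_mul_smul_comm, mul_smul_comm, map_smul, smul_eq_mul, mul_pow, mul_pow, mul_pow,
    inv_pow, inv_pow,
    Real.sq_sqrt (by have := sqNorm_pos a (2 * j); positivity),
    Real.sq_sqrt (by have := sqNorm_pos a (2 * k); positivity)]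
  have p1 := sqNorm_pos a (2 * j)
  have p2 := sqNorm_pos a (2 * k)
  field_simp

lemma exists_comp_sq (a i : ℕ) : (∃ E : ℝ[X], gegen a (2 * i) = E.comp (X ^ 2)) ∧
    ∃ O : ℝ[X], gegen a (2 * i + 1) = X * O.comp (X ^ 2) := by
  induction i with
  | zero => exact ⟨⟨1, by simp [gegen_zero]⟩, ⟨1, by simp [gegen_one]⟩⟩
  | succ i ih =>
    obtain ⟨⟨E, hE⟩, O, hO⟩ := ih
    have step : ∃ E : ℝ[X], gegen a (2 * i + 2) = E.comp (X ^ 2) := by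
      refine ⟨C (((2 * i : ℕ) + 2 * a + 2 : ℝ)⁻¹) *
        (C (2 * (2 * i : ℕ) + 2 * a + 3 : ℝ) * (X * O) - C ((2 * i : ℕ) + 1 : ℝ) * E), ?_⟩
      rw [gegen, hE, hO]
      simp only [mul_comp, sub_comp, C_comp, X_comp]
      ring
    refine ⟨step, ?_⟩
    obtain ⟨E', hE'⟩ := step
    refine ⟨C (((2 * i + 1 : ℕ) + 2 * a + 2 : ℝ)⁻¹) *
        (C (2 * (2 * i + 1 : ℕ) + 2 * a + 3 : ℝ) * E' - C ((2 * i + 1 : ℕ) + 1 : ℝ) * O), ?_⟩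
    rw [show 2 * (i + 1) + 1 = (2 * i + 1) + 2 by ring, gegen, hO,
      show 2 * i + 1 + 1 = 2 * i + 2 by ring, hE']
    simp only [mul_comp, sub_comp, C_comp]
    ring

/-- The polynomial `E` with `gegen a (2i) = E(X²)`. -/
noncomputable def evenGegen (a i : ℕ) : ℝ[X] := (exists_comp_sq a i).1.choose

lemma gegen_two_mul (a i : ℕ) : gegen a (2 * i) = (evenGegen a i).comp (X ^ 2) :=
  (exists_comp_sq a i).1.choose_spec

lemma natDegree_evenGegen (a i : ℕ) : (evenGegen a i).natDegree = i := by
  have h := congrArg natDegree (gegen_two_mul a i)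
  rw [natDegree_comp, natDegree_X_pow, natDegree_eq_of_degree_eq_some (degree_gegen a _)] at h
  omega

lemma evenGegen_ne_zero (a i : ℕ) : evenGegen a i ≠ 0 := by
  intro h
  have h1 := gegen_two_mul a i
  have h2 := degree_gegen a (2 * i)
  rw [h1, h, zero_comp, degree_zero] at h2
  exact WithBot.bot_ne_coe h2

/-- The polynomials `evenGegen a` as a polynomial sequence. -/
noncomputable def evenSeq (a : ℕ) : Polynomial.Sequence ℝ where
  elems' := evenGegen a
  degree_eq' i := by rw [degree_eq_natDegree (evenGegen_ne_zero a i), natDegree_evenGegen]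

lemma mem_span_evenGegen (a : ℕ) {l : ℕ} {p : ℝ[X]} (hp : p.degree < l) :
    p ∈ Submodule.span ℝ (evenGegen a '' Set.Iio l) := by
  have := (evenSeq a).span_degreeLT (m := l) fun i _ => by
    rw [isUnit_iff_ne_zero, Ne, leadingCoeff_eq_zero]
    exact (evenSeq a).ne_zero i
  have h : p ∈ degreeLT ℝ l := mem_degreeLT.2 hp
  rw [← this] at h
  exact h

lemma orthoPoly_eq_smul (a k : ℕ) : orthoPoly a k =
    (√(sqNorm a (2 * k) / 2))⁻¹ • ((evenGegen a k).comp (X ^ 2)).toContinuousMap := by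
  rw [orthoPoly, gegen_two_mul]

lemma toContinuousMap_add (p q : ℝ[X]) :
    (p + q).toContinuousMap = p.toContinuousMap + q.toContinuousMap := by
  ext x
  simp

lemma toContinuousMap_smul (c : ℝ) (p : ℝ[X]) :
    (c • p).toContinuousMap = c • p.toContinuousMap := by
  ext x
  simp

lemma unitInt_mul_comp_sq_eq_zero {a K : ℕ} {f : C(ℝ, ℝ)}
    (hf : ∀ k < K, unitInt a (f * orthoPoly a k) = 0) {q : ℝ[X]} (hq : q.degree < K) :
    unitInt a (f * (q.comp (X ^ 2)).toContinuousMap) = 0 := by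
  have h := mem_span_evenGegen a hq
  clear hq
  induction h using Submodule.span_induction with
  | mem p hp =>
    obtain ⟨k, hk, rfl⟩ := hp
    have h1 := hf k hk
    rw [orthoPoly_eq_smul, mul_smul_comm, map_smul, smul_eq_mul, mul_eq_zero] at h1
    refine h1.resolve_left ?_
    have := sqNorm_pos a (2 * k)
    positivity
  | zero =>
    have : (0 : ℝ[X]).toContinuousMap = 0 := by ext; simp
    rw [zero_comp, this, mul_zero, map_zero]
  | add p q _ _ h1 h2 => rw [add_comp, toContinuousMap_add, mul_add, map_add, h1, h2, add_zero]
  | smul c p _ h1 => rw [smul_comp, toContinuousMap_smul, mul_smul_comm, map_smul, h1, smul_zero]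

/-- Parseval's identity for the orthonormal even polynomials. -/
theorem hasSum_unitInt_mul_orthoPoly_sq (a : ℕ) (f : C(ℝ, ℝ)) :
    HasSum (fun k => unitInt a (f * orthoPoly a k) ^ 2) (unitInt a (f * f)) := by
  obtain ⟨c, hc⟩ : ∃ c : ℕ → ℝ, ∀ k, unitInt a (f * orthoPoly a k) = c k := ⟨_, fun _ => rfl⟩
  obtain ⟨r, hr⟩ : ∃ r : ℕ → C(ℝ, ℝ),
      ∀ K, r K = f - ∑ k ∈ Finset.range K, c k • orthoPoly a k := ⟨_, fun _ => rfl⟩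
  have orth (K) : ∀ k < K, unitInt a (r K * orthoPoly a k) = 0 := by
    intro k hk
    rw [hr, sub_mul, map_sub, hc, Finset.sum_mul, map_sum]
    simp only [smul_mul_assoc, map_smul, unitInt_orthoPoly_mul, smul_eq_mul, mul_ite, mul_one,
      mul_zero, Finset.sum_ite_eq', Finset.mem_range, hk, if_true, sub_self]
  have norm (K) : unitInt a (r K * r K) =
      unitInt a (f * f) - ∑ k ∈ Finset.range K, c k ^ 2 := by
    nth_rewrite 2 [hr]
    rw [mul_sub, map_sub, Finset.mul_sum, map_sum]
    simp only [mul_smul_comm, map_smul]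
    rw [Finset.sum_eq_zero fun k hk => by rw [orth K k (Finset.mem_range.1 hk), smul_zero],
      sub_zero, hr, sub_mul, map_sub, Finset.sum_mul, map_sum]
    congr 1
    refine Finset.sum_congr rfl fun k _ => ?_
    rw [smul_mul_assoc, map_smul, mul_comm, hc, smul_eq_mul, sq]
  have nonneg (K) : 0 ≤ unitInt a (r K * r K) := by
    rw [← map_zero (unitInt a)]
    exact unitInt_mono a fun x _ => mul_self_nonneg _
  simp only [hc]
  rw [hasSum_iff_tendsto_nat_of_nonneg fun k => sq_nonneg _]
  obtain ⟨M, hM⟩ : ∃ M, unitInt a 1 = M := ⟨_, rfl⟩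
  have hM0 : 0 ≤ M := by
    rw [← hM, ← map_zero (unitInt a)]
    exact unitInt_mono a fun x _ => zero_le_one
  rw [Metric.tendsto_atTop]
  intro ε hε
  obtain ⟨δ, hδ, hδε⟩ : ∃ δ : ℝ, 0 < δ ∧ δ ^ 2 * M < ε := by
    refine ⟨min 1 (ε / (M + 1)), by positivity, ?_⟩
    have h1 : min 1 (ε / (M + 1)) ≤ 1 := min_le_left _ _
    have h2 : min 1 (ε / (M + 1)) ≤ ε / (M + 1) := min_le_right _ _
    have h3 : 0 < min 1 (ε / (M + 1)) := by positivity
    have h4 : ε / (M + 1) * (M + 1) = ε := by field_simp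
    nlinarith [mul_nonneg h3.le hM0]
  -- Weierstrass for `y ↦ f(√y)`: on `[0,1]` this approximates `f` by the even polynomial `q(x²)`.
  obtain ⟨q, hq⟩ := exists_polynomial_near_of_continuousOn 0 1 (fun y => f (√y))
    (by fun_prop) δ hδ
  refine ⟨q.natDegree + 1, fun K hK => ?_⟩
  have hqK : q.degree < K :=
    degree_le_natDegree.trans_lt (by exact_mod_cast hK)
  set p : C(ℝ, ℝ) := (q.comp (X ^ 2)).toContinuousMap with hp
  have h0 := unitInt_mul_comp_sq_eq_zero (orth K) hqK
  have h0' : unitInt a (r K * r K) = unitInt a (r K * (f - p)) := by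
    have h1 : unitInt a (r K * r K) = unitInt a (r K * f) := by
      nth_rewrite 2 [hr]
      rw [mul_sub, map_sub, Finset.mul_sum, map_sum]
      simp only [mul_smul_comm, map_smul]
      rw [Finset.sum_eq_zero fun k hk => by rw [orth K k (Finset.mem_range.1 hk), smul_zero],
        sub_zero]
    rw [mul_sub, map_sub, h0, sub_zero, h1]
  -- The remainder is orthogonal to `p`, so its squared norm is its product with `f - p`, at most
  -- half that squared norm plus `δ² M / 2`. Hence it is at most `δ² M < ε`.
  have h2 : unitInt a (r K * (f - p)) ≤
      unitInt a ((1 / 2 : ℝ) • (r K * r K) + (δ ^ 2 / 2) • 1) := by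
    refine unitInt_mono a fun x hx => ?_
    have h3 := hq (x ^ 2) ⟨sq_nonneg x, by nlinarith [hx.1, hx.2]⟩
    rw [Real.sqrt_sq hx.1] at h3
    have h4 : (q.eval (x ^ 2) - f x) ^ 2 ≤ δ ^ 2 := sq_le_sq' (abs_lt.1 h3).1.le (abs_lt.1 h3).2.le
    simp only [ContinuousMap.mul_apply, ContinuousMap.sub_apply, ContinuousMap.add_apply,
      ContinuousMap.smul_apply, ContinuousMap.one_apply, smul_eq_mul, hp, toContinuousMap_apply,
      eval_comp, eval_pow, eval_X]
    nlinarith [sq_nonneg (r K x - (f x - q.eval (x ^ 2)))]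
  rw [map_add, map_smul, map_smul, hM, ← h0', smul_eq_mul, smul_eq_mul] at h2
  rw [Real.dist_eq, abs_sub_comm, ← norm, abs_of_nonneg (nonneg K)]
  linarith

/-- The truncated double sum given by Parseval's identity. -/
theorem sum_unitInt_sub_sum_sq (a m : ℕ) (hm : 1 ≤ m) :
    ∑ j ∈ Finset.range m, (unitInt a (vMap * vMap * (orthoPoly a j * orthoPoly a j)) -
      ∑ k ∈ Finset.range m, unitInt a (vMap * (orthoPoly a j * orthoPoly a k)) ^ 2) =
    varianceFormula m (m + a) := by
  rw [← sum_tsum_entTerm a m hm]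
  refine Finset.sum_congr rfl fun j hj => ?_
  have h := hasSum_unitInt_mul_orthoPoly_sq a (vMap * orthoPoly a j)
  have h1 := (hasSum_nat_add_iff' m).2 h
  simp only [mul_assoc] at h1 ⊢
  rw [show vMap * (orthoPoly a j * (vMap * orthoPoly a j)) =
    vMap * (vMap * (orthoPoly a j * orthoPoly a j)) by ring] at h1
  rw [← h1.tsum_eq]
  refine tsum_congr fun k => ?_
  rw [unitInt_v_mul_orthoPoly_sq (by have := Finset.mem_range.1 hj; omega), add_comm k m]

/-! ### Determinants with few nontrivial rows -/

section Determinant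

variable {ι : Type*} [Fintype ι] [DecidableEq ι]

/-- A nontrivial permutation moves at least two points, hence meets an identity row off the
diagonal. -/
lemma det_eq_of_rows_one {B : Matrix ι ι ℝ} {p : ι}
    (h : ∀ i k, i ≠ p → B i k = if i = k then 1 else 0) : B.det = B p p := by
  rw [← Matrix.det_transpose, Matrix.det_apply, Finset.sum_eq_single 1]
  · rw [Equiv.Perm.sign_one, one_smul, Finset.prod_eq_single p]
    · rfl
    · intro i _ hi
      rw [Matrix.transpose_apply, Equiv.Perm.one_apply, h i i hi, if_pos rfl]
    · simp
  · intro σ _ hσ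
    obtain ⟨i, hi, hip⟩ : ∃ i, σ i ≠ i ∧ i ≠ p := by
      by_contra! hc
      refine hσ (Equiv.ext fun i => ?_)
      by_cases hi : σ i = i
      · exact hi
      · have h1 := hc i hi
        have h2 : σ (σ i) ≠ σ i := fun h => hi (σ.injective h)
        exact absurd ((hc _ h2).trans h1.symm) hi
    rw [Finset.prod_eq_zero (Finset.mem_univ i), smul_zero]
    rw [Matrix.transpose_apply, h i _ hip, if_neg hi.symm]
  · simp

/-- Only the identity and the transposition of `p` and `q` fix every other point. -/
lemma det_eq_of_rows_two {B : Matrix ι ι ℝ} {p q : ι} (hpq : p ≠ q)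
    (h : ∀ i k, i ≠ p → i ≠ q → B i k = if i = k then 1 else 0) :
    B.det = B p p * B q q - B p q * B q p := by
  have hne : (1 : Equiv.Perm ι) ≠ Equiv.swap p q := by
    intro h
    have := congrArg (fun σ : Equiv.Perm ι => σ p) h
    simp only [Equiv.Perm.one_apply, Equiv.swap_apply_left] at this
    exact hpq this
  rw [← Matrix.det_transpose, Matrix.det_apply, Finset.sum_eq_add 1 (Equiv.swap p q) hne]
  · rw [Equiv.Perm.sign_one, one_smul, Equiv.Perm.sign_swap hpq, Finset.prod_eq_mul p q hpq,
      Finset.prod_eq_mul p q hpq, Equiv.swap_apply_left, Equiv.swap_apply_right]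
    · simp only [Matrix.transpose_apply, Equiv.Perm.one_apply, Units.neg_smul, one_smul]
      ring
    · intro i _ hi
      rw [Matrix.transpose_apply, Equiv.swap_apply_of_ne_of_ne hi.1 hi.2, h i i hi.1 hi.2,
        if_pos rfl]
    · simp
    · simp
    · intro i _ hi
      rw [Matrix.transpose_apply, Equiv.Perm.one_apply, h i i hi.1 hi.2, if_pos rfl]
    · simp
    · simp
  · intro σ _ hσ
    obtain ⟨i, hi, hip, hiq⟩ : ∃ i, σ i ≠ i ∧ i ≠ p ∧ i ≠ q := by
      by_contra! hc
      have fix (i) (hp : i ≠ p) (hq : i ≠ q) : σ i = i := by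
        by_contra hi
        exact hq (hc i hi hp)
      by_cases hp : σ p = p
      · refine hσ.1 (Equiv.ext fun i => ?_)
        by_cases hip : i = p
        · rw [hip, hp, Equiv.Perm.one_apply]
        by_cases hiq : i = q
        · subst hiq
          by_contra h1
          have h2 : σ (σ i) ≠ σ i := fun h => h1 (σ.injective h)
          have h3 : σ i ≠ p := fun h => hip (σ.injective (h.trans hp.symm))
          exact h1 (hc _ h2 h3)
        exact fix i hip hiq
      · have h2 : σ (σ p) ≠ σ p := fun h => hp (σ.injective h)
        have hpq' : σ p = q := hc _ h2 hp
        refine hσ.2 (Equiv.ext fun i => ?_)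
        by_cases hip : i = p
        · rw [hip, hpq', Equiv.swap_apply_left]
        by_cases hiq : i = q
        · subst hiq
          rw [Equiv.swap_apply_right]
          by_contra h1
          have h3 : σ (σ i) ≠ σ i := fun h => by
            have := σ.injective h
            exact hip (σ.injective (this.trans hpq'.symm))
          have h4 := hc _ h3 h1
          exact hip (σ.injective (h4.trans hpq'.symm))
        rw [fix i hip hiq, Equiv.swap_apply_of_ne_of_ne hip hiq]
    rw [Finset.prod_eq_zero (Finset.mem_univ i), smul_zero]
    rw [Matrix.transpose_apply, h i _ hip hiq, if_neg hi.symm]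
  · simp
  · simp

/-- The square of a determinant as a double sum over permutations. -/
lemma det_sq_eq_sum (M : Matrix ι ι ℝ) :
    M.det ^ 2 = ∑ σ : Equiv.Perm ι, ∑ ρ : Equiv.Perm ι,
      ((Equiv.Perm.sign ρ : ℤ) : ℝ) * ∏ i, (M i (σ i) * M i (σ (ρ i))) := by
  have e : M.det = ∑ σ : Equiv.Perm ι, ((Equiv.Perm.sign σ : ℤ) : ℝ) * ∏ i, M i (σ i) := by
    rw [← Matrix.det_transpose, Matrix.det_apply']
    rfl
  rw [sq]
  nth_rewrite 1 [e]
  rw [Finset.sum_mul]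
  refine Finset.sum_congr rfl fun σ _ => ?_
  -- Writing the second permutation as `σ * ρ` cancels the sign of `σ`.
  rw [e, ← Equiv.sum_comp (Equiv.mulLeft σ), Finset.mul_sum]
  refine Finset.sum_congr rfl fun ρ _ => ?_
  simp only [Equiv.coe_mulLeft, Equiv.Perm.sign_mul, Units.val_mul, Int.cast_mul,
    Equiv.Perm.mul_apply, Finset.prod_mul_distrib]
  have h : ((Equiv.Perm.sign σ : ℤ) : ℝ) * ((Equiv.Perm.sign σ : ℤ) : ℝ) = 1 := by
    rw [← Int.cast_mul, ← Units.val_mul, Int.units_mul_self]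
    simp
  linear_combination (((Equiv.Perm.sign ρ : ℤ) : ℝ) * (∏ i, M i (σ i)) * ∏ i, M i (σ (ρ i))) * h

end Determinant

/-! ### Andréief integration over the cube -/

/-- Lebesgue measure on the unit cube. -/
noncomputable def cubeMeasure (m : ℕ) : Measure (Fin m → ℝ) :=
  Measure.pi fun _ => (volume.restrict (Set.Icc (0 : ℝ) 1))

lemma volume_restrict_cube (m : ℕ) :
    (volume : Measure (Fin m → ℝ)).restrict (Set.univ.pi fun _ : Fin m => Set.Icc (0 : ℝ) 1) =
      cubeMeasure m := by
  rw [volume_pi, Measure.restrict_pi_pi, cubeMeasure]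

lemma integral_cube_prod (a m : ℕ) (f : Fin m → C(ℝ, ℝ)) :
    ∫ x, ∏ i, (f i (x i) * (1 - x i ^ 2) ^ a) ∂cubeMeasure m = ∏ i, unitInt a (f i) :=
  integral_fintype_prod_eq_prod (𝕜 := ℝ) fun i x => f i x * (1 - x ^ 2) ^ a

lemma integrable_cube_prod (a m : ℕ) (f : Fin m → C(ℝ, ℝ)) :
    Integrable (fun x : Fin m → ℝ => ∏ i, (f i (x i) * (1 - x i ^ 2) ^ a)) (cubeMeasure m) :=
  Integrable.fintype_prod (f := fun i x => f i x * (1 - x ^ 2) ^ a)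
    fun i => integrableOn_mul_weight a (f i)

/-- The matrix whose squared determinant gives the joint density. -/
noncomputable def orthoMatrix (a m : ℕ) (x : Fin m → ℝ) : Matrix (Fin m) (Fin m) ℝ :=
  Matrix.of fun i j => orthoPoly a j (x i)

lemma integrand_eq (a m : ℕ) (φ : Fin m → C(ℝ, ℝ)) (x : Fin m → ℝ) :
    (∏ i, φ i (x i)) * ((orthoMatrix a m x).det ^ 2 * ∏ i, (1 - x i ^ 2) ^ a) =
      ∑ σ : Equiv.Perm (Fin m), ∑ ρ : Equiv.Perm (Fin m), ((Equiv.Perm.sign ρ : ℤ) : ℝ) *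
        ∏ i, ((φ i * (orthoPoly a (σ i) * orthoPoly a (σ (ρ i)))) (x i) * (1 - x i ^ 2) ^ a) := by
  rw [det_sq_eq_sum, Finset.sum_mul, Finset.mul_sum]
  refine Finset.sum_congr rfl fun σ _ => ?_
  rw [Finset.sum_mul, Finset.mul_sum]
  refine Finset.sum_congr rfl fun ρ _ => ?_
  simp only [ContinuousMap.mul_apply, Finset.prod_mul_distrib, orthoMatrix, Matrix.of_apply]
  ring

/-- Andréief's argument: the integral factorises over the variables and the sum over `ρ` reassembles
a determinant. Rows with `φ i = 1` are identity rows by orthonormality, so one- and two-variable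
statistics need only small determinants. -/
lemma integral_det_sq (a m : ℕ) (φ : Fin m → C(ℝ, ℝ)) :
    ∫ x, (∏ i, φ i (x i)) * ((orthoMatrix a m x).det ^ 2 * ∏ i, (1 - x i ^ 2) ^ a)
      ∂cubeMeasure m =
    ∑ σ : Equiv.Perm (Fin m), (Matrix.of fun i k : Fin m =>
      unitInt a (φ i * (orthoPoly a (σ i) * orthoPoly a (σ k)))).det := by
  simp only [integrand_eq]
  rw [integral_finsetSum _ fun σ _ => integrable_finsetSum _ fun ρ _ =>
    (integrable_cube_prod a m _).const_mul _]
  refine Finset.sum_congr rfl fun σ _ => ?_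
  rw [integral_finsetSum _ fun ρ _ => (integrable_cube_prod a m _).const_mul _,
    ← Matrix.det_transpose, Matrix.det_apply']
  refine Finset.sum_congr rfl fun ρ _ => ?_
  rw [integral_const_mul, integral_cube_prod]
  rfl

lemma unitInt_orthoPoly_perm {a m : ℕ} (σ : Equiv.Perm (Fin m)) (i k : Fin m) :
    unitInt a (1 * (orthoPoly a (σ i) * orthoPoly a (σ k))) = if i = k then 1 else 0 := by
  rw [one_mul, unitInt_orthoPoly_mul]
  simp only [Fin.val_inj, EmbeddingLike.apply_eq_iff_eq]

lemma integral_det_sq_one (a m : ℕ) :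
    ∫ x, (orthoMatrix a m x).det ^ 2 * ∏ i, (1 - x i ^ 2) ^ a ∂cubeMeasure m =
      (m.factorial : ℝ) := by
  have h := integral_det_sq a m fun _ => 1
  simp only [ContinuousMap.one_apply, Finset.prod_const_one, one_mul] at h
  rw [h]
  have (σ : Equiv.Perm (Fin m)) : (Matrix.of fun i k : Fin m =>
      unitInt a (orthoPoly a (σ i) * orthoPoly a (σ k))) = 1 := by
    ext i k
    rw [Matrix.of_apply, ← one_mul (orthoPoly a (σ i) * _), unitInt_orthoPoly_perm,
      Matrix.one_apply]
  simp only [this, Matrix.det_one, Finset.sum_const, mul_one, nsmul_eq_mul]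
  rw [Finset.card_univ, Fintype.card_perm, Fintype.card_fin]

lemma integral_det_sq_single (a m : ℕ) (g : C(ℝ, ℝ)) (p : Fin m) :
    ∫ x, g (x p) * ((orthoMatrix a m x).det ^ 2 * ∏ i, (1 - x i ^ 2) ^ a) ∂cubeMeasure m =
      ∑ σ : Equiv.Perm (Fin m), unitInt a (g * (orthoPoly a (σ p) * orthoPoly a (σ p))) := by
  have h := integral_det_sq a m fun i => if i = p then g else 1
  have e (x : Fin m → ℝ) : ∏ i, (if i = p then g else 1 : C(ℝ, ℝ)) (x i) = g (x p) := by
    rw [Finset.prod_eq_single p]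
    · rw [if_pos rfl]
    · intro i _ hi
      rw [if_neg hi, ContinuousMap.one_apply]
    · simp
  simp only [e] at h
  rw [h]
  refine Finset.sum_congr rfl fun σ _ => ?_
  rw [det_eq_of_rows_one (p := p), Matrix.of_apply, if_pos rfl]
  intro i k hi
  rw [Matrix.of_apply, if_neg hi, unitInt_orthoPoly_perm]

lemma integral_det_sq_pair (a m : ℕ) (g : C(ℝ, ℝ)) {p q : Fin m} (hpq : p ≠ q) :
    ∫ x, (g (x p) * g (x q)) * ((orthoMatrix a m x).det ^ 2 * ∏ i, (1 - x i ^ 2) ^ a)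
      ∂cubeMeasure m =
      ∑ σ : Equiv.Perm (Fin m), (unitInt a (g * (orthoPoly a (σ p) * orthoPoly a (σ p))) *
        unitInt a (g * (orthoPoly a (σ q) * orthoPoly a (σ q))) -
        unitInt a (g * (orthoPoly a (σ p) * orthoPoly a (σ q))) ^ 2) := by
  have h := integral_det_sq a m fun i => if i = p ∨ i = q then g else 1
  have e (x : Fin m → ℝ) :
      ∏ i, (if i = p ∨ i = q then g else 1 : C(ℝ, ℝ)) (x i) = g (x p) * g (x q) := by
    rw [Finset.prod_eq_mul p q hpq]
    · rw [if_pos (Or.inl rfl), if_pos (Or.inr rfl)]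
    · intro i _ hi
      rw [if_neg (not_or.2 hi), ContinuousMap.one_apply]
    · simp
    · simp
  simp only [e] at h
  rw [h]
  refine Finset.sum_congr rfl fun σ _ => ?_
  rw [det_eq_of_rows_two hpq]
  · simp only [Matrix.of_apply, true_or, or_true, if_true]
    rw [mul_comm (orthoPoly a (σ q)) (orthoPoly a (σ p))]
    ring
  intro i k hp hq
  rw [Matrix.of_apply, if_neg (not_or.2 ⟨hp, hq⟩), unitInt_orthoPoly_perm]

/-! ### The eigenvalue law as a determinantal ensemble -/

/-- The column `j` is a polynomial of degree `j` in `x i ^ 2`, so the matrix is a Vandermonde matrix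
times a triangular coefficient matrix with nonzero diagonal. -/
lemma exists_det_orthoMatrix (a m : ℕ) : ∃ c : ℝ, c ≠ 0 ∧ ∀ x : Fin m → ℝ,
    (orthoMatrix a m x).det =
      c * ∏ i : Fin m, ∏ j ∈ Finset.Ioi i, (x j ^ 2 - x i ^ 2) := by
  let P : Fin m → ℝ[X] := fun j => (√(sqNorm a (2 * j) / 2))⁻¹ • evenGegen a j
  have hd (j : Fin m) : (P j).natDegree ≤ j :=
    (natDegree_smul_le _ _).trans (natDegree_evenGegen a j).le
  refine ⟨(Matrix.of fun i j : Fin m => (P j).coeff i).det, ?_, fun x => ?_⟩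
  · rw [Matrix.det_of_isUpperTriangular, Finset.prod_ne_zero_iff]
    · intro j _
      have h1 := sqNorm_pos a (2 * j)
      have h2 := leadingCoeff_ne_zero.2 (evenGegen_ne_zero a j)
      rw [leadingCoeff, natDegree_evenGegen] at h2
      rw [Matrix.of_apply, coeff_smul, smul_eq_mul]
      exact mul_ne_zero (by positivity) h2
    · intro i j hij
      exact coeff_eq_zero_of_natDegree_lt ((hd j).trans_lt hij)
  · have e : orthoMatrix a m x = Matrix.of fun i j => (P j).eval (x i ^ 2) := by
      ext i j
      simp [orthoMatrix, orthoPoly_eq_smul, P]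
    rw [e, Matrix.eval_matrixOfPolynomials_eq_vandermonde_mul_matrixOfPolynomials _ P hd,
      Matrix.det_mul, Matrix.det_vandermonde, mul_comm]

lemma exists_weight_eq {m n : ℕ} : ∃ c : ℝ, 0 < c ∧ ∀ x : Fin m → ℝ,
    weight m n x = c * ((orthoMatrix (n - m) m x).det ^ 2 * ∏ i, (1 - x i ^ 2) ^ (n - m)) := by
  obtain ⟨c, hc, h⟩ := exists_det_orthoMatrix (n - m) m
  refine ⟨(c ^ 2)⁻¹, by positivity, fun x => ?_⟩
  rw [h, weight, mul_pow, ← mul_assoc, ← mul_assoc, inv_mul_cancel₀ (by positivity), one_mul,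
    ← Finset.prod_pow]
  congr 1
  refine Finset.prod_congr rfl fun i _ => ?_
  rw [← Finset.prod_pow]
  exact Finset.prod_congr rfl fun j _ => by ring

lemma continuous_weight (m n : ℕ) : Continuous (weight m n) := by
  unfold weight
  fun_prop

instance (m : ℕ) : IsFiniteMeasure (cubeMeasure m) := by
  unfold cubeMeasure
  infer_instance

lemma ae_cube_mem (m : ℕ) : ∀ᵐ x ∂cubeMeasure m, ∀ i, x i ∈ Set.Icc (0 : ℝ) 1 := by
  rw [← volume_restrict_cube]
  filter_upwards [ae_restrict_mem (MeasurableSet.univ_pi fun _ => measurableSet_Icc)] with x hx i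
  exact hx i (Set.mem_univ i)

lemma ae_weight_nonneg (m n : ℕ) : ∀ᵐ x ∂cubeMeasure m, 0 ≤ weight m n x := by
  filter_upwards [ae_cube_mem m] with x hx
  refine mul_nonneg (Finset.prod_nonneg fun i _ => Finset.prod_nonneg fun j _ => sq_nonneg _)
    (Finset.prod_nonneg fun i _ => pow_nonneg ?_ _)
  nlinarith [(hx i).1, (hx i).2]

lemma integrable_cube {m : ℕ} {f : (Fin m → ℝ) → ℝ} (hf : Continuous f) :
    Integrable f (cubeMeasure m) := by
  rw [← volume_restrict_cube]
  exact hf.continuousOn.integrableOn_compact (isCompact_univ_pi fun _ => isCompact_Icc)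

lemma unnormalizedLaw_eq (m n : ℕ) : unnormalizedLaw m n =
    (cubeMeasure m).withDensity fun x => ENNReal.ofReal (weight m n x) := by
  rw [unnormalizedLaw, volume_restrict_cube]

lemma unnormalizedLaw_univ (m n : ℕ) : unnormalizedLaw m n Set.univ =
    ENNReal.ofReal (∫ x, weight m n x ∂cubeMeasure m) := by
  rw [unnormalizedLaw_eq, withDensity_apply _ MeasurableSet.univ, Measure.restrict_univ,
    ofReal_integral_eq_lintegral_ofReal (integrable_cube (continuous_weight m n))
    (ae_weight_nonneg m n)]

lemma integral_weight_pos (m n : ℕ) : 0 < ∫ x, weight m n x ∂cubeMeasure m := by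
  obtain ⟨c, hc, h⟩ := exists_weight_eq (m := m) (n := n)
  simp only [h]
  rw [integral_const_mul, integral_det_sq_one]
  positivity

instance isProbabilityMeasure_eigenvalueLaw (m n : ℕ) :
    IsProbabilityMeasure (eigenvalueLaw m n) := by
  constructor
  rw [eigenvalueLaw, Measure.smul_apply, smul_eq_mul, ENNReal.inv_mul_cancel]
  · rw [unnormalizedLaw_univ, Ne, ENNReal.ofReal_eq_zero, not_le]
    exact integral_weight_pos m n
  · rw [unnormalizedLaw_univ]
    exact ENNReal.ofReal_ne_top

/-- The unknown constant between the density and the squared determinant cancels on normalising; the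
squared determinant has total mass `m!`. -/
lemma integral_eigenvalueLaw (m n : ℕ) (f : (Fin m → ℝ) → ℝ) :
    ∫ x, f x ∂eigenvalueLaw m n = (m.factorial : ℝ)⁻¹ * ∫ x, f x *
      ((orthoMatrix (n - m) m x).det ^ 2 * ∏ i, (1 - x i ^ 2) ^ (n - m)) ∂cubeMeasure m := by
  obtain ⟨c, hc, h⟩ := exists_weight_eq (m := m) (n := n)
  have h1 : ∫ x, f x ∂unnormalizedLaw m n = ∫ x, c * (f x *
      ((orthoMatrix (n - m) m x).det ^ 2 * ∏ i, (1 - x i ^ 2) ^ (n - m))) ∂cubeMeasure m := by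
    rw [unnormalizedLaw_eq, integral_withDensity_eq_integral_toReal_smul
      (continuous_weight m n).measurable.ennreal_ofReal (ae_of_all _ fun _ => ENNReal.ofReal_lt_top)]
    refine integral_congr_ae ?_
    filter_upwards [ae_weight_nonneg m n] with x hx
    rw [ENNReal.toReal_ofReal hx, smul_eq_mul, h]
    ring
  rw [eigenvalueLaw, integral_smul_measure, h1, unnormalizedLaw_univ, ENNReal.toReal_inv,
    ENNReal.toReal_ofReal (integral_weight_pos m n).le]
  simp only [h]
  rw [integral_const_mul, integral_const_mul, integral_det_sq_one, smul_eq_mul]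
  have : (m.factorial : ℝ) ≠ 0 := by positivity
  field_simp

/-! ### First two moments of the entropy and the variance -/

lemma continuous_entropy (m : ℕ) : Continuous (entropy m) := by
  have := continuous_v
  unfold entropy
  fun_prop

lemma memLp_entropy (m n : ℕ) : MemLp (entropy m) 2 (eigenvalueLaw m n) := by
  have hK : IsCompact (Set.univ.pi fun _ : Fin m => Set.Icc (0 : ℝ) 1) :=
    isCompact_univ_pi fun _ => isCompact_Icc
  obtain ⟨C, hC⟩ := hK.exists_bound_of_continuousOn (continuous_entropy m).continuousOn
  refine MemLp.of_bound (continuous_entropy m).aestronglyMeasurable C ?_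
  have h1 : eigenvalueLaw m n ≪ cubeMeasure m := by
    rw [eigenvalueLaw, unnormalizedLaw_eq]
    exact (Measure.smul_absolutelyContinuous).trans (withDensity_absolutelyContinuous _ _)
  filter_upwards [h1.ae_le (ae_cube_mem m)] with x hx
  exact hC x fun i _ => hx i

lemma continuous_orthoDensity (a m : ℕ) : Continuous fun x : Fin m → ℝ =>
    (orthoMatrix a m x).det ^ 2 * ∏ i, (1 - x i ^ 2) ^ a := by
  have : Continuous fun x : Fin m → ℝ => (orthoMatrix a m x).det := by
    refine Continuous.matrix_det (continuous_matrix fun i j => ?_)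
    simp only [orthoMatrix, Matrix.of_apply]
    fun_prop
  fun_prop

lemma integral_entropy (m n : ℕ) : ∫ x, entropy m x ∂eigenvalueLaw m n =
    -∑ j : Fin m, unitInt (n - m) (vMap * (orthoPoly (n - m) j * orthoPoly (n - m) j)) := by
  have hf : (m.factorial : ℝ) ≠ 0 := by positivity
  have hv := continuous_v
  have hD := continuous_orthoDensity (n - m) m
  simp only [integral_eigenvalueLaw, entropy, neg_mul, Finset.sum_mul]
  rw [integral_neg, integral_finsetSum _ fun p _ => integrable_cube (by fun_prop), mul_neg, neg_inj]
  have := fun p => integral_det_sq_single (n - m) m vMap p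
  simp only [vMap, ContinuousMap.coe_mk] at this
  simp only [this]
  rw [Finset.sum_comm, ← vMap]
  have e (σ : Equiv.Perm (Fin m)) := Equiv.sum_comp σ fun j : Fin m =>
    unitInt (n - m) (vMap * (orthoPoly (n - m) j * orthoPoly (n - m) j))
  simp only [e, Finset.sum_const, nsmul_eq_mul, Finset.card_univ, Fintype.card_perm,
    Fintype.card_fin]
  field_simp

lemma integral_entropy_sq (m n : ℕ) : ∫ x, entropy m x ^ 2 ∂eigenvalueLaw m n =
    ∑ j : Fin m, unitInt (n - m) (vMap * vMap * (orthoPoly (n - m) j * orthoPoly (n - m) j)) +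
    ((∑ j : Fin m, unitInt (n - m) (vMap * (orthoPoly (n - m) j * orthoPoly (n - m) j))) ^ 2 -
    ∑ j : Fin m, ∑ k : Fin m,
      unitInt (n - m) (vMap * (orthoPoly (n - m) j * orthoPoly (n - m) k)) ^ 2) := by
  have hf : (m.factorial : ℝ) ≠ 0 := by positivity
  have hv := continuous_v
  have hD := continuous_orthoDensity (n - m) m
  obtain ⟨A, hA⟩ : ∃ A : Fin m → ℝ, ∀ j : Fin m, unitInt (n - m)
      (vMap * vMap * (orthoPoly (n - m) j * orthoPoly (n - m) j)) = A j := ⟨_, fun _ => rfl⟩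
  obtain ⟨g, hg⟩ : ∃ g : Fin m → Fin m → ℝ, ∀ j k : Fin m, unitInt (n - m)
      (vMap * (orthoPoly (n - m) j * orthoPoly (n - m) k)) = g j k := ⟨_, fun _ _ => rfl⟩
  -- The two-row determinant vanishes for `j = k`, so one function `G` covers `p = q` (giving `v²`)
  -- and `p ≠ q`, and summing over permutations runs over all pairs.
  obtain ⟨G, hG⟩ : ∃ G : Fin m → Fin m → ℝ, ∀ j k, G j k =
      (if j = k then A j else 0) + (g j j * g k k - g j k ^ 2) := ⟨_, fun _ _ => rfl⟩
  have pair (p q : Fin m) : ∫ x, (v (x p) * v (x q)) *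
      ((orthoMatrix (n - m) m x).det ^ 2 * ∏ i, (1 - x i ^ 2) ^ (n - m)) ∂cubeMeasure m =
      ∑ σ : Equiv.Perm (Fin m), G (σ p) (σ q) := by
    rcases eq_or_ne p q with rfl | hpq
    · refine (integral_det_sq_single (n - m) m (vMap * vMap) p).trans ?_
      refine Finset.sum_congr rfl fun σ _ => ?_
      rw [hA, hG, if_pos rfl]
      ring
    · refine (integral_det_sq_pair (n - m) m vMap hpq).trans ?_
      refine Finset.sum_congr rfl fun σ _ => ?_
      rw [hg, hg, hg, hG, if_neg fun h => hpq (σ.injective h), zero_add]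
  have hS (x : Fin m → ℝ) : entropy m x ^ 2 = ∑ p, ∑ q, v (x p) * v (x q) := by
    rw [entropy, neg_sq, sq, Finset.sum_mul_sum]
  have perm (σ : Equiv.Perm (Fin m)) : ∑ p, ∑ q, G (σ p) (σ q) = ∑ j, ∑ k, G j k := by
    rw [← Equiv.sum_comp σ fun j => ∑ k, G j k]
    exact Finset.sum_congr rfl fun p _ => Equiv.sum_comp σ fun k => G (σ p) k
  have total : ∑ p, ∑ q, ∑ σ : Equiv.Perm (Fin m), G (σ p) (σ q) =
      m.factorial * ∑ j, ∑ k, G j k := by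
    rw [Finset.sum_congr rfl fun p _ => Finset.sum_comm, Finset.sum_comm,
      Finset.sum_congr rfl fun σ _ => perm σ, Finset.sum_const, nsmul_eq_mul, Finset.card_univ,
      Fintype.card_perm, Fintype.card_fin]
  simp only [integral_eigenvalueLaw, hS, Finset.sum_mul]
  rw [integral_finsetSum _ fun p _ => integrable_cube (by fun_prop),
    Finset.sum_congr rfl fun p _ => integral_finsetSum _ fun q _ => integrable_cube (by fun_prop)]
  simp only [pair]
  rw [total, inv_mul_cancel_left₀ hf]
  simp only [hA, hg, hG, Finset.sum_add_distrib, Finset.sum_sub_distrib, Finset.sum_ite_eq,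
    Finset.mem_univ, if_true]
  rw [sq (∑ j, g j j), Finset.sum_mul_sum]

end FermionicGaussian

theorem proposition3 (m n : ℕ) (hm : 1 ≤ m) (hmn : m ≤ n) :
    IsProbabilityMeasure (FermionicGaussian.eigenvalueLaw m n) ∧
    MemLp (FermionicGaussian.entropy m) 2 (FermionicGaussian.eigenvalueLaw m n) ∧
    variance (FermionicGaussian.entropy m) (FermionicGaussian.eigenvalueLaw m n) =
      (1 / 2 - (m : ℝ) - n) * FermionicGaussian.trigamma (2 * m + 2 * n)
        + ((n : ℝ) - 1 / 2) * FermionicGaussian.trigamma (2 * n)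
        + ((m : ℝ) * (2 * m + n - 1) / (2 * m + 2 * n - 1) - 1 / 8)
            * FermionicGaussian.trigamma (m + n)
        + FermionicGaussian.trigamma n / 8
        - 1 / 2 * (FermionicGaussian.digamma (2 * m + 2 * n)
            - FermionicGaussian.digamma (2 * n)) := by
  refine ⟨FermionicGaussian.isProbabilityMeasure_eigenvalueLaw m n,
    FermionicGaussian.memLp_entropy m n, ?_⟩
  have h := FermionicGaussian.sum_unitInt_sub_sum_sq (n - m) m hm
  have hn : (m : ℝ) + ((n - m : ℕ) : ℝ) = n := by
    rw [Nat.cast_sub hmn]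
    ring
  rw [hn, FermionicGaussian.varianceFormula] at h
  -- The squared mean cancels against the product part of the second moment, leaving the expression
  -- that Parseval's identity evaluates.
  rw [variance_eq_sub (FermionicGaussian.memLp_entropy m n), ← h]
  simp only [Pi.pow_apply]
  rw [FermionicGaussian.integral_entropy_sq, FermionicGaussian.integral_entropy,
    Finset.sum_sub_distrib]
  simp only [Finset.sum_range]
  ring
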